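/- Let $k$ be a field and $D=\mathrm{Hom}_k(-,k)$; bimodules over $k$-algebras have $k$ acting centrally. Let $A$ be a finite dimensional semisimple $k$-algebra with a fixed symmetrising element $\sigma\in DA$ (so $\sigma(ab)=\sigma(ba)$, and $\sigma(a\,-)=0$ implies $a=0$), let $M$ be a finite dimensional $A$-bimodule, and assume that the (hereditary) tensor algebra $\Lambda=T_A(M)=A\oplus M\oplus (M\otimes_AM)\oplus\cdots$ is finite dimensional. For a right $A$-module $X$ and $\xi\in DX$ let $\xi^{r}\colon X\to A$ be the right $A$-linear map with $\sigma\xi^{r}=\xi$; for a left $A$-module $X$ and $\xi\in DX$ let $\xi^{l}\colon X\to A$ be the left $A$-linear map with $\sigma\xi^{l}=\xi$. Let $\Omega$ be the kernel of the multiplication map $\Lambda\otimes_A\Lambda\to\Lambda$, put $d\lambda=1\otimes\lambda-\lambda\otimes1\in\Omega$ and $$\mho=D(D\Lambda\otimes_\Lambda\Omega\otimes_\Lambda D\Lambda),$$ and let $\bar c\in\mho$ be the functional with $\bar c(\theta\otimes d\lambda\otimes\phi)=\theta(\phi^{l}(\lambda))-\phi(\theta^{r}(\lambda))$. Let $\Pi_1$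 be the cokernel of the $\Lambda$-bimodule homomorphism $\Lambda\otimes_A\Lambda\to\mho$, $1\otimes1\mapsto\bar c$, and let $\tau^-\Lambda=\mathrm{Ext}^1_\Lambda(D\Lambda,\Lambda)$ (extensions of left $\Lambda$-modules, a $\Lambda$-bimodule by functoriality). **Theorem.** (1) There are unique elements $\rho=\sum m_i\otimes\mu_i\in M\otimes_ADM$ and $\ell=\sum\nu_j\otimes n_j\in DM\otimes_AM$ corresponding to the identities of $M_A$ and ${}_AM$, i.e. with $m=\sum m_i\,\mu_i^{r}(m)$ and $m=\sum\nu_j^{l}(m)\,n_j$ for all $m\in M$. Put $c=\rho-\ell\in T_A(M\oplus DM)$. There is an isomorphism of $k$-algebras $$T_\Lambda(\mho)\;\cong\;T_A(M\oplus DM)$$ which restricts to the canonical map on $\Lambda=T_A(M)$ and sends $\bar c$ to $c$. Moreover the preprojective algebra of $\Lambda$ is isomorphic, as a $k$-algebra, to the quotient by the two-sided ideal generated by $c$: $$T_\Lambda(\Pi_1)\;\cong\;T_A(M\oplus DM)/\langle c\rangle\qquad\text{and}\qquad T_\Lambda(\tau^-\Lambda)\;\cong\;T_A(M\oplus DM)/\langle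 c\rangle .$$ (2) Let $Q$ be a quiver with finite vertex set $V$ and finitely many arrows. Let $A=k^V$ with $\sigma$ the sum of the coordinates, let $M$ be the $A$-bimodule with basis the arrows of $Q$ (an arrow $a\colon i\to j$ lying in $e_iMe_j$), and let $(a^*)$ be the dual basis of $DM$. Then $T_A(M)\cong kQ$ by the isomorphism sending $e_i$ to the trivial path at $i$ and each arrow to itself. One has $\rho=\sum_a a\otimes a^*$ and $\ell=\sum_a a^*\otimes a$. Let $\bar Q$ be the double quiver, with an additional arrow $a^*\colon j\to i$ for each arrow $a\colon i\to j$ of $Q$. There is an isomorphism $T_A(M\oplus DM)\cong k\bar Q$ sending $e_i$ to the trivial path at $i$, $a\mapsto a$, $a^*\mapsto a^*$ and $c\mapsto\sum_a[a,a^*]$, so that $T_A(M\oplus DM)/\langle c\rangle\cong k\bar Q/\langle\sum_a[a,a^*]\rangle$. In particular, if $kQ$ is finite dimensional, then for $\Lambda=T_A(M)\cong kQ$ one has $T_\Lambda(\tau^-\Lambda)\cong k\bar Q/\langle\sum_a[a,a^*]\rangle$. -/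

import Mathlib

/-
Conventions.  `k` is a field.  An `A`-bimodule on which `k` acts centrally is a type `M` with
`Module k M`, `Module A M` (left action), `Module Aᵐᵒᵖ M` (right action, `m · a = op a • m`),
`SMulCommClass A Aᵐᵒᵖ M`, `IsScalarTower k A M`, `IsScalarTower k Aᵐᵒᵖ M`.
-/

universe u

set_option linter.unusedSectionVars false

noncomputable section

namespace Preproj

open scoped TensorProduct
open MulOpposite CategoryTheory

/-! ### The tensor algebra of a bimodule over a noncommutative algebra -/

section TensorAlg

variable (k : Type*) [Field k] (A : Type*) [Ring A] [Algebra k A]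
  (M : Type*) [AddCommGroup M] [Module A M] [Module Aᵐᵒᵖ M]

/-- The relations defining the tensor algebra of the `A`-bimodule `M`: the generators coming from
`A` multiply, add and scale as in `A`, those from `M` add as in `M`, and the product of a generator
from `A` and a generator from `M` (in either order) is given by the actions of `A` on `M`. -/
inductive TensorAlg.Rel : FreeAlgebra k (A ⊕ M) → FreeAlgebra k (A ⊕ M) → Prop
  | base_algebraMap (r : k) :
      Rel (FreeAlgebra.ι k (Sum.inl (algebraMap k A r))) (algebraMap k _ r)
  | base_add (a b : A) : Rel (FreeAlgebra.ι k (Sum.inl (a + b)))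
      (FreeAlgebra.ι k (Sum.inl a) + FreeAlgebra.ι k (Sum.inl b))
  | base_mul (a b : A) : Rel (FreeAlgebra.ι k (Sum.inl (a * b)))
      (FreeAlgebra.ι k (Sum.inl a) * FreeAlgebra.ι k (Sum.inl b))
  | add (m n : M) : Rel (FreeAlgebra.ι k (Sum.inr (m + n)))
      (FreeAlgebra.ι k (Sum.inr m) + FreeAlgebra.ι k (Sum.inr n))
  | left (a : A) (m : M) : Rel (FreeAlgebra.ι k (Sum.inr (a • m)))
      (FreeAlgebra.ι k (Sum.inl a) * FreeAlgebra.ι k (Sum.inr m))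
  | right (a : A) (m : M) : Rel (FreeAlgebra.ι k (Sum.inr (op a • m)))
      (FreeAlgebra.ι k (Sum.inr m) * FreeAlgebra.ι k (Sum.inl a))

/-- The tensor algebra `T_A(M) = A ⊕ M ⊕ (M ⊗_A M) ⊕ ⋯` of the `A`-bimodule `M`. As for Mathlib's
`TensorAlgebra` (the case of commutative `A`), it is constructed as the universal `k`-algebra
containing an image of `A` and an image of `M`, as a quotient of a free algebra. -/
def TensorAlg : Type _ := RingQuot (TensorAlg.Rel k A M)

namespace TensorAlg

instance : Ring (TensorAlg k A M) := inferInstanceAs (Ring (RingQuot _))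
instance : Algebra k (TensorAlg k A M) := inferInstanceAs (Algebra k (RingQuot _))

/-- The structure map `A → T_A(M)`. -/
def base : A →ₐ[k] TensorAlg k A M where
  toFun a := RingQuot.mkAlgHom k (Rel k A M) (FreeAlgebra.ι k (Sum.inl a))
  map_one' := by
    rw [← map_one (algebraMap k A), RingQuot.mkAlgHom_rel k (Rel.base_algebraMap 1)]
    simp only [map_one]; rfl
  map_mul' a b := by
    rw [RingQuot.mkAlgHom_rel k (Rel.base_mul a b), map_mul]; rfl
  map_zero' := by
    rw [← map_zero (algebraMap k A), RingQuot.mkAlgHom_rel k (Rel.base_algebraMap 0)]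
    simp only [map_zero]; rfl
  map_add' a b := by
    rw [RingQuot.mkAlgHom_rel k (Rel.base_add a b), map_add]; rfl
  commutes' r := by
    rw [RingQuot.mkAlgHom_rel k (Rel.base_algebraMap r), AlgHom.commutes]; rfl

/-- The canonical map `M → T_A(M)`. -/
def ι : M →+ TensorAlg k A M :=
  AddMonoidHom.mk' (fun m => RingQuot.mkAlgHom k (Rel k A M) (FreeAlgebra.ι k (Sum.inr m)))
    (fun m n => by rw [RingQuot.mkAlgHom_rel k (Rel.add m n), map_add]; rfl)

variable {A M}

lemma ι_smul (a : A) (m : M) : ι k A M (a • m) = base k A M a * ι k A M m := by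
  change RingQuot.mkAlgHom k (Rel k A M) _ = _
  rw [RingQuot.mkAlgHom_rel k (Rel.left a m), map_mul]; rfl

lemma ι_op_smul (a : A) (m : M) : ι k A M (op a • m) = ι k A M m * base k A M a := by
  change RingQuot.mkAlgHom k (Rel k A M) _ = _
  rw [RingQuot.mkAlgHom_rel k (Rel.right a m), map_mul]; rfl

variable (A M)

/-- `T_A(M)` as an `A`-bimodule, through the structure map `A → T_A(M)`. -/
instance : Module A (TensorAlg k A M) := Module.compHom _ (base k A M).toRingHom
instance : Module Aᵐᵒᵖ (TensorAlg k A M) :=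
  Module.compHom _ (RingHom.op (base k A M).toRingHom)

end TensorAlg

end TensorAlg

/-- `Λ` is an algebra over `A`, i.e. its `A`-bimodule structure is given by multiplication with
the images of the elements of `A` under the ring homomorphism `A → Λ`, `a ↦ a • 1`. -/
class IsAlgebraOver (A Λ : Type*) [Ring A] [Ring Λ] [Module A Λ] [Module Aᵐᵒᵖ Λ] : Prop where
  smul_mul' : ∀ (a : A) (x y : Λ), (a • x) * y = a • (x * y)
  mul_op_smul' : ∀ (a : A) (x y : Λ), x * (op a • y) = op a • (x * y)
  smul_one' : ∀ a : A, a • (1 : Λ) = op a • (1 : Λ)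

section IsAlgebraOver

variable {A Λ : Type*} [Ring A] [Ring Λ] [Module A Λ] [Module Aᵐᵒᵖ Λ] [IsAlgebraOver A Λ]

lemma smul_eq (a : A) (x : Λ) : a • x = (a • (1 : Λ)) * x := by
  rw [IsAlgebraOver.smul_mul', one_mul]

lemma op_smul_eq (a : A) (x : Λ) : op a • x = x * (a • (1 : Λ)) := by
  rw [IsAlgebraOver.smul_one', IsAlgebraOver.mul_op_smul', mul_one]

end IsAlgebraOver

instance (k A M : Type*) [Field k] [Ring A] [Algebra k A] [AddCommGroup M] [Module A M]
    [Module Aᵐᵒᵖ M] : IsAlgebraOver A (TensorAlg k A M) where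
  smul_mul' a x y := mul_assoc (TensorAlg.base k A M a) x y
  mul_op_smul' a x y := (mul_assoc x y (TensorAlg.base k A M a)).symm
  smul_one' a := (mul_one (TensorAlg.base k A M a)).trans (one_mul (TensorAlg.base k A M a)).symm

instance (k A M : Type*) [Field k] [Ring A] [Algebra k A] [AddCommGroup M] [Module A M]
    [Module Aᵐᵒᵖ M] : IsScalarTower k A (TensorAlg k A M) where
  smul_assoc r a x := by
    change TensorAlg.base k A M (r • a) * x = r • (TensorAlg.base k A M a * x)
    rw [map_smul, smul_mul_assoc]

instance (k A M : Type*) [Field k] [Ring A] [Algebra k A] [AddCommGroup M] [Module A M]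
    [Module Aᵐᵒᵖ M] : IsScalarTower k Aᵐᵒᵖ (TensorAlg k A M) where
  smul_assoc r a x := by
    change x * TensorAlg.base k A M (r • a.unop) = r • (x * TensorAlg.base k A M a.unop)
    rw [map_smul, mul_smul_comm]

/-! ### The tensor product over a noncommutative ring -/

section BTensor

variable (k A : Type*) [Field k] [Ring A]
  (X Y : Type*) [AddCommGroup X] [AddCommGroup Y] [Module k X] [Module k Y]
  [Module Aᵐᵒᵖ X] [Module A Y]

/-- The tensor product `X ⊗_A Y` of a right `A`-module `X` and a left `A`-module `Y`:
the quotient of `X ⊗_k Y` by the elements `xa ⊗ y - x ⊗ ay`. -/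
def BTensor : Type _ :=
  (X ⊗[k] Y) ⧸ Submodule.span k
    {t : X ⊗[k] Y | ∃ (x : X) (a : A) (y : Y), t = (op a • x) ⊗ₜ[k] y - x ⊗ₜ[k] (a • y)}

namespace BTensor

instance : AddCommGroup (BTensor k A X Y) := inferInstanceAs (AddCommGroup (_ ⧸ _))
instance (priority := 2000) instModuleField : Module k (BTensor k A X Y) :=
  inferInstanceAs (Module k (_ ⧸ _))
instance (priority := 2000) instSMulField : SMul k (BTensor k A X Y) :=
  (instModuleField k A X Y).toSMul

variable {X Y}

/-- The pure tensor `x ⊗ y` in `X ⊗_A Y`. -/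
def tmul (x : X) (y : Y) : BTensor k A X Y := Submodule.Quotient.mk (x ⊗ₜ[k] y)

variable {k A}

lemma tmul_add (x : X) (y y' : Y) :
    tmul k A x (y + y') = tmul k A x y + tmul k A x y' := by
  simp only [tmul, TensorProduct.tmul_add]; rfl

lemma add_tmul (x x' : X) (y : Y) :
    tmul k A (x + x') y = tmul k A x y + tmul k A x' y := by
  simp only [tmul, TensorProduct.add_tmul]; rfl

lemma smul_tmul (r : k) (x : X) (y : Y) :
    tmul k A (r • x) y = r • tmul k A x y := rfl

lemma tmul_smul (r : k) (x : X) (y : Y) :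
    tmul k A x (r • y) = r • tmul k A x y := by
  simp only [tmul, TensorProduct.tmul_smul]; rfl

lemma op_smul_tmul (a : A) (x : X) (y : Y) :
    tmul k A (op a • x) y = tmul k A x (a • y) :=
  (Submodule.Quotient.eq _).2 (Submodule.subset_span ⟨x, a, y, rfl⟩)

lemma induction_on {p : BTensor k A X Y → Prop} (t : BTensor k A X Y)
    (zero : p 0) (tmul : ∀ x y, p (tmul k A x y))
    (add : ∀ s t, p s → p t → p (s + t)) : p t := by
  obtain ⟨t, rfl⟩ := Submodule.Quotient.mk_surjective _ t
  induction t with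
  | zero => exact zero
  | tmul x y => exact tmul x y
  | add s t hs ht => exact add _ _ hs ht

/-- The linear map out of `X ⊗_A Y` given by an `A`-balanced bilinear map. -/
def lift {Z : Type*} [AddCommGroup Z] [Module k Z] (f : X →ₗ[k] Y →ₗ[k] Z)
    (hf : ∀ (x : X) (a : A) (y : Y), f (op a • x) y = f x (a • y)) : BTensor k A X Y →ₗ[k] Z :=
  Submodule.liftQ _ (TensorProduct.lift f) (by
    rw [Submodule.span_le]
    rintro _ ⟨x, a, y, rfl⟩
    simp [hf])

@[simp] lemma lift_tmul {Z : Type*} [AddCommGroup Z] [Module k Z] (f : X →ₗ[k] Y →ₗ[k] Z)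
    (hf : ∀ (x : X) (a : A) (y : Y), f (op a • x) y = f x (a • y)) (x : X) (y : Y) :
    lift f hf (tmul k A x y) = f x y := by
  change TensorProduct.lift f (x ⊗ₜ[k] y) = _
  simp

lemma hom_ext {Z : Type*} [AddCommGroup Z] [Module k Z] {f g : BTensor k A X Y →ₗ[k] Z}
    (h : ∀ x y, f (tmul k A x y) = g (tmul k A x y)) : f = g := by
  ext t
  induction t using induction_on with
  | zero => simp
  | tmul x y => exact h x y
  | add s t hs ht => simp [hs, ht]

/-- The pure tensor as a bilinear map. -/
def tmulₗ : X →ₗ[k] Y →ₗ[k] BTensor k A X Y :=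
  LinearMap.mk₂ k (tmul k A) add_tmul smul_tmul tmul_add tmul_smul

lemma zero_tmul (y : Y) : tmul k A (0 : X) y = 0 := by
  simp only [tmul, TensorProduct.zero_tmul]; rfl

/-- Functoriality of the tensor product. -/
def map (f : X →ₗ[k] X) (g : Y →ₗ[k] Y) (hf : ∀ (a : A) (x : X), f (op a • x) = op a • f x)
    (hg : ∀ (a : A) (y : Y), g (a • y) = a • g y) : BTensor k A X Y →ₗ[k] BTensor k A X Y :=
  lift ((tmulₗ.compl₁₂ f g)) (fun x a y => by
    simp [tmulₗ, hf, hg, op_smul_tmul])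

@[simp] lemma map_tmul (f : X →ₗ[k] X) (g : Y →ₗ[k] Y)
    (hf : ∀ (a : A) (x : X), f (op a • x) = op a • f x)
    (hg : ∀ (a : A) (y : Y), g (a • y) = a • g y) (x : X) (y : Y) :
    map f g hf hg (tmul k A x y) = tmul k A (f x) (g y) := by
  simp [map, tmulₗ]

section Left

variable {L : Type*} [Ring L] [Module L X] [SMulCommClass L k X] [SMulCommClass L Aᵐᵒᵖ X]

/-- The left action on `X ⊗_A Y` for an `L`-`A`-bimodule `X`: `l (x ⊗ y) = lx ⊗ y`. -/
instance instSMulLeft : SMul L (BTensor k A X Y) where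
  smul l := map (DistribSMul.toLinearMap k X l) LinearMap.id
    (fun a x => smul_comm l (op a) x) (fun _ _ => rfl)

lemma smul_tmul_left (l : L) (x : X) (y : Y) :
    l • tmul k A x y = tmul k A (l • x) y := map_tmul _ _ _ _ x y

private lemma smul_add_left (l : L) (s t : BTensor k A X Y) : l • (s + t) = l • s + l • t :=
  map_add (map (DistribSMul.toLinearMap k X l) LinearMap.id
    (fun a x => smul_comm l (op a) x) (fun _ _ => rfl)) s t

private lemma smul_zero_left (l : L) : l • (0 : BTensor k A X Y) = 0 :=
  map_zero (map (DistribSMul.toLinearMap k X l) LinearMap.id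
    (fun a x => smul_comm l (op a) x) (fun _ _ => rfl))

instance instModuleLeft : Module L (BTensor k A X Y) where
  one_smul t := by
    induction t using induction_on with
    | zero => exact smul_zero_left _
    | tmul x y => rw [smul_tmul_left, one_smul]
    | add s t hs ht => rw [smul_add_left, hs, ht]
  mul_smul l l' t := by
    induction t using induction_on with
    | zero => simp only [smul_zero_left]
    | tmul x y => simp only [smul_tmul_left, mul_smul]
    | add s t hs ht => simp only [smul_add_left, hs, ht]
  smul_zero := smul_zero_left
  smul_add := smul_add_left
  add_smul l l' t := by
    induction t using induction_on with
    | zero => simp only [smul_zero_left, add_zero]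
    | tmul x y => simp only [smul_tmul_left, add_smul, add_tmul]
    | add s t hs ht => simp only [smul_add_left, hs, ht]; abel
  zero_smul t := by
    induction t using induction_on with
    | zero => exact smul_zero_left _
    | tmul x y => rw [smul_tmul_left, zero_smul, ← zero_smul k x, smul_tmul, zero_smul]
    | add s t hs ht => rw [smul_add_left, hs, ht, add_zero]

instance : SMulCommClass L k (BTensor k A X Y) where
  smul_comm l r t := map_smul (map (DistribSMul.toLinearMap k X l) LinearMap.id
    (fun a x => smul_comm l (op a) x) (fun _ _ => rfl)) r t

instance [Algebra k L] [IsScalarTower k L X] : IsScalarTower k L (BTensor k A X Y) where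
  smul_assoc r l t := by
    induction t using induction_on with
    | zero => simp only [smul_zero]
    | tmul x y => rw [smul_tmul_left, smul_tmul_left, smul_assoc, smul_tmul]
    | add s t hs ht => simp only [smul_add, hs, ht]

end Left

section Right

variable {R : Type*} [Ring R] [Module Rᵐᵒᵖ Y] [SMulCommClass Rᵐᵒᵖ k Y] [SMulCommClass A Rᵐᵒᵖ Y]

/-- The right action on `X ⊗_A Y` for an `A`-`R`-bimodule `Y`: `(x ⊗ y) r = x ⊗ yr`. -/
instance instSMulRight : SMul Rᵐᵒᵖ (BTensor k A X Y) where
  smul r := map LinearMap.id (DistribSMul.toLinearMap k Y r)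
    (fun _ _ => rfl) (fun a y => (smul_comm a r y).symm)

lemma op_smul_tmul_right (r : Rᵐᵒᵖ) (x : X) (y : Y) :
    r • tmul k A x y = tmul k A x (r • y) := map_tmul _ _ _ _ x y

private lemma smul_add_right (r : Rᵐᵒᵖ) (s t : BTensor k A X Y) : r • (s + t) = r • s + r • t :=
  map_add (map LinearMap.id (DistribSMul.toLinearMap k Y r)
    (fun _ _ => rfl) (fun a y => (smul_comm a r y).symm)) s t

private lemma smul_zero_right (r : Rᵐᵒᵖ) : r • (0 : BTensor k A X Y) = 0 :=
  map_zero (map LinearMap.id (DistribSMul.toLinearMap k Y r)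
    (fun _ _ => rfl) (fun a y => (smul_comm a r y).symm))

instance instModuleRight : Module Rᵐᵒᵖ (BTensor k A X Y) where
  one_smul t := by
    induction t using induction_on with
    | zero => exact smul_zero_right _
    | tmul x y => rw [op_smul_tmul_right, one_smul]
    | add s t hs ht => rw [smul_add_right, hs, ht]
  mul_smul l l' t := by
    induction t using induction_on with
    | zero => simp only [smul_zero_right]
    | tmul x y => simp only [op_smul_tmul_right, mul_smul]
    | add s t hs ht => simp only [smul_add_right, hs, ht]
  smul_zero := smul_zero_right
  smul_add := smul_add_right
  add_smul l l' t := by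
    induction t using induction_on with
    | zero => simp only [smul_zero_right, add_zero]
    | tmul x y => simp only [op_smul_tmul_right, add_smul, tmul_add]
    | add s t hs ht => simp only [smul_add_right, hs, ht]; abel
  zero_smul t := by
    induction t using induction_on with
    | zero => exact smul_zero_right _
    | tmul x y => rw [op_smul_tmul_right, zero_smul, ← zero_smul k y, tmul_smul, zero_smul]
    | add s t hs ht => rw [smul_add_right, hs, ht, add_zero]

instance : SMulCommClass Rᵐᵒᵖ k (BTensor k A X Y) where
  smul_comm l r t := map_smul (map LinearMap.id (DistribSMul.toLinearMap k Y l)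
    (fun _ _ => rfl) (fun a y => (smul_comm a l y).symm)) r t

instance [Algebra k R] [IsScalarTower k Rᵐᵒᵖ Y] : IsScalarTower k Rᵐᵒᵖ (BTensor k A X Y) where
  smul_assoc r l t := by
    induction t using induction_on with
    | zero => simp only [smul_zero]
    | tmul x y => rw [op_smul_tmul_right, op_smul_tmul_right, smul_assoc, tmul_smul]
    | add s t hs ht => simp only [smul_add, hs, ht]

end Right

instance {L R : Type*} [Ring L] [Module L X] [SMulCommClass L k X] [SMulCommClass L Aᵐᵒᵖ X]
    [Ring R] [Module Rᵐᵒᵖ Y] [SMulCommClass Rᵐᵒᵖ k Y] [SMulCommClass A Rᵐᵒᵖ Y] :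
    SMulCommClass L Rᵐᵒᵖ (BTensor k A X Y) where
  smul_comm l r t := by
    induction t using induction_on with
    | zero => simp only [smul_zero]
    | tmul x y => simp only [op_smul_tmul_right, smul_tmul_left]
    | add s t hs ht => simp only [smul_add, hs, ht]

end BTensor

end BTensor

/-! ### The vector space dual of a bimodule -/

section BDual

variable (k : Type*) [Field k] (X : Type*) [AddCommGroup X] [Module k X]

/-- The vector space dual `DX = Hom_k(X, k)`; a type synonym carrying the bimodule structure
`(a ξ)(x) = ξ(x a)`, `(ξ a)(x) = ξ(a x)`. -/
def BDual : Type _ := X →ₗ[k] k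

namespace BDual

instance : AddCommGroup (BDual k X) := inferInstanceAs (AddCommGroup (X →ₗ[k] k))

instance : FunLike (BDual k X) X k := inferInstanceAs (FunLike (X →ₗ[k] k) X k)

variable {k X}

/-- A linear functional, viewed as an element of the bimodule `DX`. -/
def ofDual (f : X →ₗ[k] k) : BDual k X := f

/-- An element of the bimodule `DX`, viewed as a linear functional. -/
def toDual (f : BDual k X) : X →ₗ[k] k := f

@[ext] lemma ext {f g : BDual k X} (h : ∀ x, f x = g x) : f = g := LinearMap.ext h

variable {R L : Type*} [Ring R] [Ring L]

instance [Module Rᵐᵒᵖ X] [SMulCommClass Rᵐᵒᵖ k X] : Module R (BDual k X) where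
  smul a ξ := ofDual (ξ.toDual ∘ₗ DistribSMul.toLinearMap k X (op a))
  one_smul ξ := ext fun x => congrArg ξ (one_smul _ x)
  mul_smul a b ξ := ext fun x => congrArg ξ (mul_smul (op b) (op a) x)
  smul_zero _ := rfl
  smul_add _ _ _ := rfl
  add_smul a b ξ := ext fun x =>
    (congrArg ξ (add_smul (op a) (op b) x)).trans (map_add ξ.toDual _ _)
  zero_smul ξ := ext fun x => (congrArg ξ (zero_smul Rᵐᵒᵖ x)).trans (map_zero ξ.toDual)

instance [Module L X] [SMulCommClass L k X] : Module Lᵐᵒᵖ (BDual k X) where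
  smul a ξ := ofDual (ξ.toDual ∘ₗ DistribSMul.toLinearMap k X a.unop)
  one_smul ξ := ext fun x => congrArg ξ (one_smul _ x)
  mul_smul a b ξ := ext fun x => congrArg ξ (mul_smul b.unop a.unop x)
  smul_zero _ := rfl
  smul_add _ _ _ := rfl
  add_smul a b ξ := ext fun x =>
    (congrArg ξ (add_smul a.unop b.unop x)).trans (map_add ξ.toDual _ _)
  zero_smul ξ := ext fun x => (congrArg ξ (zero_smul L x)).trans (map_zero ξ.toDual)

instance (priority := 2000) : Module k (BDual k X) := inferInstanceAs (Module k (X →ₗ[k] k))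

lemma smul_apply [Module Rᵐᵒᵖ X] [SMulCommClass Rᵐᵒᵖ k X] (a : R) (ξ : BDual k X) (x : X) :
    (a • ξ) x = ξ (op a • x) := rfl

lemma op_smul_apply [Module L X] [SMulCommClass L k X] (a : L) (ξ : BDual k X) (x : X) :
    (op a • ξ) x = ξ (a • x) := rfl

lemma add_apply (ξ η : BDual k X) (x : X) : (ξ + η) x = ξ x + η x := rfl

lemma field_smul_apply (r : k) (ξ : BDual k X) (x : X) : (r • ξ) x = r * ξ x := rfl

instance [Module L X] [SMulCommClass L k X] [Module Rᵐᵒᵖ X] [SMulCommClass Rᵐᵒᵖ k X]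
    [SMulCommClass L Rᵐᵒᵖ X] : SMulCommClass R Lᵐᵒᵖ (BDual k X) where
  smul_comm a b ξ := ext fun x => congrArg ξ (smul_comm b.unop (op a) x)

instance [Module Rᵐᵒᵖ X] [SMulCommClass Rᵐᵒᵖ k X] : SMulCommClass R k (BDual k X) where
  smul_comm _ _ _ := rfl

instance [Module L X] [SMulCommClass L k X] : SMulCommClass Lᵐᵒᵖ k (BDual k X) where
  smul_comm _ _ _ := rfl

instance [Algebra k R] [Module Rᵐᵒᵖ X] [IsScalarTower k Rᵐᵒᵖ X] :
    IsScalarTower k R (BDual k X) where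
  smul_assoc r a ξ := ext fun x => by
    rw [smul_apply, MulOpposite.op_smul, smul_assoc]; exact map_smul ξ.toDual r (op a • x)

instance [Algebra k L] [Module L X] [IsScalarTower k L X] :
    IsScalarTower k Lᵐᵒᵖ (BDual k X) where
  smul_assoc r a ξ := ext fun x => by
    change ξ ((r • a.unop) • x) = _
    rw [smul_assoc]; exact map_smul ξ.toDual r (a.unop • x)

end BDual

end BDual

/-! ### Symmetrising elements and the maps `ξ ↦ ♯ξ` -/

/-- A symmetrising element `σ ∈ DA`: `σ(ab) = σ(ba)`, and `σ(a -) = 0` implies `a = 0`. -/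
structure SymmetrisingElement (k A : Type*) [Field k] [Ring A] [Algebra k A] where
  toFun : A →ₗ[k] k
  symm' : ∀ a b, toFun (a * b) = toFun (b * a)
  nondeg' : ∀ a, (∀ b, toFun (a * b) = 0) → a = 0

namespace SymmetrisingElement

variable {k A : Type*} [Field k] [Ring A] [Algebra k A] [FiniteDimensional k A]
  (σ : SymmetrisingElement k A)

/-- The isomorphism `A ≅ DA`, `a ↦ σ(a -)`. -/
def equivDual : A ≃ₗ[k] Module.Dual k A :=
  LinearEquiv.ofInjectiveOfFinrankEq ((LinearMap.mul k A).compr₂ σ.toFun)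
    ((injective_iff_map_eq_zero _).2 fun a ha =>
      σ.nondeg' a fun b => by simpa using LinearMap.congr_fun ha b)
    Subspace.dual_finrank_eq.symm

lemma apply_equivDual_symm_mul (f : Module.Dual k A) (b : A) :
    σ.toFun (σ.equivDual.symm f * b) = f b := by
  have : σ.equivDual (σ.equivDual.symm f) b = f b := LinearMap.congr_fun (σ.equivDual.apply_symm_apply f) b
  exact this

lemma eq_of_forall {a a' : A} (h : ∀ b, σ.toFun (a * b) = σ.toFun (a' * b)) : a = a' :=
  sub_eq_zero.1 (σ.nondeg' _ fun b => by rw [sub_mul, map_sub, h, sub_self])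

variable {X : Type*} [AddCommGroup X] [Module k X]

section Right

variable [Module Aᵐᵒᵖ X] [SMulCommClass Aᵐᵒᵖ k X] [IsScalarTower k Aᵐᵒᵖ X]

/-- For a right `A`-module `X`, `ξ ∈ DX` and `x ∈ X`, the element `♯ξ(x)` of `A`, where
`♯ξ : X → A` is the right `A`-linear map with `σ(♯ξ(x)) = ξ(x)`. Explicitly
`σ(♯ξ(x) b) = ξ(x b)` for all `b ∈ A`. -/
def rmod : BDual k X →ₗ[k] X →ₗ[k] A :=
  LinearMap.mk₂ k
    (fun ξ x => σ.equivDual.symm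
      { toFun := fun b => ξ (op b • x)
        map_add' := fun b c => by
          rw [MulOpposite.op_add, add_smul]; exact map_add ξ.toDual _ _
        map_smul' := fun r b => by
          rw [MulOpposite.op_smul, smul_assoc]; exact map_smul ξ.toDual _ _ })
    (fun ξ η x => σ.eq_of_forall fun b => by
      simp only [add_mul, map_add, apply_equivDual_symm_mul, LinearMap.coe_mk, AddHom.coe_mk]
      rfl)
    (fun r ξ x => σ.eq_of_forall fun b => by
      simp only [smul_mul_assoc, map_smul, apply_equivDual_symm_mul, LinearMap.coe_mk,
        AddHom.coe_mk]
      rfl)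
    (fun ξ x y => σ.eq_of_forall fun b => by
      simp only [add_mul, map_add, apply_equivDual_symm_mul, LinearMap.coe_mk, AddHom.coe_mk,
        smul_add]
      exact map_add ξ.toDual _ _)
    (fun r ξ x => σ.eq_of_forall fun b => by
      simp only [smul_mul_assoc, map_smul, apply_equivDual_symm_mul, LinearMap.coe_mk,
        AddHom.coe_mk]
      rw [smul_comm]; exact map_smul ξ.toDual _ _)

lemma apply_rmod_mul (ξ : BDual k X) (x : X) (b : A) :
    σ.toFun (σ.rmod ξ x * b) = ξ (op b • x) := σ.apply_equivDual_symm_mul _ b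

lemma apply_rmod (ξ : BDual k X) (x : X) : σ.toFun (σ.rmod ξ x) = ξ x := by
  simpa using σ.apply_rmod_mul ξ x 1

lemma rmod_op_smul (ξ : BDual k X) (a : A) (x : X) :
    σ.rmod ξ (op a • x) = σ.rmod ξ x * a :=
  σ.eq_of_forall fun b => by rw [mul_assoc, apply_rmod_mul, apply_rmod_mul, MulOpposite.op_mul, mul_smul]

lemma rmod_smul (ξ : BDual k X) (a : A) (x : X) : σ.rmod (a • ξ) x = a * σ.rmod ξ x :=
  σ.eq_of_forall fun b => by
    rw [mul_assoc, σ.symm' a, mul_assoc, apply_rmod_mul, apply_rmod_mul, BDual.smul_apply,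
      MulOpposite.op_mul, mul_smul]

end Right

section Left

variable [Module A X] [SMulCommClass A k X] [IsScalarTower k A X]

/-- For a left `A`-module `X`, `ξ ∈ DX` and `x ∈ X`, the element `♯ξ(x)` of `A`, where
`♯ξ : X → A` is the left `A`-linear map with `σ(♯ξ(x)) = ξ(x)`. Explicitly
`σ(♯ξ(x) b) = ξ(b x)` for all `b ∈ A`. -/
def lmod : BDual k X →ₗ[k] X →ₗ[k] A :=
  LinearMap.mk₂ k
    (fun ξ x => σ.equivDual.symm
      { toFun := fun b => ξ (b • x)
        map_add' := fun b c => by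
          rw [add_smul]; exact map_add ξ.toDual _ _
        map_smul' := fun r b => by
          rw [smul_assoc]; exact map_smul ξ.toDual _ _ })
    (fun ξ η x => σ.eq_of_forall fun b => by
      simp only [add_mul, map_add, apply_equivDual_symm_mul, LinearMap.coe_mk, AddHom.coe_mk]
      rfl)
    (fun r ξ x => σ.eq_of_forall fun b => by
      simp only [smul_mul_assoc, map_smul, apply_equivDual_symm_mul, LinearMap.coe_mk,
        AddHom.coe_mk]
      rfl)
    (fun ξ x y => σ.eq_of_forall fun b => by
      simp only [add_mul, map_add, apply_equivDual_symm_mul, LinearMap.coe_mk, AddHom.coe_mk,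
        smul_add]
      exact map_add ξ.toDual _ _)
    (fun r ξ x => σ.eq_of_forall fun b => by
      simp only [smul_mul_assoc, map_smul, apply_equivDual_symm_mul, LinearMap.coe_mk,
        AddHom.coe_mk]
      rw [smul_comm]; exact map_smul ξ.toDual _ _)

lemma apply_lmod_mul (ξ : BDual k X) (x : X) (b : A) :
    σ.toFun (σ.lmod ξ x * b) = ξ (b • x) := σ.apply_equivDual_symm_mul _ b

lemma apply_lmod (ξ : BDual k X) (x : X) : σ.toFun (σ.lmod ξ x) = ξ x := by
  simpa using σ.apply_lmod_mul ξ x 1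

lemma lmod_smul (ξ : BDual k X) (a : A) (x : X) :
    σ.lmod ξ (a • x) = a * σ.lmod ξ x :=
  σ.eq_of_forall fun b => by
    rw [mul_assoc, σ.symm' a, mul_assoc, apply_lmod_mul, apply_lmod_mul, mul_smul]

lemma lmod_op_smul (ξ : BDual k X) (a : A) (x : X) : σ.lmod (op a • ξ) x = σ.lmod ξ x * a :=
  σ.eq_of_forall fun b => by
    rw [mul_assoc, apply_lmod_mul, apply_lmod_mul, BDual.op_smul_apply, mul_smul]

end Left

end SymmetrisingElement

/-! ### The identity elements `ρ ∈ M ⊗_A DM` and `ℓ ∈ DM ⊗_A M` -/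

section Identities

variable {k A : Type*} [Field k] [Ring A] [Algebra k A] [FiniteDimensional k A]
  (σ : SymmetrisingElement k A)
  (M : Type*) [AddCommGroup M] [Module k M] [Module A M] [Module Aᵐᵒᵖ M]
  [SMulCommClass A Aᵐᵒᵖ M] [IsScalarTower k A M] [IsScalarTower k Aᵐᵒᵖ M]

/-- The map `M ⊗_A DM → End(M_A)` sending `m ⊗ μ` to `x ↦ m ♯μ(x)`. (The values are right
`A`-linear, but are recorded as `k`-linear maps only.) -/
def evRight : BTensor k A M (BDual k M) →ₗ[k] (M →ₗ[k] M) :=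
  BTensor.lift
    (LinearMap.mk₂ k
      (fun (m : M) (μ : BDual k M) =>
        { toFun := fun x : M => op (σ.rmod μ x) • m
          map_add' := fun x y => by rw [map_add, MulOpposite.op_add, add_smul]
          map_smul' := fun r x => by rw [map_smul, MulOpposite.op_smul, smul_assoc]; rfl })
      (fun m m' μ => LinearMap.ext fun x => smul_add _ m m')
      (fun r m μ => LinearMap.ext fun x => smul_comm (op (σ.rmod μ x)) r m)
      (fun m μ ν => LinearMap.ext fun x => by
        change op (σ.rmod (μ + ν) x) • m = op (σ.rmod μ x) • m + op (σ.rmod ν x) • m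
        rw [map_add, LinearMap.add_apply, MulOpposite.op_add, add_smul])
      (fun r m μ => LinearMap.ext fun x => by
        change op (σ.rmod (r • μ) x) • m = r • (op (σ.rmod μ x) • m)
        rw [map_smul, LinearMap.smul_apply, MulOpposite.op_smul, smul_assoc]))
    (fun m a μ => LinearMap.ext fun x => by
      change op (σ.rmod μ x) • op a • m = op (σ.rmod (a • μ) x) • m
      rw [σ.rmod_smul, MulOpposite.op_mul, mul_smul])

/-- The map `DM ⊗_A M → End(_A M)` sending `ν ⊗ n` to `x ↦ ♯ν(x) n`. (The values are left
`A`-linear, but are recorded as `k`-linear maps only.) -/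
def evLeft : BTensor k A (BDual k M) M →ₗ[k] (M →ₗ[k] M) :=
  BTensor.lift
    (LinearMap.mk₂ k
      (fun (ν : BDual k M) (n : M) =>
        { toFun := fun x : M => σ.lmod ν x • n
          map_add' := fun x y => by rw [map_add, add_smul]
          map_smul' := fun r x => by rw [map_smul, smul_assoc]; rfl })
      (fun μ ν n => LinearMap.ext fun x => by
        change σ.lmod (μ + ν) x • n = σ.lmod μ x • n + σ.lmod ν x • n
        rw [map_add, LinearMap.add_apply, add_smul])
      (fun r ν n => LinearMap.ext fun x => by
        change σ.lmod (r • ν) x • n = r • (σ.lmod ν x • n)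
        rw [map_smul, LinearMap.smul_apply, smul_assoc])
      (fun ν n n' => LinearMap.ext fun x => smul_add _ n n')
      (fun r ν n => LinearMap.ext fun x => smul_comm (σ.lmod ν x) r n))
    (fun ν a n => LinearMap.ext fun x => by
      change σ.lmod (op a • ν) x • n = σ.lmod ν x • a • n
      rw [σ.lmod_op_smul, mul_smul])

/-- `ρ ∈ M ⊗_A DM` corresponds to the identity of `M_A`. -/
def IsRho (ρ : BTensor k A M (BDual k M)) : Prop := evRight σ M ρ = LinearMap.id

/-- `ℓ ∈ DM ⊗_A M` corresponds to the identity of `_A M`. -/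
def IsEll (ℓ : BTensor k A (BDual k M) M) : Prop := evLeft σ M ℓ = LinearMap.id

end Identities

section Element

variable (k A : Type*) [Field k] [Ring A] [Algebra k A]
  (M : Type*) [AddCommGroup M] [Module k M] [Module A M] [Module Aᵐᵒᵖ M]
  [SMulCommClass A Aᵐᵒᵖ M] [IsScalarTower k A M] [IsScalarTower k Aᵐᵒᵖ M]

/-- `T_A(M ⊕ DM)`. -/
abbrev DoubleAlg : Type _ := TensorAlg k A (M × BDual k M)

variable {M}

/-- The canonical map `M → T_A(M ⊕ DM)`. -/
def DoubleAlg.inM : M →ₗ[k] DoubleAlg k A M where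
  toFun m := TensorAlg.ι k A _ (m, 0)
  map_add' m n := by rw [← map_add]; simp
  map_smul' r m := by
    have : ((r • m, 0) : M × BDual k M) = (algebraMap k A r) • (m, 0) := by
      simp
    rw [this, TensorAlg.ι_smul, AlgHom.commutes, ← Algebra.smul_def]; rfl

/-- The canonical map `DM → T_A(M ⊕ DM)`. -/
def DoubleAlg.inD : BDual k M →ₗ[k] DoubleAlg k A M where
  toFun m := TensorAlg.ι k A _ (0, m)
  map_add' m n := by rw [← map_add]; simp
  map_smul' r m := by
    have : ((0, r • m) : M × BDual k M) = (algebraMap k A r) • (0, m) := by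
      simp
    rw [this, TensorAlg.ι_smul, AlgHom.commutes, ← Algebra.smul_def]; rfl

/-- The canonical map `M ⊗_A DM → T_A(M ⊕ DM)`, `m ⊗ μ ↦ m μ`. -/
def DoubleAlg.inMD : BTensor k A M (BDual k M) →ₗ[k] DoubleAlg k A M :=
  BTensor.lift ((LinearMap.mul k _).compl₁₂ (inM k A) (inD k A)) (fun m a μ => by
    change TensorAlg.ι k A _ (op a • m, (0 : BDual k M)) * TensorAlg.ι k A _ ((0 : M), μ)
      = TensorAlg.ι k A _ (m, (0 : BDual k M)) * TensorAlg.ι k A _ ((0 : M), a • μ)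
    have h1 : ((op a • m, 0) : M × BDual k M) = op a • (m, 0) := by simp
    have h2 : ((0, a • μ) : M × BDual k M) = a • (0, μ) := by simp
    rw [h1, h2, TensorAlg.ι_smul, TensorAlg.ι_op_smul, mul_assoc])

/-- The canonical map `DM ⊗_A M → T_A(M ⊕ DM)`, `ν ⊗ n ↦ ν n`. -/
def DoubleAlg.inDM : BTensor k A (BDual k M) M →ₗ[k] DoubleAlg k A M :=
  BTensor.lift ((LinearMap.mul k _).compl₁₂ (inD k A) (inM k A)) (fun μ a m => by
    change TensorAlg.ι k A _ ((0 : M), op a • μ) * TensorAlg.ι k A _ (m, (0 : BDual k M))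
      = TensorAlg.ι k A _ ((0 : M), μ) * TensorAlg.ι k A _ (a • m, (0 : BDual k M))
    have h1 : ((0, op a • μ) : M × BDual k M) = op a • (0, μ) := by simp
    have h2 : ((a • m, 0) : M × BDual k M) = a • (m, 0) := by simp
    rw [h1, h2, TensorAlg.ι_smul, TensorAlg.ι_op_smul, mul_assoc])

/-- The element `c = ρ - ℓ ∈ (M ⊗_A DM) ⊕ (DM ⊗_A M) ⊆ T_A(M ⊕ DM)`. -/
def cElement (ρ : BTensor k A M (BDual k M)) (ℓ : BTensor k A (BDual k M) M) : DoubleAlg k A M :=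
  DoubleAlg.inMD k A ρ - DoubleAlg.inDM k A ℓ

end Element

/-- The quotient `R / ⟨c⟩` by the two-sided ideal generated by `c`. -/
abbrev QuotBy {R : Type*} [Ring R] (c : R) : Type _ := (TwoSidedIdeal.span {c}).ringCon.Quotient

/-! ### Differential forms, the bimodule `℧`, the element `c̄`, and `Π₁` -/

section Forms

variable (k A Λ : Type*) [Field k] [Ring A] [Algebra k A] [Ring Λ] [Algebra k Λ]
  [Module A Λ] [Module Aᵐᵒᵖ Λ] [IsAlgebraOver A Λ]

instance : SMulCommClass Λ Aᵐᵒᵖ Λ where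
  smul_comm l a x := IsAlgebraOver.mul_op_smul' a.unop l x

instance : SMulCommClass A Λᵐᵒᵖ Λ where
  smul_comm a l x := (IsAlgebraOver.smul_mul' a x l.unop).symm

/-- The multiplication map `Λ ⊗_A Λ → Λ`. -/
def mulMap : BTensor k A Λ Λ →ₗ[k] Λ :=
  BTensor.lift (LinearMap.mul k Λ) (fun x a y => by
    simp only [LinearMap.mul_apply']
    rw [op_smul_eq, smul_eq a y, mul_assoc])

variable {k A Λ} in
lemma mulMap_smul (l : Λ) (t : BTensor k A Λ Λ) : mulMap k A Λ (l • t) = l * mulMap k A Λ t := by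
  induction t using BTensor.induction_on with
  | zero => simp
  | tmul x y =>
    rw [BTensor.smul_tmul_left]
    simp [mulMap, mul_assoc]
  | add s t hs ht => simp only [smul_add, map_add, hs, ht, mul_add]

variable {k A Λ} in
lemma mulMap_op_smul (l : Λᵐᵒᵖ) (t : BTensor k A Λ Λ) :
    mulMap k A Λ (l • t) = mulMap k A Λ t * l.unop := by
  induction t using BTensor.induction_on with
  | zero => simp
  | tmul x y =>
    rw [BTensor.op_smul_tmul_right]
    simp [mulMap, mul_assoc]
  | add s t hs ht => simp only [smul_add, map_add, hs, ht, add_mul]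

/-- The `Λ`-bimodule `Ω` of noncommutative 1-forms on `Λ` over `A`: the kernel of the
multiplication map `Λ ⊗_A Λ → Λ`. -/
def Omega : Type _ := LinearMap.ker (mulMap k A Λ)

namespace Omega

instance : AddCommGroup (Omega k A Λ) :=
  inferInstanceAs (AddCommGroup (LinearMap.ker (mulMap k A Λ)))
instance : Module k (Omega k A Λ) := inferInstanceAs (Module k (LinearMap.ker (mulMap k A Λ)))

/-- The inclusion `Ω → Λ ⊗_A Λ`. -/
def incl : Omega k A Λ →ₗ[k] BTensor k A Λ Λ := (LinearMap.ker (mulMap k A Λ)).subtype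

lemma incl_injective : Function.Injective (incl k A Λ) := Subtype.val_injective

instance : SMul Λ (Omega k A Λ) where
  smul l ω := ⟨l • incl k A Λ ω, by
    rw [LinearMap.mem_ker, mulMap_smul, show mulMap k A Λ (incl k A Λ ω) = 0 from ω.2, mul_zero]⟩

instance : SMul Λᵐᵒᵖ (Omega k A Λ) where
  smul l ω := ⟨l • incl k A Λ ω, by
    rw [LinearMap.mem_ker, mulMap_op_smul, show mulMap k A Λ (incl k A Λ ω) = 0 from ω.2,
      zero_mul]⟩

instance : Module Λ (Omega k A Λ) :=
  Function.Injective.module Λ (incl k A Λ).toAddMonoidHom (incl_injective k A Λ) fun _ _ => rfl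

instance : Module Λᵐᵒᵖ (Omega k A Λ) :=
  Function.Injective.module Λᵐᵒᵖ (incl k A Λ).toAddMonoidHom (incl_injective k A Λ) fun _ _ => rfl

instance : SMulCommClass Λ Λᵐᵒᵖ (Omega k A Λ) where
  smul_comm l r ω := incl_injective k A Λ (smul_comm l r (incl k A Λ ω))

instance : SMulCommClass Λ k (Omega k A Λ) where
  smul_comm l r ω := incl_injective k A Λ (smul_comm l r (incl k A Λ ω))

instance : SMulCommClass Λᵐᵒᵖ k (Omega k A Λ) where
  smul_comm l r ω := incl_injective k A Λ (smul_comm l r (incl k A Λ ω))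

variable {Λ}

/-- The differential form `dλ = 1 ⊗ λ - λ ⊗ 1`. -/
def d (l : Λ) : Omega k A Λ :=
  ⟨BTensor.tmul k A 1 l - BTensor.tmul k A l 1, by
    rw [LinearMap.mem_ker, map_sub]; simp [mulMap]⟩

end Omega

/-- The `Λ`-bimodule `DΛ ⊗_Λ Ω ⊗_Λ DΛ`. -/
abbrev DOmegaD : Type _ :=
  BTensor k Λ (BTensor k Λ (BDual k Λ) (Omega k A Λ)) (BDual k Λ)

/-- The `Λ`-bimodule `℧ = D(DΛ ⊗_Λ Ω ⊗_Λ DΛ)`. -/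
abbrev Mho : Type _ := BDual k (DOmegaD k A Λ)


variable {k A Λ} [FiniteDimensional k A] [IsScalarTower k A Λ] [IsScalarTower k Aᵐᵒᵖ Λ]
  (σ : SymmetrisingElement k A)

/-- The map `Λ ⊗_A Λ → Λ`, `α ⊗ β ↦ α ♯φ(β)`, for `φ ∈ DΛ` (here `♯φ` is the left `A`-linear
version). -/
def psi : BDual k Λ →ₗ[k] BTensor k A Λ Λ →ₗ[k] Λ where
  toFun φ := BTensor.lift
    (LinearMap.mk₂ k (fun α β : Λ => op (σ.lmod φ β) • α)
      (fun α α' β => smul_add _ α α')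
      (fun r α β => smul_comm (op (σ.lmod φ β)) r α)
      (fun α β β' => by rw [map_add, MulOpposite.op_add, add_smul])
      (fun r α β => by rw [map_smul, MulOpposite.op_smul, smul_assoc]))
    (fun α a β => by
      change op (σ.lmod φ β) • op a • α = op (σ.lmod φ (a • β)) • α
      rw [σ.lmod_smul, MulOpposite.op_mul, mul_smul])
  map_add' φ φ' := BTensor.hom_ext fun α β => by
    simp only [BTensor.lift_tmul, LinearMap.mk₂_apply, LinearMap.add_apply, map_add,
      MulOpposite.op_add, add_smul]
  map_smul' r φ := BTensor.hom_ext fun α β => by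
    simp only [BTensor.lift_tmul, LinearMap.mk₂_apply, LinearMap.smul_apply, map_smul,
      MulOpposite.op_smul, smul_assoc, RingHom.id_apply]

@[simp] lemma psi_tmul (φ : BDual k Λ) (α β : Λ) :
    psi σ φ (BTensor.tmul k A α β) = op (σ.lmod φ β) • α := by
  simp [psi]

lemma psi_smul (φ : BDual k Λ) (l : Λ) (t : BTensor k A Λ Λ) :
    psi σ φ (l • t) = l * psi σ φ t := by
  induction t using BTensor.induction_on with
  | zero => simp
  | tmul x y => rw [BTensor.smul_tmul_left, psi_tmul, psi_tmul, IsAlgebraOver.mul_op_smul']; rfl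
  | add s t hs ht => simp only [smul_add, map_add, hs, ht, mul_add]

lemma psi_op_smul (φ : BDual k Λ) (l : Λ) (t : BTensor k A Λ Λ) :
    psi σ φ (op l • t) = psi σ (l • φ) t := by
  induction t using BTensor.induction_on with
  | zero => simp
  | tmul x y =>
    rw [BTensor.op_smul_tmul_right, psi_tmul, psi_tmul]
    congr 2
    refine σ.eq_of_forall fun b => ?_
    rw [σ.apply_lmod_mul, σ.apply_lmod_mul, BDual.smul_apply, smul_comm]
  | add s t hs ht => simp only [smul_add, map_add, hs, ht]

variable (Λ) in
/-- The functional on `DΛ ⊗_Λ Ω ⊗_Λ DΛ` defining `c̄`, as a linear map on `DΛ ⊗_Λ Ω` with values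
in functionals on `DΛ`: it sends `θ ⊗ ω` to `φ ↦ θ(ψ_φ(ω))`, with `ψ_φ(α ⊗ β) = α ♯φ(β)`. -/
def cBarAux : BTensor k Λ (BDual k Λ) (Omega k A Λ) →ₗ[k] BDual k Λ →ₗ[k] k :=
  BTensor.lift
    (LinearMap.mk₂ k (fun (θ : BDual k Λ) (ω : Omega k A Λ) =>
        θ.toDual ∘ₗ (psi σ).flip (Omega.incl k A Λ ω))
      (fun θ θ' ω => rfl)
      (fun r θ ω => rfl)
      (fun θ ω ω' => by rw [map_add, map_add, LinearMap.comp_add])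
      (fun r θ ω => by rw [map_smul, map_smul, LinearMap.comp_smul]))
    (fun θ l ω => LinearMap.ext fun φ => by
      change θ (l • psi σ φ (Omega.incl k A Λ ω)) = θ (psi σ φ (l • Omega.incl k A Λ ω))
      rw [psi_smul]; rfl)

lemma cBarAux_tmul (θ φ : BDual k Λ) (ω : Omega k A Λ) :
    cBarAux Λ σ (BTensor.tmul k Λ θ ω) φ = θ (psi σ φ (Omega.incl k A Λ ω)) := by
  simp [cBarAux]; rfl

variable (Λ) in
lemma cBarAux_balanced (s : BTensor k Λ (BDual k Λ) (Omega k A Λ)) (l : Λ) (φ : BDual k Λ) :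
    cBarAux Λ σ (op l • s) φ = cBarAux Λ σ s (l • φ) := by
  induction s using BTensor.induction_on with
  | zero => simp
  | tmul θ ω =>
    rw [BTensor.op_smul_tmul_right, cBarAux_tmul, cBarAux_tmul]
    exact congrArg θ (psi_op_smul σ φ l _)
  | add s t hs ht => simp only [smul_add, map_add, LinearMap.add_apply, hs, ht]

variable (Λ) in
/-- The element `c̄ ∈ ℧ = D(DΛ ⊗_Λ Ω ⊗_Λ DΛ)`; it is the functional given by
`θ ⊗ dλ ⊗ φ ↦ θ(♯φ(λ)) - φ(♯θ(λ))`, see `cBar_apply`. -/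
def cBar : Mho k A Λ :=
  BDual.ofDual (BTensor.lift (cBarAux Λ σ) (cBarAux_balanced Λ σ))

lemma cBar_tmul (θ φ : BDual k Λ) (ω : Omega k A Λ) :
    cBar Λ σ (BTensor.tmul k Λ (BTensor.tmul k Λ θ ω) φ)
      = θ (psi σ φ (Omega.incl k A Λ ω)) := by
  rw [← cBarAux_tmul]
  change BTensor.lift (cBarAux Λ σ) (cBarAux_balanced Λ σ)
    (BTensor.tmul k Λ (BTensor.tmul k Λ θ ω) φ) = _
  rw [BTensor.lift_tmul]

/-- The defining formula `c̄(θ ⊗ dλ ⊗ φ) = θ(♯φ(λ)) - φ(♯θ(λ))`. Here `♯φ(λ), ♯θ(λ) ∈ A` are viewed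
in `Λ` through the structure map `A → Λ`, `a ↦ a • 1`. -/
lemma cBar_apply (θ φ : BDual k Λ) (l : Λ) :
    cBar Λ σ (BTensor.tmul k Λ (BTensor.tmul k Λ θ (Omega.d k A l)) φ)
      = θ ((σ.lmod φ l) • (1 : Λ)) - φ ((σ.rmod θ l) • (1 : Λ)) := by
  rw [cBar_tmul]
  have h : psi σ φ (Omega.incl k A Λ (Omega.d k A l))
      = σ.lmod φ l • (1 : Λ) - op (σ.lmod φ 1) • l := by
    rw [IsAlgebraOver.smul_one', ← psi_tmul, ← psi_tmul, ← map_sub]; rfl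
  rw [h, ← σ.apply_lmod_mul φ 1 (σ.rmod θ l), σ.symm', σ.apply_rmod_mul]
  exact map_sub θ.toDual _ _

/-- `a c̄ = c̄ a` for `a ∈ A`. -/
lemma smul_cBar (a : A) : (a • (1 : Λ)) • cBar Λ σ = op (a • (1 : Λ)) • cBar Λ σ := by
  refine congrArg BDual.ofDual (?_ : BDual.toDual ((a • (1 : Λ)) • cBar Λ σ)
    = BDual.toDual (op (a • (1 : Λ)) • cBar Λ σ))
  refine BTensor.hom_ext fun s φ => ?_
  change ((a • (1 : Λ)) • cBar Λ σ) (BTensor.tmul k Λ s φ)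
    = (op (a • (1 : Λ)) • cBar Λ σ) (BTensor.tmul k Λ s φ)
  rw [BDual.smul_apply, BDual.op_smul_apply, BTensor.op_smul_tmul_right, BTensor.smul_tmul_left]
  induction s using BTensor.induction_on with
  | zero =>
    rw [smul_zero, BTensor.zero_tmul, BTensor.zero_tmul]
  | tmul θ ω =>
    rw [BTensor.smul_tmul_left, cBar_tmul, cBar_tmul, BDual.smul_apply]
    refine congrArg θ ?_
    generalize Omega.incl k A Λ ω = t
    induction t using BTensor.induction_on with
    | zero => simp
    | tmul x y =>
      rw [psi_tmul, psi_tmul, op_smul_eq (Λ := Λ), op_smul_eq (Λ := Λ) (σ.lmod φ y)]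
      have : σ.lmod (op (a • (1 : Λ)) • φ) y = σ.lmod φ y * a := by
        rw [← σ.lmod_op_smul]
        refine congrArg (fun ξ => σ.lmod ξ y) (BDual.ext fun z => ?_)
        rw [BDual.op_smul_apply, BDual.op_smul_apply, smul_eq a z]; rfl
      rw [this, mul_smul, smul_eq (σ.lmod φ y)]
      simp [mul_assoc]
    | add s t hs ht => simp only [smul_add, map_add, hs, ht]
  | add s t hs ht =>
    rw [smul_add, BTensor.add_tmul, BTensor.add_tmul]
    have h1 := map_add (BDual.toDual (cBar Λ σ))
    exact (h1 _ _).trans ((congrArg₂ (· + ·) hs ht).trans (h1 _ _).symm)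

variable (Λ) in
/-- The bimodule homomorphism `Λ ⊗_A Λ → ℧`, `α ⊗ β ↦ α c̄ β`. -/
def cBarMap : BTensor k A Λ Λ →ₗ[k] Mho k A Λ :=
  BTensor.lift
    (LinearMap.mk₂ k (fun α β : Λ => α • op β • cBar Λ σ)
      (fun α α' β => add_smul α α' _)
      (fun r α β => smul_assoc r α _)
      (fun α β β' => by rw [MulOpposite.op_add, add_smul, smul_add])
      (fun r α β => by rw [MulOpposite.op_smul, smul_assoc, smul_comm]))
    (fun α a β => by
      change (op a • α) • op β • cBar Λ σ = α • op (a • β) • cBar Λ σ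
      rw [op_smul_eq, smul_eq a β, MulOpposite.op_mul, mul_smul, mul_smul, ← smul_cBar,
        smul_comm (a • (1 : Λ)) (op β)])

lemma cBarMap_tmul (α β : Λ) :
    cBarMap Λ σ (BTensor.tmul k A α β) = α • op β • cBar Λ σ := by
  rw [cBarMap, BTensor.lift_tmul]; rfl

lemma cBarMap_smul (l : Λ) (t : BTensor k A Λ Λ) : cBarMap Λ σ (l • t) = l • cBarMap Λ σ t := by
  induction t using BTensor.induction_on with
  | zero => rw [smul_zero, map_zero, smul_zero]
  | tmul x y => rw [BTensor.smul_tmul_left, cBarMap_tmul, cBarMap_tmul, smul_eq_mul, mul_smul]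
  | add s t hs ht => simp only [smul_add, map_add, hs, ht]

lemma cBarMap_op_smul (l : Λᵐᵒᵖ) (t : BTensor k A Λ Λ) : cBarMap Λ σ (l • t) = l • cBarMap Λ σ t := by
  induction t using BTensor.induction_on with
  | zero => rw [smul_zero, map_zero, smul_zero]
  | tmul x y =>
    rw [BTensor.op_smul_tmul_right, cBarMap_tmul, cBarMap_tmul, ← smul_comm x l, ← mul_smul l]; rfl
  | add s t hs ht => simp only [smul_add, map_add, hs, ht]

variable (Λ) in
/-- The `Λ`-bimodule `Π₁`, the cokernel of the bimodule homomorphism `Λ ⊗_A Λ → ℧`. -/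
def PiOne : Type _ :=
  Mho k A Λ ⧸ LinearMap.range (cBarMap Λ σ)

namespace PiOne

instance : AddCommGroup (PiOne Λ σ) :=
  inferInstanceAs (AddCommGroup (Mho k A Λ ⧸ LinearMap.range (cBarMap Λ σ)))
instance (priority := 2000) : Module k (PiOne Λ σ) :=
  inferInstanceAs (Module k (Mho k A Λ ⧸ LinearMap.range (cBarMap Λ σ)))

variable (Λ) in
/-- The projection `℧ → Π₁`. -/
def proj : Mho k A Λ →ₗ[k] PiOne Λ σ := (LinearMap.range (cBarMap Λ σ)).mkQ

lemma proj_surjective : Function.Surjective (proj Λ σ) := Submodule.mkQ_surjective _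

instance : SMul Λ (PiOne Λ σ) where
  smul l := Submodule.mapQ _ (LinearMap.range (cBarMap Λ σ))
    (DistribSMul.toLinearMap k (Mho k A Λ) l) (by
      rintro _ ⟨t, rfl⟩
      exact ⟨l • t, cBarMap_smul σ l t⟩)

instance : SMul Λᵐᵒᵖ (PiOne Λ σ) where
  smul l := Submodule.mapQ _ (LinearMap.range (cBarMap Λ σ))
    (DistribSMul.toLinearMap k (Mho k A Λ) l) (by
      rintro _ ⟨t, rfl⟩
      exact ⟨l • t, cBarMap_op_smul σ l t⟩)

lemma proj_smul (l : Λ) (u : Mho k A Λ) : proj Λ σ (l • u) = l • proj Λ σ u := rfl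

lemma proj_op_smul (l : Λᵐᵒᵖ) (u : Mho k A Λ) : proj Λ σ (l • u) = l • proj Λ σ u := rfl

instance : Module Λ (PiOne Λ σ) :=
  Function.Surjective.module Λ (proj Λ σ).toAddMonoidHom (proj_surjective σ) (proj_smul σ)

instance : Module Λᵐᵒᵖ (PiOne Λ σ) :=
  Function.Surjective.module Λᵐᵒᵖ (proj Λ σ).toAddMonoidHom (proj_surjective σ) (proj_op_smul σ)

instance : SMulCommClass Λ Λᵐᵒᵖ (PiOne Λ σ) where
  smul_comm l r u := by
    obtain ⟨u, rfl⟩ := proj_surjective σ u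
    rw [← proj_op_smul, ← proj_smul, ← proj_smul, ← proj_op_smul, smul_comm]

instance : IsScalarTower k Λ (PiOne Λ σ) where
  smul_assoc r l u := by
    obtain ⟨u, rfl⟩ := proj_surjective σ u
    rw [← proj_smul, ← proj_smul, smul_assoc, map_smul]

instance : IsScalarTower k Λᵐᵒᵖ (PiOne Λ σ) where
  smul_assoc r l u := by
    obtain ⟨u, rfl⟩ := proj_surjective σ u
    rw [← proj_op_smul, ← proj_op_smul, smul_assoc, map_smul]

end PiOne

end Forms

/-! ### The inverse Auslander-Reiten translate of `Λ` -/

section TauMinus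

variable {Λ : Type u} [Ring Λ] {X Y : Type u} [AddCommGroup X] [AddCommGroup Y]
  [Module Λ X] [Module Λᵐᵒᵖ X] [SMulCommClass Λ Λᵐᵒᵖ X]
  [Module Λ Y] [Module Λᵐᵒᵖ Y] [SMulCommClass Λ Λᵐᵒᵖ Y]

variable (Λ X) in
/-- Right multiplication by `l` on a `Λ`-bimodule, as a homomorphism of left `Λ`-modules. -/
def rightMulHom (l : Λ) : ModuleCat.of Λ X ⟶ ModuleCat.of Λ X :=
  ModuleCat.ofHom
    { toFun := fun x => op l • x
      map_add' := smul_add _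
      map_smul' := fun a x => (smul_comm a (op l) x).symm }

lemma rightMulHom_one : rightMulHom Λ X 1 = 𝟙 _ := by
  ext x; exact one_smul _ x

lemma rightMulHom_zero : rightMulHom Λ X 0 = 0 := by
  ext x; exact zero_smul Λᵐᵒᵖ x

lemma rightMulHom_mul (l l' : Λ) :
    rightMulHom Λ X (l * l') = rightMulHom Λ X l ≫ rightMulHom Λ X l' := by
  ext x; exact mul_smul (op l') (op l) x

lemma rightMulHom_add (l l' : Λ) :
    rightMulHom Λ X (l + l') = rightMulHom Λ X l + rightMulHom Λ X l' := by
  ext x; exact add_smul (op l) (op l') x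

variable (Λ X Y) in
/-- `Ext¹_{Λ-}(X, Y)`, the extension group of the left `Λ`-modules underlying the `Λ`-bimodules `X`
and `Y`. It is a `Λ`-bimodule by functoriality: `l e` is the image of `e` under the map induced by
right multiplication by `l` on `X`, and `e l` its image under the map induced by right
multiplication by `l` on `Y`. -/
def ExtOne : Type u := Abelian.Ext (ModuleCat.of Λ X) (ModuleCat.of Λ Y) 1

namespace ExtOne

instance : AddCommGroup (ExtOne Λ X Y) :=
  inferInstanceAs (AddCommGroup (Abelian.Ext (ModuleCat.of Λ X) (ModuleCat.of Λ Y) 1))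

/-- The map on `Ext¹(X, Y)` induced by right multiplication by `l` on `X`. -/
def leftAct (l : Λ) (e : Abelian.Ext (ModuleCat.of Λ X) (ModuleCat.of Λ Y) 1) :
    Abelian.Ext (ModuleCat.of Λ X) (ModuleCat.of Λ Y) 1 :=
  (Abelian.Ext.mk₀ (rightMulHom Λ X l)).comp e (zero_add 1)

/-- The map on `Ext¹(X, Y)` induced by right multiplication by `l` on `Y`. -/
def rightAct (l : Λ) (e : Abelian.Ext (ModuleCat.of Λ X) (ModuleCat.of Λ Y) 1) :
    Abelian.Ext (ModuleCat.of Λ X) (ModuleCat.of Λ Y) 1 :=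
  e.comp (Abelian.Ext.mk₀ (rightMulHom Λ Y l)) (add_zero 1)

instance : Module Λ (ExtOne Λ X Y) where
  smul l e := leftAct l e
  one_smul (e : Abelian.Ext (ModuleCat.of Λ X) (ModuleCat.of Λ Y) 1) := by
    change leftAct 1 e = e
    rw [leftAct, rightMulHom_one, Abelian.Ext.mk₀_id_comp]
  mul_smul l l' (e : Abelian.Ext (ModuleCat.of Λ X) (ModuleCat.of Λ Y) 1) := by
    change leftAct (l * l') e = leftAct l (leftAct l' e)
    rw [leftAct, leftAct, leftAct, rightMulHom_mul, Abelian.Ext.mk₀_comp_mk₀_assoc]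
  smul_zero l := Abelian.Ext.comp_zero _ _ _ _ (zero_add 1)
  smul_add l e e' := Abelian.Ext.comp_add _ _ _ (zero_add 1)
  add_smul l l' (e : Abelian.Ext (ModuleCat.of Λ X) (ModuleCat.of Λ Y) 1) := by
    change leftAct (l + l') e = leftAct l e + leftAct l' e
    rw [leftAct, leftAct, leftAct, rightMulHom_add, Abelian.Ext.mk₀_add, Abelian.Ext.add_comp]
  zero_smul (e : Abelian.Ext (ModuleCat.of Λ X) (ModuleCat.of Λ Y) 1) := by
    change leftAct 0 e = 0
    rw [leftAct, rightMulHom_zero, Abelian.Ext.mk₀_zero, Abelian.Ext.zero_comp]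

instance : Module Λᵐᵒᵖ (ExtOne Λ X Y) where
  smul l e := rightAct l.unop e
  one_smul (e : Abelian.Ext (ModuleCat.of Λ X) (ModuleCat.of Λ Y) 1) := by
    change rightAct 1 e = e
    rw [rightAct, rightMulHom_one, Abelian.Ext.comp_mk₀_id]
  mul_smul l l' (e : Abelian.Ext (ModuleCat.of Λ X) (ModuleCat.of Λ Y) 1) := by
    change rightAct (l'.unop * l.unop) e = rightAct l.unop (rightAct l'.unop e)
    rw [rightAct, rightAct, rightAct, rightMulHom_mul, ← Abelian.Ext.mk₀_comp_mk₀,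
      Abelian.Ext.comp_assoc_of_third_deg_zero]
  smul_zero l := Abelian.Ext.zero_comp _ _ _ _ (add_zero 1)
  smul_add l e e' := Abelian.Ext.add_comp _ _ _ (add_zero 1)
  add_smul l l' (e : Abelian.Ext (ModuleCat.of Λ X) (ModuleCat.of Λ Y) 1) := by
    change rightAct (l.unop + l'.unop) e = rightAct l.unop e + rightAct l'.unop e
    rw [rightAct, rightAct, rightAct, rightMulHom_add, Abelian.Ext.mk₀_add, Abelian.Ext.comp_add]
  zero_smul (e : Abelian.Ext (ModuleCat.of Λ X) (ModuleCat.of Λ Y) 1) := by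
    change rightAct 0 e = 0
    rw [rightAct, rightMulHom_zero, Abelian.Ext.mk₀_zero, Abelian.Ext.comp_zero]

instance : SMulCommClass Λ Λᵐᵒᵖ (ExtOne Λ X Y) where
  smul_comm l r e :=
    (Abelian.Ext.comp_assoc_of_third_deg_zero (Abelian.Ext.mk₀ (rightMulHom Λ X l)) e
      (Abelian.Ext.mk₀ (rightMulHom Λ Y r.unop)) (zero_add 1)).symm

end ExtOne

/-- The `Λ`-bimodule `τ⁻Λ = Ext¹_{Λ-}(DΛ, Λ)`. -/
abbrev TauMinus (k Λ : Type u) [Field k] [Ring Λ] [Algebra k Λ] : Type u :=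
  ExtOne Λ (BDual k Λ) Λ

end TauMinus

/-! ### Path algebras, double quivers and arrow bimodules -/

section PathAlgebra

variable (k V : Type*) [Field k] [Quiver V]

/-- The path algebra `kQ` of a quiver `Q` with set of vertices `V`: it has as basis the paths of
`Q`, and the product of two paths is their concatenation (`p * q` is `p` followed by `q`) if `p`
ends where `q` starts, and `0` otherwise. -/
def PathAlgebra : Type _ := (Σ i j : V, Quiver.Path i j) →₀ k

namespace PathAlgebra

instance : AddCommGroup (PathAlgebra k V) :=
  inferInstanceAs (AddCommGroup ((Σ i j : V, Quiver.Path i j) →₀ k))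
instance : Module k (PathAlgebra k V) :=
  inferInstanceAs (Module k ((Σ i j : V, Quiver.Path i j) →₀ k))

variable {V}

/-- The basis element given by a path. -/
def ofPath {i j : V} (p : Quiver.Path i j) : PathAlgebra k V := Finsupp.single ⟨i, j, p⟩ 1

/-- The basis element given by an arrow. -/
def ofArrow {i j : V} (a : i ⟶ j) : PathAlgebra k V := ofPath k a.toPath

variable (V)

open Classical in
/-- The product of two basis elements. -/
def mulPath (p q : Σ i j : V, Quiver.Path i j) : PathAlgebra k V :=
  if h : p.2.1 = q.1 then ofPath k (p.2.2.comp (q.2.2.cast h.symm rfl)) else 0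

/-- The product of the path algebra. -/
def mulₗ : PathAlgebra k V →ₗ[k] PathAlgebra k V →ₗ[k] PathAlgebra k V :=
  Finsupp.lift _ k _ fun p => Finsupp.lift _ k _ fun q => mulPath k V p q

instance : Mul (PathAlgebra k V) := ⟨fun x y => mulₗ k V x y⟩

variable {V}

lemma mulₗ_single (p q : Σ i j : V, Quiver.Path i j) :
    mulₗ k V (Finsupp.single p 1) (Finsupp.single q 1) = mulPath k V p q := by
  have h1 : mulₗ k V (Finsupp.single p 1) = Finsupp.lift _ k _ fun q => mulPath k V p q :=
    (Finsupp.lift_apply _ _ _ _ _).trans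
      ((Finsupp.sum_single_index (by exact zero_smul _ _)).trans (one_smul _ _))
  rw [h1]
  exact (Finsupp.lift_apply _ _ _ _ _).trans
    ((Finsupp.sum_single_index (by exact zero_smul _ _)).trans (one_smul _ _))

lemma ofPath_mul {i j l : V} (p : Quiver.Path i j) (q : Quiver.Path j l) :
    ofPath k p * ofPath k q = ofPath k (p.comp q) := by
  refine (mulₗ_single k _ _).trans ?_
  simp [mulPath]

lemma ofPath_mul_of_ne {i j i' j' : V} (p : Quiver.Path i j) (q : Quiver.Path i' j')
    (h : j ≠ i') : ofPath k p * ofPath k q = 0 := by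
  refine (mulₗ_single k _ _).trans ?_
  simp [mulPath, h]

variable {k} in
lemma induction_on {P : PathAlgebra k V → Prop} (x : PathAlgebra k V) (zero : P 0)
    (add : ∀ x y, P x → P y → P (x + y)) (smul : ∀ (r : k) (x), P x → P (r • x))
    (path : ∀ {i j : V} (p : Quiver.Path i j), P (ofPath k p)) : P x := by
  refine Finsupp.induction_linear x zero add fun ⟨i, j, p⟩ r => ?_
  have : (Finsupp.single ⟨i, j, p⟩ r : (Σ i j : V, Quiver.Path i j) →₀ k)
      = r • Finsupp.single ⟨i, j, p⟩ 1 := by simp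
  rw [this]
  exact smul r _ (path p)

private lemma mul_add' (x y z : PathAlgebra k V) : x * (y + z) = x * y + x * z :=
  map_add (mulₗ k V x) y z

private lemma add_mul' (x y z : PathAlgebra k V) : (x + y) * z = x * z + y * z :=
  LinearMap.map_add₂ (mulₗ k V) x y z

private lemma mul_zero' (x : PathAlgebra k V) : x * 0 = 0 := map_zero (mulₗ k V x)

private lemma zero_mul' (x : PathAlgebra k V) : 0 * x = 0 := LinearMap.map_zero₂ (mulₗ k V) x

private lemma smul_mul' (r : k) (x y : PathAlgebra k V) : (r • x) * y = r • (x * y) :=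
  LinearMap.map_smul₂ (mulₗ k V) r x y

private lemma mul_smul' (r : k) (x y : PathAlgebra k V) : x * (r • y) = r • (x * y) :=
  map_smul (mulₗ k V x) r y

private lemma mul_assoc' (x y z : PathAlgebra k V) : x * y * z = x * (y * z) := by
  induction x using induction_on with
  | zero => simp only [zero_mul']
  | add x x' hx hx' => simp only [add_mul', hx, hx']
  | smul r x hx => simp only [smul_mul', hx]
  | path p =>
    induction y using induction_on with
    | zero => simp only [zero_mul', mul_zero']
    | add x x' hx hx' => simp only [add_mul', mul_add', hx, hx']
    | smul r x hx => simp only [smul_mul', mul_smul', hx]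
    | path q =>
      induction z using induction_on with
      | zero => simp only [mul_zero']
      | add x x' hx hx' => simp only [mul_add', hx, hx']
      | smul r x hx => simp only [mul_smul', hx]
      | @path l l' s =>
        rename_i i j i' j'
        by_cases h : j = i'
        · subst h
          rw [ofPath_mul]
          by_cases h' : j' = l
          · subst h'
            rw [ofPath_mul, ofPath_mul, ofPath_mul, Quiver.Path.comp_assoc]
          · rw [ofPath_mul_of_ne k _ _ h', ofPath_mul_of_ne k _ _ h', mul_zero']
        · rw [ofPath_mul_of_ne k _ _ h, zero_mul']
          by_cases h' : j' = l
          · subst h'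
            rw [ofPath_mul, ofPath_mul_of_ne k _ _ h]
          · rw [ofPath_mul_of_ne k _ _ h', mul_zero']

variable [Fintype V]

instance : One (PathAlgebra k V) := ⟨∑ i : V, ofPath k (Quiver.Path.nil : Quiver.Path i i)⟩

variable (V) in
lemma one_def :
    (1 : PathAlgebra k V) = ∑ i : V, ofPath k (Quiver.Path.nil : Quiver.Path i i) := rfl

private lemma one_mul' (x : PathAlgebra k V) : 1 * x = x := by
  induction x using induction_on with
  | zero => exact mul_zero' k 1
  | add x x' hx hx' => rw [mul_add', hx, hx']
  | smul r x hx => rw [mul_smul', hx]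
  | @path i j p =>
    change mulₗ k V (∑ i : V, ofPath k (Quiver.Path.nil : Quiver.Path i i)) (ofPath k p) = _
    rw [map_sum, LinearMap.sum_apply, Finset.sum_eq_single i]
    · exact (ofPath_mul k _ _).trans (by rw [Quiver.Path.nil_comp])
    · intro l _ hl
      exact ofPath_mul_of_ne k _ _ hl
    · simp

private lemma mul_one' (x : PathAlgebra k V) : x * 1 = x := by
  induction x using induction_on with
  | zero => exact zero_mul' k 1
  | add x x' hx hx' => rw [add_mul', hx, hx']
  | smul r x hx => rw [smul_mul', hx]
  | @path i j p =>
    change mulₗ k V (ofPath k p) (∑ i : V, ofPath k (Quiver.Path.nil : Quiver.Path i i)) = _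
    rw [map_sum, Finset.sum_eq_single j]
    · exact (ofPath_mul k _ _).trans (by rw [Quiver.Path.comp_nil])
    · intro l _ hl
      exact ofPath_mul_of_ne k _ _ (Ne.symm hl)
    · simp

instance : Ring (PathAlgebra k V) :=
  { (inferInstance : AddCommGroup (PathAlgebra k V)) with
    mul := (· * ·)
    one := 1
    mul_assoc := mul_assoc' k
    one_mul := one_mul' k
    mul_one := mul_one' k
    left_distrib := mul_add' k
    right_distrib := add_mul' k
    zero_mul := zero_mul' k
    mul_zero := mul_zero' k }

instance : Algebra k (PathAlgebra k V) :=
  Algebra.ofModule (smul_mul' k) (mul_smul' k)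

end PathAlgebra

instance [Fintype V] : Fintype (Quiver.Symmetrify V) := inferInstanceAs (Fintype V)

/-- The arrows of a quiver. -/
abbrev Arrows (V : Type*) [Quiver V] : Type _ := Σ i j : V, (i ⟶ j)

/-- The bimodule over `k^V` with basis the arrows of the quiver (which is assumed to have finitely
many arrows): for an arrow `a : i ⟶ j` one has `f a = f(i) a` and `a f = f(j) a`, so that
`a ∈ e_i M e_j`. Its elements are given by their coefficients. -/
def ArrowBimodule : Type _ := Arrows V → k

namespace ArrowBimodule

instance : AddCommGroup (ArrowBimodule k V) := inferInstanceAs (AddCommGroup (Arrows V → k))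
instance : Module k (ArrowBimodule k V) := inferInstanceAs (Module k (Arrows V → k))

instance [Finite (Arrows V)] : FiniteDimensional k (ArrowBimodule k V) :=
  inferInstanceAs (FiniteDimensional k (Arrows V → k))

instance : Module (V → k) (ArrowBimodule k V) where
  smul f m := fun a => f a.1 * m a
  one_smul m := funext fun a => one_mul (m a)
  mul_smul f g m := funext fun a => mul_assoc (f a.1) (g a.1) (m a)
  smul_zero f := funext fun a => mul_zero (f a.1)
  smul_add f m n := funext fun a => mul_add (f a.1) (m a) (n a)
  add_smul f g m := funext fun a => add_mul (f a.1) (g a.1) (m a)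
  zero_smul m := funext fun a => zero_mul (m a)

instance : Module (V → k)ᵐᵒᵖ (ArrowBimodule k V) where
  smul f m := fun a => f.unop a.2.1 * m a
  one_smul m := funext fun a => one_mul (m a)
  mul_smul f g m := funext fun a => by
    change (g.unop a.2.1 * f.unop a.2.1) * m a = f.unop a.2.1 * (g.unop a.2.1 * m a)
    ring
  smul_zero f := funext fun a => mul_zero (f.unop a.2.1)
  smul_add f m n := funext fun a => mul_add (f.unop a.2.1) (m a) (n a)
  add_smul f g m := funext fun a => add_mul (f.unop a.2.1) (g.unop a.2.1) (m a)
  zero_smul m := funext fun a => zero_mul (m a)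

instance : SMulCommClass (V → k) (V → k)ᵐᵒᵖ (ArrowBimodule k V) where
  smul_comm f g m := funext fun a => mul_left_comm (f a.1) (g.unop a.2.1) (m a)

instance : IsScalarTower k (V → k) (ArrowBimodule k V) where
  smul_assoc r f m := funext fun a => mul_assoc r (f a.1) (m a)

instance : IsScalarTower k (V → k)ᵐᵒᵖ (ArrowBimodule k V) where
  smul_assoc r f m := funext fun a => mul_assoc r (f.unop a.2.1) (m a)

variable {V}

open Classical in
/-- The basis element given by an arrow. -/
def ofArrow (a : Arrows V) : ArrowBimodule k V := fun b => if b = a then 1 else 0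

/-- The element `a*` of the dual basis given by an arrow `a`. -/
def dualArrow (a : Arrows V) : BDual k (ArrowBimodule k V) :=
  BDual.ofDual (LinearMap.proj (φ := fun _ : Arrows V => k) a)

end ArrowBimodule

/-- The standard symmetrising element of `k^V`: the sum of the coordinates. -/
def stdSymmetrising [Fintype V] : SymmetrisingElement k (V → k) where
  toFun := ∑ i : V, LinearMap.proj i
  symm' a b := by rw [mul_comm]
  nondeg' a h := by
    classical
    funext i
    simpa [Pi.single_apply] using h (Pi.single i 1)

/-- The element `∑ [a, a*] = ∑ (a a* - a* a)` of the path algebra of the double quiver, which has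
for each arrow `a : i ⟶ j` of the given quiver an arrow `a : i ⟶ j` and an arrow `a* : j ⟶ i`. -/
def commutatorSum [Fintype V] [Fintype (Arrows V)] : PathAlgebra k (Quiver.Symmetrify V) :=
  ∑ a : Arrows V,
    (PathAlgebra.ofArrow k (Quiver.Hom.toPos a.2.2)
        * PathAlgebra.ofArrow k (Quiver.Hom.toNeg a.2.2)
      - PathAlgebra.ofArrow k (Quiver.Hom.toNeg a.2.2)
        * PathAlgebra.ofArrow k (Quiver.Hom.toPos a.2.2))

end PathAlgebra

end Preproj

end

open Preproj MulOpposite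

/-!
Write `Λ = T_A(M)`, and let `φ^l`, `φ^r` be the `A`-valued lifts `σ.lmod φ`, `σ.rmod φ` of a
functional `φ`.

*Dual bases.* Over the semisimple algebra `A` every finite dimensional module is finitely generated
projective, and composing coordinates with `σ` turns a dual basis of `X` into elements `x_i ∈ X`,
`ξ_i ∈ DX` with `y = ∑ x_i ξ_i^r(y)`, which are then also dual bases of `DX`
(`SymmetrisingElement.IsRightDualBasis.sum_rmod_smul` and its left version). For `X = M` they give
`ρ` and `ℓ`; for `X = Λ` they are used to write down inverses of the maps below.

*The bimodule `℧`.* An element `f` of `℧` is a trilinear form `f(θ ⊗ ω ⊗ φ)` (`Mho.form`). For a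
tensor algebra `Ω` is generated by the `dm` with `m ∈ M`, so that `f` is determined by the values
`f(θ ⊗ dm ⊗ φ)` (`Mho.ext_ι`). Conversely, as `A`-bimodule maps on `M` extend to derivations of `Λ`
(`TensorAlg.exists_derivation`), every `μ ∈ DM` gives an element `θ ⊗ dm ⊗ φ ↦ μ(θ^l(1) m φ^r(1))`
of `℧` (`Mho.ofDualM`). By means of dual bases of `Λ` every `f` is a sum of elements `x μ y`
(`Mho.eq_sum_smul_ofDualM`), and there is a well defined bimodule map `℧ → T_A(M ⊕ DM)` with
`x μ y ↦ x μ y` (`Mho.toDouble`). In other words `℧ ≅ Λ ⊗_A DM ⊗_A Λ` is the bimodule induced from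
`DM`, so both `T_Λ(℧)` and `T_A(M ⊕ DM)` are universal among algebras receiving `A`, `M` and `DM`
(`Mho.tensorAlgEquiv`). That `c̄` corresponds to `ρ - ℓ` is checked on the forms `θ ⊗ dm ⊗ φ`
(`Mho.toDouble_cBar`).

*The quotients.* If `Y` is the quotient of a bimodule `X` by the sub-bimodule generated by `c`, then
`T_Λ(Y) = T_Λ(X) / ⟨c⟩` (`tensorAlgEquivQuot`). This applies to `℧ → Π₁` by definition. It remains to
present `τ⁻Λ` in the same way. The left module `Λ ⊗_A DΛ` is projective and maps onto `DΛ` with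
kernel `Ω ⊗_Λ DΛ`, so `Ext¹(DΛ, Λ)` is the cokernel of the restriction map
`Hom_Λ(Λ ⊗_A DΛ, Λ) → Hom_Λ(Ω ⊗_Λ DΛ, Λ)`. Its target is `℧`, through `f ↦ f̂` (`Mho.hat`,
`Mho.hatKer_surjective`), and the maps which extend to `Λ ⊗_A DΛ` are those given by the elements of
`Λ c̄ Λ` (`Mho.exists_extension_iff`), since `∑ x_i c̄ y_i` extends to the map sending `α ⊗ φ` to
`∑ α φ^r(x_i) y_i`.

*Quivers.* The path algebra has a universal property with respect to the images of the vertices and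
the arrows (`PathAlgebra.lift`), which for a `k^V`-bimodule with a basis of arrows is that of the
tensor algebra (`exists_equiv_pathAlgebra`). It is applied to the arrow bimodule `M` of a quiver and
to `M ⊕ DM`, whose basis consists of the arrows of the double quiver.
-/

namespace Preproj

open scoped TensorProduct
open CategoryTheory

noncomputable section

/-! ### Universal properties of tensor algebras and of quotients -/

namespace TensorAlg

section Lift

variable {k A M : Type*} [Field k] [Ring A] [Algebra k A] [AddCommGroup M] [Module A M]
  [Module Aᵐᵒᵖ M] {B : Type*} [Ring B] [Algebra k B]

/-- The universal property of `T_A(M)`: the algebra homomorphism extending an algebra homomorphism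
`f : A → B` and an additive map `g : M → B` compatible with the two actions of `A`. -/
def lift (f : A →ₐ[k] B) (g : M →+ B) (hl : ∀ (a : A) (m : M), g (a • m) = f a * g m)
    (hr : ∀ (a : A) (m : M), g (op a • m) = g m * f a) : TensorAlg k A M →ₐ[k] B :=
  RingQuot.liftAlgHom k ⟨FreeAlgebra.lift k (Sum.elim f g), by
    rintro _ _ (r | ⟨a, b⟩ | ⟨a, b⟩ | ⟨m, n⟩ | ⟨a, m⟩ | ⟨a, m⟩) <;> simp [hl, hr]⟩

variable (f : A →ₐ[k] B) (g : M →+ B) (hl : ∀ (a : A) (m : M), g (a • m) = f a * g m)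
    (hr : ∀ (a : A) (m : M), g (op a • m) = g m * f a)

@[simp] lemma lift_base (a : A) : lift f g hl hr (base k A M a) = f a := by
  refine (RingQuot.liftAlgHom_mkAlgHom_apply k _ _ _).trans ?_
  simp

@[simp] lemma lift_ι (m : M) : lift f g hl hr (ι k A M m) = g m := by
  refine (RingQuot.liftAlgHom_mkAlgHom_apply k _ _ _).trans ?_
  simp

lemma induction {P : TensorAlg k A M → Prop} (base : ∀ a, P (base k A M a))
    (ι : ∀ m, P (ι k A M m)) (add : ∀ x y, P x → P y → P (x + y))
    (mul : ∀ x y, P x → P y → P (x * y)) (x : TensorAlg k A M) : P x := by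
  obtain ⟨x, rfl⟩ := RingQuot.mkAlgHom_surjective k (Rel k A M) x
  induction x using FreeAlgebra.induction with
  | grade0 r =>
    have := base (algebraMap k A r)
    rw [AlgHom.commutes] at this
    have h := AlgHom.commutes (RingQuot.mkAlgHom k (Rel k A M)) r
    rw [h]
    exact this
  | grade1 x =>
    rcases x with a | m
    · exact base a
    · exact ι m
  | mul x y hx hy => rw [map_mul]; exact mul _ _ hx hy
  | add x y hx hy => rw [map_add]; exact add _ _ hx hy

lemma hom_ext {f g : TensorAlg k A M →ₐ[k] B}
    (hb : ∀ a, f (base k A M a) = g (base k A M a)) (hι : ∀ m, f (ι k A M m) = g (ι k A M m)) :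
    f = g := by
  refine AlgHom.ext fun x => ?_
  induction x using induction with
  | base a => exact hb a
  | ι m => exact hι m
  | add x y hx hy => rw [map_add, map_add, hx, hy]
  | mul x y hx hy => rw [map_mul, map_mul, hx, hy]

lemma base_smul_one (a : A) : a • (1 : TensorAlg k A M) = base k A M a :=
  mul_one (base k A M a)

lemma smul_eq_base_mul (a : A) (x : TensorAlg k A M) : a • x = base k A M a * x := rfl

lemma op_smul_eq_mul_base (a : A) (x : TensorAlg k A M) : op a • x = x * base k A M a := rfl

end Lift

section Field

variable {k A M : Type*} [Field k] [Ring A] [Algebra k A] [AddCommGroup M] [Module k M] [Module A M]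
  [Module Aᵐᵒᵖ M] [IsScalarTower k A M]

lemma ι_field_smul (r : k) (m : M) : ι k A M (r • m) = r • ι k A M m := by
  rw [← one_smul A m, ← smul_assoc, ι_smul, map_smul, one_smul, map_one, smul_mul_assoc, one_mul]

variable (k A M) in
/-- The canonical map `M → T_A(M)` as a `k`-linear map. -/
def ιₗ : M →ₗ[k] TensorAlg k A M := { ι k A M with map_smul' := ι_field_smul }

end Field

end TensorAlg

namespace QuotBy

variable {k R S : Type*} [Field k] [Ring R] [Algebra k R] [Ring S] [Algebra k S]

variable (k) in
/-- The projection `R → R / ⟨c⟩`. -/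
def mk (c : R) : R →ₐ[k] QuotBy c := RingCon.mkₐ k _

lemma mk_surjective (c : R) : Function.Surjective (mk k c) := Quotient.mk_surjective

lemma mk_self (c : R) : mk k c c = 0 := by
  have : (TwoSidedIdeal.span {c}).ringCon c 0 :=
    (TwoSidedIdeal.mem_iff _ _).1 (TwoSidedIdeal.subset_span rfl)
  exact ((RingCon.eq _).2 this).trans (map_zero (mk k c))

/-- The algebra homomorphism on `R / ⟨c⟩` induced by one on `R` vanishing at `c`. -/
def lift (c : R) (f : R →ₐ[k] S) (h : f c = 0) : QuotBy c →ₐ[k] S :=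
  RingCon.liftₐ _ f (by
    intro x y hxy
    have h1 : x - y ∈ TwoSidedIdeal.span {c} := (TwoSidedIdeal.rel_iff _ _ _).1 hxy
    have h2 : TwoSidedIdeal.span {c} ≤ TwoSidedIdeal.ker f.toRingHom := by
      rw [TwoSidedIdeal.span_le]
      rintro _ rfl
      exact (TwoSidedIdeal.mem_ker _).2 h
    have h3 := (TwoSidedIdeal.mem_ker _).1 (h2 h1)
    rw [map_sub, sub_eq_zero] at h3
    exact h3)

@[simp] lemma lift_mk (c : R) (f : R →ₐ[k] S) (h : f c = 0) (x : R) :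
    lift c f h (mk k c x) = f x := rfl

lemma hom_ext {c : R} {f g : QuotBy c →ₐ[k] S} (h : ∀ x, f (mk k c x) = g (mk k c x)) : f = g := by
  refine AlgHom.ext fun y => ?_
  obtain ⟨x, rfl⟩ := mk_surjective (k := k) c y
  exact h x

/-- An isomorphism of algebras sending `c` to `d` induces one of the quotients. -/
def congr (e : R ≃ₐ[k] S) (c : R) (d : S) (h : e c = d) : QuotBy c ≃ₐ[k] QuotBy d :=
  AlgEquiv.ofAlgHom
    (lift c ((mk k d).comp e.toAlgHom) (by
      change mk k d (e c) = 0
      rw [h, mk_self]))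
    (lift d ((mk k c).comp e.symm.toAlgHom) (by
      change mk k c (e.symm d) = 0
      rw [← h, e.symm_apply_apply, mk_self]))
    (hom_ext fun x => by simp) (hom_ext fun x => by simp)

end QuotBy

section Surjection

variable {k Λ X Y S : Type*} [Field k] [Ring Λ] [Algebra k Λ] [AddCommGroup X] [Module Λ X]
  [Module Λᵐᵒᵖ X] [AddCommGroup Y] [Module Λ Y] [Module Λᵐᵒᵖ Y] [Ring S] [Algebra k S]

namespace TensorAlg

/-- An algebra homomorphism on `T_Λ(X)` killing the kernel of a surjective bimodule homomorphism
`X → Y` induces one on `T_Λ(Y)`. -/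
def descend (p : X →+ Y) (hp : Function.Surjective p)
    (hl : ∀ (l : Λ) (x : X), p (l • x) = l • p x)
    (hr : ∀ (l : Λ) (x : X), p (op l • x) = op l • p x) (q : TensorAlg k Λ X →ₐ[k] S)
    (hker : ∀ x, p x = 0 → q (ι k Λ X x) = 0) : TensorAlg k Λ Y →ₐ[k] S :=
  have hg : ∀ u, (p.liftOfSurjective hp ⟨(q : TensorAlg k Λ X →+ S).comp (ι k Λ X), hker⟩) (p u)
      = q (ι k Λ _ u) := fun u => p.liftOfRightInverse_comp_apply _ _ _ u
  lift (q.comp (base k Λ _))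
    (p.liftOfSurjective hp ⟨(q : TensorAlg k Λ X →+ S).comp (ι k Λ X), hker⟩)
    (fun a m => by
      obtain ⟨u, rfl⟩ := hp m
      rw [← hl, hg, hg, ι_smul, map_mul]; rfl)
    (fun a m => by
      obtain ⟨u, rfl⟩ := hp m
      rw [← hr, hg, hg, ι_op_smul, map_mul]; rfl)

/-- The functoriality of the tensor algebra. -/
def map (p : X →+ Y) (hl : ∀ (l : Λ) (x : X), p (l • x) = l • p x)
    (hr : ∀ (l : Λ) (x : X), p (op l • x) = op l • p x) : TensorAlg k Λ X →ₐ[k] TensorAlg k Λ Y :=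
  lift (base k Λ _) ((ι k Λ Y).comp p)
    (fun a u => by rw [AddMonoidHom.comp_apply, AddMonoidHom.comp_apply, hl, ι_smul])
    (fun a u => by rw [AddMonoidHom.comp_apply, AddMonoidHom.comp_apply, hr, ι_op_smul])

variable {p : X →+ Y} {hl : ∀ (l : Λ) (x : X), p (l • x) = l • p x}
  {hr : ∀ (l : Λ) (x : X), p (op l • x) = op l • p x}

@[simp] lemma map_base (a : Λ) : map (k := k) p hl hr (base k Λ X a) = base k Λ Y a :=
  lift_base _ _ _ _ a

@[simp] lemma map_ι (x : X) : map (k := k) p hl hr (ι k Λ X x) = ι k Λ Y (p x) :=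
  lift_ι _ _ _ _ x

variable {hp : Function.Surjective p} {q : TensorAlg k Λ X →ₐ[k] S}
  {hker : ∀ x, p x = 0 → q (ι k Λ X x) = 0}

@[simp] lemma descend_base (a : Λ) :
    descend p hp hl hr q hker (base k Λ Y a) = q (base k Λ X a) :=
  by rw [descend, lift_base, AlgHom.comp_apply]

@[simp] lemma descend_ι (x : X) :
    descend p hp hl hr q hker (ι k Λ Y (p x)) = q (ι k Λ X x) :=
  by rw [descend, lift_ι]; exact p.liftOfRightInverse_comp_apply _ _ _ x

lemma descend_map (x : TensorAlg k Λ X) : descend p hp hl hr q hker (map p hl hr x) = q x := by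
  have : (descend p hp hl hr q hker).comp (map p hl hr) = q :=
    hom_ext (fun a => by rw [AlgHom.comp_apply, map_base, descend_base])
      (fun m => by rw [AlgHom.comp_apply, map_ι, descend_ι])
  exact DFunLike.congr_fun this x

end TensorAlg

/-- If `Y` is the quotient of the bimodule `X` by the sub-bimodule generated by `c`, then the tensor
algebra of `Y` is the quotient of the tensor algebra of `X` by the ideal generated by `c`. The
hypothesis `hker` only asks that the kernel of `p : X → Y` vanishes in `T_Λ(X) / ⟨c⟩`. -/
def tensorAlgEquivQuot (p : X →+ Y) (hp : Function.Surjective p)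
    (hl : ∀ (l : Λ) (x : X), p (l • x) = l • p x)
    (hr : ∀ (l : Λ) (x : X), p (op l • x) = op l • p x) (c : X) (hc : p c = 0)
    (hker : ∀ x, p x = 0 → QuotBy.mk k (TensorAlg.ι k Λ X c) (TensorAlg.ι k Λ X x) = 0) :
    TensorAlg k Λ Y ≃ₐ[k] QuotBy (TensorAlg.ι k Λ X c) :=
  have hc' : TensorAlg.map (k := k) p hl hr (TensorAlg.ι k Λ X c) = 0 := by
    rw [TensorAlg.map_ι, hc, map_zero]
  AlgEquiv.ofAlgHom (TensorAlg.descend p hp hl hr (QuotBy.mk k _) hker)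
    (QuotBy.lift _ (TensorAlg.map p hl hr) hc')
    (QuotBy.hom_ext fun x => TensorAlg.descend_map x)
    (TensorAlg.hom_ext
      (fun a => (congrArg (QuotBy.lift _ (TensorAlg.map p hl hr) hc')
        (TensorAlg.descend_base a)).trans (TensorAlg.map_base a))
      (fun m => by
        obtain ⟨u, rfl⟩ := hp m
        exact (congrArg (QuotBy.lift _ (TensorAlg.map p hl hr) hc')
          (TensorAlg.descend_ι u)).trans (TensorAlg.map_ι u)))

end Surjection

section CBarMap

variable {k A Λ : Type*} [Field k] [Ring A] [Algebra k A] [Ring Λ] [Algebra k Λ]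
  [Module A Λ] [Module Aᵐᵒᵖ Λ] [IsAlgebraOver A Λ] [FiniteDimensional k A] [IsScalarTower k A Λ]
  [IsScalarTower k Aᵐᵒᵖ Λ] (σ : SymmetrisingElement k A)

/-- The image of `Λ ⊗_A Λ → ℧` lies in the ideal of `T_Λ(℧)` generated by `c̄`. -/
lemma map_ι_cBarMap_eq_zero {S : Type*} [Ring S] [Algebra k S]
    (q : TensorAlg k Λ (Mho k A Λ) →ₐ[k] S) (hq : q (TensorAlg.ι k Λ _ (cBar Λ σ)) = 0)
    (t : BTensor k A Λ Λ) : q (TensorAlg.ι k Λ (Mho k A Λ) (cBarMap Λ σ t)) = 0 := by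
  induction t using BTensor.induction_on with
  | zero => rw [map_zero, map_zero, map_zero]
  | tmul x y =>
    rw [cBarMap_tmul, TensorAlg.ι_smul, TensorAlg.ι_op_smul, map_mul, map_mul, hq,
      zero_mul, mul_zero]
  | add s t hs ht => rw [map_add, map_add, map_add, hs, ht, add_zero]

lemma cBarMap_one_tmul_one : cBarMap Λ σ (BTensor.tmul k A 1 1) = cBar Λ σ := by
  rw [cBarMap_tmul, op_one, one_smul, one_smul]

variable (Λ) in
/-- A surjective bimodule homomorphism on `℧` with kernel the sub-bimodule generated by `c̄`
presents the tensor algebra of its target as `T_Λ(℧) / ⟨c̄⟩`. -/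
def tensorAlgEquivQuotCBar {Y : Type*} [AddCommGroup Y] [Module Λ Y] [Module Λᵐᵒᵖ Y]
    (p : Mho k A Λ →+ Y) (hp : Function.Surjective p)
    (hl : ∀ (l : Λ) (x : Mho k A Λ), p (l • x) = l • p x)
    (hr : ∀ (l : Λ) (x : Mho k A Λ), p (op l • x) = op l • p x)
    (hker : ∀ x, p x = 0 ↔ x ∈ LinearMap.range (cBarMap Λ σ)) :
    TensorAlg k Λ Y ≃ₐ[k] QuotBy (TensorAlg.ι k Λ (Mho k A Λ) (cBar Λ σ)) :=
  tensorAlgEquivQuot p hp hl hr (cBar Λ σ) ((hker _).2 ⟨_, cBarMap_one_tmul_one σ⟩)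
    (fun x hx => by
      obtain ⟨t, rfl⟩ := (hker x).1 hx
      exact map_ι_cBarMap_eq_zero σ _ (QuotBy.mk_self _) t)

variable (Λ) in
/-- The isomorphism `T_Λ(Π₁) ≅ T_Λ(℧) / ⟨c̄⟩`. -/
def tensorAlgPiOneEquiv : TensorAlg k Λ (PiOne Λ σ) ≃ₐ[k]
    QuotBy (TensorAlg.ι k Λ (Mho k A Λ) (cBar Λ σ)) :=
  tensorAlgEquivQuotCBar Λ σ (PiOne.proj Λ σ).toAddMonoidHom (PiOne.proj_surjective σ)
    (PiOne.proj_smul σ) (fun l => PiOne.proj_op_smul σ (op l))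
    (fun _ => Submodule.Quotient.mk_eq_zero _)

end CBarMap

/-! ### Dual bases over a semisimple algebra with a symmetrising element -/

namespace SymmetrisingElement

variable {k A : Type*} [Field k] [Ring A] [Algebra k A] [FiniteDimensional k A]
  (σ : SymmetrisingElement k A) {X : Type*} [AddCommGroup X] [Module k X]

section Right

variable [Module Aᵐᵒᵖ X] [SMulCommClass Aᵐᵒᵖ k X] [IsScalarTower k Aᵐᵒᵖ X]

/-- `x` and `ξ` form a dual basis of the right `A`-module `X`. -/
def IsRightDualBasis {n : ℕ} (x : Fin n → X) (ξ : Fin n → BDual k X) : Prop :=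
  ∀ y : X, ∑ i, op (σ.rmod (ξ i) y) • x i = y

variable (X) in
/-- The functionals `ξ_i` are the coordinates of a dual basis of the finitely generated projective
module `X`, composed with `σ`. -/
lemma exists_isRightDualBasis [IsSemisimpleRing A] [FiniteDimensional k X] :
    ∃ (n : ℕ) (x : Fin n → X) (ξ : Fin n → BDual k X), σ.IsRightDualBasis x ξ := by
  have : Module.Finite Aᵐᵒᵖ X := Module.Finite.of_restrictScalars_finite k Aᵐᵒᵖ X
  have := Module.projective_of_isSemisimpleRing Aᵐᵒᵖ X
  obtain ⟨n, f, g, -, -, hfg⟩ := Module.Finite.exists_comp_eq_id_of_projective Aᵐᵒᵖ X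
  have hg : ∀ (r : k) (y : X), g (r • y) = r • g y := fun r y =>
    (g.restrictScalars k).map_smul r y
  obtain ⟨ξ, hξ⟩ : ∃ ξ : Fin n → BDual k X, ∀ i y, ξ i y = σ.toFun (g y i).unop :=
    ⟨fun i => BDual.ofDual
      { toFun := fun y => σ.toFun (g y i).unop
        map_add' := fun y z => by rw [map_add, Pi.add_apply, MulOpposite.unop_add, map_add]
        map_smul' := fun r y => by
          rw [hg, Pi.smul_apply, MulOpposite.unop_smul, map_smul]; rfl }, fun _ _ => rfl⟩
  refine ⟨n, fun i => f (Pi.single i 1), ξ, fun y => ?_⟩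
  have h1 : ∀ i, op (σ.rmod (ξ i) y) = g y i := fun i => by
    refine (congrArg op (σ.eq_of_forall fun b => ?_)).trans (op_unop _)
    rw [apply_rmod_mul, hξ, map_smul]; rfl
  simp_rw [h1]
  conv_rhs => rw [← LinearMap.id_apply (R := Aᵐᵒᵖ) y, ← hfg, LinearMap.comp_apply,
    pi_eq_sum_univ' (g y), map_sum]
  refine Finset.sum_congr rfl fun i _ => ?_
  rw [← map_smul]

variable {σ} {n : ℕ} {x : Fin n → X} {ξ : Fin n → BDual k X}

/-- A dual basis of the right `A`-module `X` is also one of the left `A`-module `DX`. -/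
lemma IsRightDualBasis.sum_rmod_smul (h : σ.IsRightDualBasis x ξ) (φ : BDual k X) :
    ∑ i, σ.rmod φ (x i) • ξ i = φ := by
  refine BDual.ext fun y => ?_
  conv_rhs => rw [← h y]
  refine (LinearMap.sum_apply (σ₁₂ := RingHom.id k) Finset.univ
    (fun i => (σ.rmod φ (x i) • ξ i).toDual) y).trans
    (Eq.trans ?_ (map_sum φ.toDual _ _).symm)
  refine Finset.sum_congr rfl fun i _ => ?_
  change (σ.rmod φ (x i) • ξ i) y = φ (op (σ.rmod (ξ i) y) • x i)
  rw [← σ.apply_rmod, ← σ.apply_rmod φ, σ.rmod_smul, σ.rmod_op_smul]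

end Right

section Left

variable [Module A X] [SMulCommClass A k X] [IsScalarTower k A X]

/-- `x` and `ξ` form a dual basis of the left `A`-module `X`. -/
def IsLeftDualBasis {n : ℕ} (x : Fin n → X) (ξ : Fin n → BDual k X) : Prop :=
  ∀ y : X, ∑ i, σ.lmod (ξ i) y • x i = y

variable (X) in
lemma exists_isLeftDualBasis [IsSemisimpleRing A] [FiniteDimensional k X] :
    ∃ (n : ℕ) (x : Fin n → X) (ξ : Fin n → BDual k X), σ.IsLeftDualBasis x ξ := by
  have : Module.Finite A X := Module.Finite.of_restrictScalars_finite k A X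
  have := Module.projective_of_isSemisimpleRing A X
  obtain ⟨n, f, g, -, -, hfg⟩ := Module.Finite.exists_comp_eq_id_of_projective A X
  have hg : ∀ (r : k) (y : X), g (r • y) = r • g y := fun r y =>
    (g.restrictScalars k).map_smul r y
  obtain ⟨ξ, hξ⟩ : ∃ ξ : Fin n → BDual k X, ∀ i y, ξ i y = σ.toFun (g y i) :=
    ⟨fun i => BDual.ofDual
      { toFun := fun y => σ.toFun (g y i)
        map_add' := fun y z => by rw [map_add, Pi.add_apply, map_add]
        map_smul' := fun r y => by rw [hg, Pi.smul_apply, map_smul]; rfl }, fun _ _ => rfl⟩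
  refine ⟨n, fun i => f (Pi.single i 1), ξ, fun y => ?_⟩
  have h1 : ∀ i, σ.lmod (ξ i) y = g y i := fun i => by
    refine σ.eq_of_forall fun b => ?_
    rw [apply_lmod_mul, hξ, map_smul, σ.symm']; rfl
  simp_rw [h1]
  conv_rhs => rw [← LinearMap.id_apply (R := A) y, ← hfg, LinearMap.comp_apply,
    pi_eq_sum_univ' (g y), map_sum]
  refine Finset.sum_congr rfl fun i _ => ?_
  rw [← map_smul]

variable {σ} {n : ℕ} {x : Fin n → X} {ξ : Fin n → BDual k X}

/-- A dual basis of the left `A`-module `X` is also one of the right `A`-module `DX`. -/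
lemma IsLeftDualBasis.sum_lmod_smul (h : σ.IsLeftDualBasis x ξ) (θ : BDual k X) :
    ∑ i, op (σ.lmod θ (x i)) • ξ i = θ := by
  refine BDual.ext fun y => ?_
  conv_rhs => rw [← h y]
  refine (LinearMap.sum_apply (σ₁₂ := RingHom.id k) Finset.univ
    (fun i => (op (σ.lmod θ (x i)) • ξ i).toDual) y).trans
    (Eq.trans ?_ (map_sum θ.toDual _ _).symm)
  refine Finset.sum_congr rfl fun i _ => ?_
  change (op (σ.lmod θ (x i)) • ξ i) y = θ (σ.lmod (ξ i) y • x i)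
  rw [← σ.apply_lmod, ← σ.apply_lmod θ, σ.lmod_op_smul, σ.lmod_smul]

end Left

end SymmetrisingElement

/-! ### Existence and uniqueness of `ρ` and `ℓ` -/

namespace BTensor

variable {k A X Y ι : Type*} [Field k] [Ring A] [AddCommGroup X] [AddCommGroup Y] [Module k X]
  [Module k Y] [Module Aᵐᵒᵖ X] [Module A Y]

lemma tmul_zero (x : X) : tmul k A x (0 : Y) = 0 := map_zero (tmulₗ (k := k) (A := A) x)

lemma tmul_sum (s : Finset ι) (x : X) (y : ι → Y) :
    tmul k A x (∑ i ∈ s, y i) = ∑ i ∈ s, tmul k A x (y i) :=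
  map_sum (tmulₗ (k := k) (A := A) x) y s

lemma sum_tmul (s : Finset ι) (x : ι → X) (y : Y) :
    tmul k A (∑ i ∈ s, x i) y = ∑ i ∈ s, tmul k A (x i) y :=
  map_sum ((tmulₗ (k := k) (A := A)).flip y) x s

end BTensor

section Identities

variable {k A : Type*} [Field k] [Ring A] [Algebra k A] [FiniteDimensional k A]
  {σ : SymmetrisingElement k A}
  {M : Type*} [AddCommGroup M] [Module k M] [Module A M] [Module Aᵐᵒᵖ M]
  [SMulCommClass A Aᵐᵒᵖ M] [IsScalarTower k A M] [IsScalarTower k Aᵐᵒᵖ M]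
  {n : ℕ} {x : Fin n → M} {ξ : Fin n → BDual k M}

lemma evRight_tmul (m : M) (μ : BDual k M) (y : M) :
    evRight σ M (BTensor.tmul k A m μ) y = op (σ.rmod μ y) • m := by
  simp [evRight]

lemma evLeft_tmul (m : M) (μ : BDual k M) (y : M) :
    evLeft σ M (BTensor.tmul k A μ m) y = σ.lmod μ y • m := by
  simp [evLeft]

lemma SymmetrisingElement.IsRightDualBasis.sum_evRight_tmul (h : σ.IsRightDualBasis x ξ)
    (t : BTensor k A M (BDual k M)) :
    ∑ i, BTensor.tmul k A (evRight σ M t (x i)) (ξ i) = t := by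
  induction t using BTensor.induction_on with
  | zero => simp [BTensor.zero_tmul]
  | tmul m μ =>
    simp_rw [evRight_tmul, BTensor.op_smul_tmul]
    rw [← BTensor.tmul_sum, h.sum_rmod_smul]
  | add s t hs ht =>
    simp_rw [map_add, LinearMap.add_apply, BTensor.add_tmul]
    rw [Finset.sum_add_distrib, hs, ht]

lemma SymmetrisingElement.IsLeftDualBasis.sum_tmul_evLeft (h : σ.IsLeftDualBasis x ξ)
    (t : BTensor k A (BDual k M) M) :
    ∑ i, BTensor.tmul k A (ξ i) (evLeft σ M t (x i)) = t := by
  induction t using BTensor.induction_on with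
  | zero => exact Finset.sum_eq_zero fun i _ => BTensor.tmul_zero (ξ i)
  | tmul μ m =>
    simp_rw [evLeft_tmul, ← BTensor.op_smul_tmul]
    rw [← BTensor.sum_tmul, h.sum_lmod_smul]
  | add s t hs ht =>
    simp_rw [map_add, LinearMap.add_apply, BTensor.tmul_add]
    rw [Finset.sum_add_distrib, hs, ht]

variable (σ M) [IsSemisimpleRing A] [FiniteDimensional k M]

lemma existsUnique_isRho : ∃! ρ : BTensor k A M (BDual k M), IsRho σ M ρ := by
  obtain ⟨n, x, ξ, h⟩ := σ.exists_isRightDualBasis M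
  refine ⟨∑ i, BTensor.tmul k A (x i) (ξ i), LinearMap.ext fun y => ?_, fun t ht => ?_⟩
  · rw [map_sum, LinearMap.sum_apply]
    simp_rw [evRight_tmul]
    exact h y
  · rw [← h.sum_evRight_tmul t, show evRight σ M t = LinearMap.id from ht]
    rfl

lemma existsUnique_isEll : ∃! ℓ : BTensor k A (BDual k M) M, IsEll σ M ℓ := by
  obtain ⟨n, x, ξ, h⟩ := σ.exists_isLeftDualBasis M
  refine ⟨∑ i, BTensor.tmul k A (ξ i) (x i), LinearMap.ext fun y => ?_, fun t ht => ?_⟩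
  · rw [map_sum, LinearMap.sum_apply]
    simp_rw [evLeft_tmul]
    exact h y
  · rw [← h.sum_tmul_evLeft t, show evLeft σ M t = LinearMap.id from ht]
    rfl

end Identities

/-! ### Differential forms and functionals in `℧` -/

section Forms

variable {k A Λ : Type*} [Field k] [Ring A] [Algebra k A] [Ring Λ] [Algebra k Λ]
  [Module A Λ] [Module Aᵐᵒᵖ Λ] [IsAlgebraOver A Λ]

namespace Omega

lemma incl_smul (l : Λ) (ω : Omega k A Λ) : incl k A Λ (l • ω) = l • incl k A Λ ω := rfl

lemma incl_op_smul (l : Λ) (ω : Omega k A Λ) : incl k A Λ (op l • ω) = op l • incl k A Λ ω := rfl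

lemma incl_d (l : Λ) :
    incl k A Λ (d k A l) = BTensor.tmul k A 1 l - BTensor.tmul k A l 1 := rfl

lemma mulMap_incl (ω : Omega k A Λ) : mulMap k A Λ (incl k A Λ ω) = 0 := ω.2

variable (k A Λ) in
/-- The universal derivation `d : Λ → Ω` as a linear map. -/
def dₗ : Λ →ₗ[k] Omega k A Λ where
  toFun := d k A
  map_add' x y := incl_injective k A Λ (by
    rw [map_add, incl_d, incl_d, incl_d, BTensor.tmul_add, BTensor.add_tmul]; abel)
  map_smul' r x := incl_injective k A Λ (by
    rw [RingHom.id_apply, map_smul, incl_d, incl_d, BTensor.tmul_smul, BTensor.smul_tmul,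
      smul_sub])

lemma dₗ_apply (l : Λ) : dₗ k A Λ l = d k A l := rfl

lemma d_mul (x y : Λ) : d k A (x * y) = x • d k A y + op y • d k A x := incl_injective k A Λ (by
  rw [map_add, incl_smul, incl_op_smul, incl_d, incl_d, incl_d, smul_sub, smul_sub,
    BTensor.smul_tmul_left, BTensor.smul_tmul_left, BTensor.op_smul_tmul_right,
    BTensor.op_smul_tmul_right]
  simp)

lemma d_smul_one (a : A) : d k A (a • (1 : Λ)) = 0 := incl_injective k A Λ (by
  rw [map_zero, incl_d, sub_eq_zero, ← BTensor.op_smul_tmul, ← IsAlgebraOver.smul_one'])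

lemma d_smul (a : A) (x : Λ) : d k A (a • x) = (a • (1 : Λ)) • d k A x := by
  rw [smul_eq a x, d_mul, d_smul_one, smul_zero, add_zero]

lemma d_op_smul (a : A) (x : Λ) : d k A (op a • x) = op (a • (1 : Λ)) • d k A x := by
  rw [op_smul_eq a x, d_mul, d_smul_one, smul_zero, zero_add]

variable (k A Λ) in
/-- The map `Λ ⊗_A Λ → Ω`, `α ⊗ β ↦ (dα) β`; its negative is a retraction onto `Ω`. -/
def dMul : BTensor k A Λ Λ →ₗ[k] Omega k A Λ :=
  BTensor.lift
    (LinearMap.mk₂ k (fun α β : Λ => op β • dₗ k A Λ α)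
      (fun α α' β => by rw [map_add, smul_add])
      (fun r α β => by rw [map_smul, smul_comm])
      (fun α β β' => by rw [MulOpposite.op_add, add_smul])
      (fun r α β => incl_injective k A Λ (by
        change op (r • β) • incl k A Λ (dₗ k A Λ α) = r • (op β • incl k A Λ (dₗ k A Λ α))
        rw [MulOpposite.op_smul, smul_assoc])))
    (fun α a β => by
      change op β • d k A (op a • α) = op (a • β) • d k A α
      rw [d_op_smul, ← mul_smul, ← MulOpposite.op_mul, ← smul_eq])

lemma dMul_tmul (α β : Λ) : dMul k A Λ (BTensor.tmul k A α β) = op β • d k A α := by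
  rw [dMul, BTensor.lift_tmul]; rfl

lemma incl_dMul (t : BTensor k A Λ Λ) :
    incl k A Λ (dMul k A Λ t) = BTensor.tmul k A 1 (mulMap k A Λ t) - t := by
  induction t using BTensor.induction_on with
  | zero =>
    rw [map_zero, map_zero, map_zero, sub_zero]
    exact (BTensor.tmul_zero (1 : Λ)).symm
  | tmul x y =>
    rw [dMul_tmul, incl_op_smul, incl_d, smul_sub, BTensor.op_smul_tmul_right,
      BTensor.op_smul_tmul_right]
    simp [mulMap]
  | add s t hs ht => rw [map_add, map_add, map_add, hs, ht, BTensor.tmul_add]; abel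

lemma dMul_incl (ω : Omega k A Λ) : dMul k A Λ (incl k A Λ ω) = -ω := incl_injective k A Λ (by
  rw [incl_dMul, mulMap_incl, map_neg]
  exact (sub_eq_neg_self).2 (BTensor.tmul_zero (1 : Λ)))

end Omega

namespace Mho

variable (k A Λ) in
/-- The pure tensor `θ ⊗ ω ⊗ φ` in `DΛ ⊗_Λ Ω ⊗_Λ DΛ`, as a trilinear map. -/
def tri : BDual k Λ →ₗ[k] Omega k A Λ →ₗ[k] BDual k Λ →ₗ[k] DOmegaD k A Λ :=
  (BTensor.tmulₗ (k := k) (A := Λ)).compr₂ BTensor.tmulₗ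

lemma tri_apply (θ φ : BDual k Λ) (ω : Omega k A Λ) :
    tri k A Λ θ ω φ = BTensor.tmul k Λ (BTensor.tmul k Λ θ ω) φ := rfl

lemma tri_op_smul_left (l : Λ) (θ φ : BDual k Λ) (ω : Omega k A Λ) :
    tri k A Λ (op l • θ) ω φ = tri k A Λ θ (l • ω) φ := by
  rw [tri_apply, BTensor.op_smul_tmul]; rfl

lemma tri_op_smul_mid (l : Λ) (θ φ : BDual k Λ) (ω : Omega k A Λ) :
    tri k A Λ θ (op l • ω) φ = tri k A Λ θ ω (l • φ) := by
  rw [tri_apply, tri_apply, ← BTensor.op_smul_tmul, BTensor.op_smul_tmul_right]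

lemma smul_apply_tri (f : Mho k A Λ) (l : Λ) (θ φ : BDual k Λ) (ω : Omega k A Λ) :
    (l • f) (tri k A Λ θ ω φ) = f (tri k A Λ θ ω (op l • φ)) := by
  rw [BDual.smul_apply, tri_apply, BTensor.op_smul_tmul_right]; rfl

lemma op_smul_apply_tri (f : Mho k A Λ) (l : Λ) (θ φ : BDual k Λ) (ω : Omega k A Λ) :
    (op l • f) (tri k A Λ θ ω φ) = f (tri k A Λ (l • θ) ω φ) := by
  rw [BDual.op_smul_apply, tri_apply, BTensor.smul_tmul_left, BTensor.smul_tmul_left]; rfl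

lemma ext_tri {f g : Mho k A Λ}
    (h : ∀ θ ω φ, f (tri k A Λ θ ω φ) = g (tri k A Λ θ ω φ)) : f = g := by
  refine congrArg BDual.ofDual (?_ : f.toDual = g.toDual)
  refine BTensor.hom_ext fun s φ => ?_
  induction s using BTensor.induction_on with
  | zero => rw [BTensor.zero_tmul, map_zero, map_zero]
  | tmul θ ω => exact h θ ω φ
  | add s t hs ht => rw [BTensor.add_tmul, map_add, map_add, hs, ht]

/-- The value of an element of `℧` as a trilinear form. -/
def form (f : Mho k A Λ) : BDual k Λ →ₗ[k] Omega k A Λ →ₗ[k] BDual k Λ →ₗ[k] k :=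
  (tri k A Λ).compr₂ (LinearMap.llcomp k (BDual k Λ) (DOmegaD k A Λ) k f.toDual)

lemma form_op_smul_left (f : Mho k A Λ) (l : Λ) (θ φ : BDual k Λ) (ω : Omega k A Λ) :
    form f (op l • θ) ω φ = form f θ (l • ω) φ := congrArg f (tri_op_smul_left l θ φ ω)

lemma form_op_smul_mid (f : Mho k A Λ) (l : Λ) (θ φ : BDual k Λ) (ω : Omega k A Λ) :
    form f θ (op l • ω) φ = form f θ ω (l • φ) := congrArg f (tri_op_smul_mid l θ φ ω)

lemma form_smul (f : Mho k A Λ) (l : Λ) (θ φ : BDual k Λ) (ω : Omega k A Λ) :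
    form (l • f) θ ω φ = form f θ ω (op l • φ) := smul_apply_tri f l θ φ ω

lemma form_op_smul (f : Mho k A Λ) (l : Λ) (θ φ : BDual k Λ) (ω : Omega k A Λ) :
    form (op l • f) θ ω φ = form f (l • θ) ω φ := op_smul_apply_tri f l θ φ ω

lemma form_add (f g : Mho k A Λ) (θ φ : BDual k Λ) (ω : Omega k A Λ) :
    form (f + g) θ ω φ = form f θ ω φ + form g θ ω φ := rfl

lemma form_sub (f g : Mho k A Λ) (θ φ : BDual k Λ) (ω : Omega k A Λ) :
    form (f - g) θ ω φ = form f θ ω φ - form g θ ω φ := rfl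

lemma form_sum {ι : Type*} (s : Finset ι) (f : ι → Mho k A Λ) (θ φ : BDual k Λ)
    (ω : Omega k A Λ) : form (∑ i ∈ s, f i) θ ω φ = ∑ i ∈ s, form (f i) θ ω φ :=
  map_sum (AddMonoidHom.mk' (fun f : Mho k A Λ => form f θ ω φ) fun _ _ => rfl) f s

lemma ext_form {f g : Mho k A Λ} (h : ∀ θ ω φ, form f θ ω φ = form g θ ω φ) : f = g := ext_tri h

/-- As a right `Λ`-module `Ω` is generated by the `dλ`, so that an element of `℧` is determined by
its values at the `θ ⊗ dλ ⊗ φ`. -/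
lemma ext_d {f g : Mho k A Λ} (h : ∀ θ (l : Λ) φ, form f θ (Omega.d k A l) φ
    = form g θ (Omega.d k A l) φ) : f = g := by
  have key : ∀ (t : BTensor k A Λ Λ) θ φ, form f θ (Omega.dMul k A Λ t) φ
      = form g θ (Omega.dMul k A Λ t) φ := fun t θ φ => by
    induction t using BTensor.induction_on with
    | zero => simp only [map_zero, LinearMap.zero_apply]
    | tmul x y => rw [Omega.dMul_tmul, form_op_smul_mid, form_op_smul_mid, h]
    | add s t hs ht => simp only [map_add, LinearMap.add_apply, hs, ht]
  refine ext_form fun θ ω φ => ?_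
  have := key (Omega.incl k A Λ ω) θ φ
  simpa only [Omega.dMul_incl, map_neg, LinearMap.neg_apply, neg_inj] using this

section OfHom

variable (H : Omega k A Λ →ₗ[k] BDual k Λ →ₗ[k] Λ)
    (hl : ∀ (l : Λ) ω φ, H (l • ω) φ = l * H ω φ)
    (hm : ∀ (l : Λ) ω φ, H (op l • ω) φ = H ω (l • φ))

include hl in
lemma ofHomAux_balanced (θ : BDual k Λ) (l : Λ) (ω : Omega k A Λ) :
    (op l • θ).toDual ∘ₗ H ω = θ.toDual ∘ₗ H (l • ω) := LinearMap.ext fun φ => by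
  change θ (l • H ω φ) = θ (H (l • ω) φ)
  rw [hl]; rfl

/-- The map `θ ⊗ ω ↦ (φ ↦ θ(H(ω, φ)))`. -/
def ofHomAux : BTensor k Λ (BDual k Λ) (Omega k A Λ) →ₗ[k] BDual k Λ →ₗ[k] k :=
  BTensor.lift
    (LinearMap.mk₂ k (fun (θ : BDual k Λ) (ω : Omega k A Λ) => θ.toDual ∘ₗ H ω)
      (fun θ θ' ω => rfl) (fun r θ ω => rfl)
      (fun θ ω ω' => by rw [map_add, LinearMap.comp_add])
      (fun r θ ω => by rw [map_smul, LinearMap.comp_smul]))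
    (ofHomAux_balanced H hl)

lemma ofHomAux_tmul (θ φ : BDual k Λ) (ω : Omega k A Λ) :
    ofHomAux H hl (BTensor.tmul k Λ θ ω) φ = θ (H ω φ) :=
  DFunLike.congr_fun (BTensor.lift_tmul _ (ofHomAux_balanced H hl) θ ω) φ

include hm in
lemma ofHomAux_op_smul (s : BTensor k Λ (BDual k Λ) (Omega k A Λ)) (l : Λ) (φ : BDual k Λ) :
    ofHomAux H hl (op l • s) φ = ofHomAux H hl s (l • φ) := by
  induction s using BTensor.induction_on with
  | zero => rw [smul_zero, map_zero, LinearMap.zero_apply, LinearMap.zero_apply]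
  | tmul θ ω => rw [BTensor.op_smul_tmul_right, ofHomAux_tmul, ofHomAux_tmul, hm]
  | add s t hs ht =>
    rw [smul_add, map_add, map_add, LinearMap.add_apply, LinearMap.add_apply, hs, ht]

/-- The element `θ ⊗ ω ⊗ φ ↦ θ(H(ω, φ))` of `℧` given by a map `H : Ω ⊗_Λ DΛ → Λ` of left
`Λ`-modules. -/
def ofHom : Mho k A Λ :=
  BDual.ofDual (BTensor.lift (ofHomAux H hl) (ofHomAux_op_smul H hl hm))

lemma form_ofHom (θ φ : BDual k Λ) (ω : Omega k A Λ) :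
    form (ofHom H hl hm) θ ω φ = θ (H ω φ) := by
  rw [← ofHomAux_tmul H hl]
  change BTensor.lift (ofHomAux H hl) (ofHomAux_op_smul H hl hm)
    (BTensor.tmul k Λ (BTensor.tmul k Λ θ ω) φ) = _
  rw [BTensor.lift_tmul]

end OfHom

section CBar

variable [FiniteDimensional k A] [IsScalarTower k A Λ] [IsScalarTower k Aᵐᵒᵖ Λ]
  (σ : SymmetrisingElement k A)

lemma form_cBar (θ φ : BDual k Λ) (ω : Omega k A Λ) :
    form (cBar Λ σ) θ ω φ = θ (psi σ φ (Omega.incl k A Λ ω)) := cBar_tmul σ θ φ ω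

lemma form_cBar_d (θ φ : BDual k Λ) (l : Λ) : form (cBar Λ σ) θ (Omega.d k A l) φ
    = θ ((σ.lmod φ l) • (1 : Λ)) - φ ((σ.rmod θ l) • (1 : Λ)) := cBar_apply σ θ φ l

end CBar

end Mho

/-! ### The dual of `Λ` as a bimodule over `A` -/

section DualLemmas

variable [FiniteDimensional k A] [IsScalarTower k A Λ] [IsScalarTower k Aᵐᵒᵖ Λ]
  (σ : SymmetrisingElement k A)

lemma smul_one_smul_dual (a : A) (φ : BDual k Λ) : (a • (1 : Λ)) • φ = a • φ :=
  BDual.ext fun x => by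
    rw [BDual.smul_apply, BDual.smul_apply, op_smul_eq a x]; rfl

lemma op_smul_one_smul_dual (a : A) (φ : BDual k Λ) : op (a • (1 : Λ)) • φ = op a • φ :=
  BDual.ext fun x => by
    rw [BDual.op_smul_apply, BDual.op_smul_apply, smul_eq a x]; rfl

/-- Moving a factor between the functional and the argument of `φ^r`. -/
lemma rmod_op_smul_one (φ : BDual k Λ) (x : Λ) : σ.rmod (op x • φ) 1 = σ.rmod φ x :=
  σ.eq_of_forall fun b => by
    rw [σ.apply_rmod_mul, σ.apply_rmod_mul, BDual.op_smul_apply, smul_eq_mul,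
      IsAlgebraOver.mul_op_smul', mul_one]

/-- Moving a factor between the functional and the argument of `θ^l`. -/
lemma lmod_smul_one (θ : BDual k Λ) (y : Λ) : σ.lmod (y • θ) 1 = σ.lmod θ y :=
  σ.eq_of_forall fun b => by
    rw [σ.apply_lmod_mul, σ.apply_lmod_mul, BDual.smul_apply, op_smul_eq_mul,
      IsAlgebraOver.smul_mul', one_mul]

/-- Both `θ^l(1)` and `θ^r(1)` represent the restriction of `θ` to `A`. -/
lemma lmod_one_eq_rmod_one (θ : BDual k Λ) : σ.lmod θ 1 = σ.rmod θ 1 :=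
  σ.eq_of_forall fun b => by
    rw [σ.apply_lmod_mul, σ.apply_rmod_mul, IsAlgebraOver.smul_one']

lemma apply_smul_one (θ : BDual k Λ) (a : A) : θ (a • (1 : Λ)) = σ.toFun (σ.lmod θ 1 * a) :=
  (σ.apply_lmod_mul θ 1 a).symm

/-- Here `(βφ)^r(x) = (φx)^l(β)`. -/
lemma rmod_smul_eq_lmod_op_smul (φ : BDual k Λ) (x y : Λ) :
    σ.rmod (y • φ) x = σ.lmod (op x • φ) y :=
  σ.eq_of_forall fun b => by
    rw [σ.apply_rmod_mul, σ.apply_lmod_mul, BDual.smul_apply, BDual.op_smul_apply]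
    refine congrArg φ ?_
    rw [op_smul_eq_mul, smul_eq_mul, smul_eq b y, op_smul_eq b x, mul_assoc]

/-- The values of `x c̄ y`. -/
lemma form_smul_cBar (x y : Λ) (θ φ : BDual k Λ) (ω : Omega k A Λ) :
    Mho.form (x • op y • cBar Λ σ) θ ω φ
      = θ (psi σ (op x • φ) (Omega.incl k A Λ ω) * y) := by
  rw [Mho.form_smul, Mho.form_op_smul, Mho.form_cBar]; rfl

end DualLemmas

end Forms

/-! ### Derivations on a tensor algebra -/

section Derivation

variable {k A M : Type*} [Field k] [Ring A] [Algebra k A] [AddCommGroup M] [Module A M]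
  [Module Aᵐᵒᵖ M] {U V : Type*} [AddCommGroup U] [Module k U] [Module (TensorAlg k A M) U]
  [IsScalarTower k (TensorAlg k A M) U] [AddCommGroup V] [Module k V] [Module (TensorAlg k A M) V]
  [IsScalarTower k (TensorAlg k A M) V]

/-- An `A`-bimodule homomorphism `N : M → Hom_k(U, V)`, for left `T_A(M)`-modules `U` and `V`,
extends to a derivation of `T_A(M)` over `A`. The pair `(x, D x)` is encoded as the block upper
triangular endomorphism of `V × U` with diagonal given by the actions of `x`. -/
lemma TensorAlg.exists_derivation (N : M →+ (U →ₗ[k] V))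
    (hl : ∀ a m u, N (a • m) u = base k A M a • N m u)
    (hr : ∀ a m u, N (op a • m) u = N m (base k A M a • u)) :
    ∃ D : TensorAlg k A M →ₗ[k] U →ₗ[k] V,
      (∀ a u, D (base k A M a) u = 0) ∧ (∀ m u, D (ι k A M m) u = N m u) ∧
      ∀ x y u, D (x * y) u = x • D y u + D x (y • u) := by
  let s := Algebra.lsmul k k (V × U) (A := TensorAlg k A M)
  let n : M →+ Module.End k (V × U) :=
    AddMonoidHom.mk' (fun m => LinearMap.inl k V U ∘ₗ N m ∘ₗ LinearMap.snd k V U)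
      (fun m m' => by rw [map_add, LinearMap.add_comp, LinearMap.comp_add])
  have hn : ∀ m w, n m w = (N m w.2, 0) := fun _ _ => rfl
  let R : TensorAlg k A M →ₐ[k] Module.End k (V × U) :=
    TensorAlg.lift (s.comp (base k A M)) ((s : _ →+ Module.End k (V × U)).comp (ι k A M) + n)
      (fun a m => LinearMap.ext fun w => by
        change ι k A M (a • m) • w + n (a • m) w = base k A M a • (ι k A M m • w + n m w)
        rw [ι_smul, mul_smul, smul_add, hn, hn, hl]
        simp)
      (fun a m => LinearMap.ext fun w => by
        change ι k A M (op a • m) • w + n (op a • m) w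
          = ι k A M m • base k A M a • w + n m (base k A M a • w)
        rw [ι_op_smul, mul_smul, hn, hn, hr]
        rfl)
  have hRb : ∀ a w, R (base k A M a) w = base k A M a • w := fun a w => by
    simp only [R, lift_base]; rfl
  have hRι : ∀ m w, R (ι k A M m) w = ι k A M m • w + n m w := fun m w => by
    simp only [R, lift_ι]; rfl
  have hR2 : ∀ x w, (R x w).2 = x • w.2 := fun x => by
    induction x using TensorAlg.induction with
    | base a => intro w; rw [hRb, Prod.smul_snd]
    | ι m => intro w; rw [hRι, hn, Prod.snd_add, Prod.smul_snd, add_zero]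
    | add x y hx hy =>
      intro w; rw [map_add, LinearMap.add_apply, Prod.snd_add, hx, hy, add_smul]
    | mul x y hx hy => intro w; rw [map_mul, Module.End.mul_apply, hx, hy, mul_smul]
  have hR1 : ∀ x w, (R x w).1 = x • w.1 + (R x (0, w.2)).1 := fun x => by
    induction x using TensorAlg.induction with
    | base a =>
      intro w; rw [hRb, hRb, Prod.smul_fst, Prod.smul_fst, smul_zero, add_zero]
    | ι m =>
      intro w
      rw [hRι, hRι, hn, hn, Prod.fst_add, Prod.fst_add, Prod.smul_fst, Prod.smul_fst, smul_zero,
        zero_add]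
    | add x y hx hy =>
      intro w
      rw [map_add, LinearMap.add_apply, LinearMap.add_apply, Prod.fst_add, Prod.fst_add, hx, hy,
        add_smul, add_add_add_comm]
    | mul x y hx hy =>
      intro w
      rw [map_mul, Module.End.mul_apply, Module.End.mul_apply, hx, hR2, hy, hx (R y (0, w.2)),
        hR2, mul_smul, smul_add, add_assoc]
  have hadd : ∀ u u' : U, ((0, u + u') : V × U) = (0, u) + (0, u') := fun u u' => by simp
  have hsmul : ∀ (r : k) (u : U), ((0, r • u) : V × U) = r • (0, u) := fun r u => by simp
  refine ⟨LinearMap.mk₂ k (fun x u => (R x (0, u)).1) (fun x y u => ?_) (fun r x u => ?_)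
    (fun x u u' => ?_) (fun r x u => ?_), fun a u => ?_, fun m u => ?_, fun x y u => ?_⟩
  · rw [map_add, LinearMap.add_apply, Prod.fst_add]
  · rw [map_smul, LinearMap.smul_apply, Prod.smul_fst]
  · rw [hadd, map_add, Prod.fst_add]
  · rw [hsmul, map_smul, Prod.smul_fst]
  · rw [LinearMap.mk₂_apply, hRb, Prod.smul_fst, smul_zero]
  · rw [LinearMap.mk₂_apply, hRι, hn, Prod.fst_add, Prod.smul_fst, smul_zero, zero_add]
  · rw [LinearMap.mk₂_apply, LinearMap.mk₂_apply, LinearMap.mk₂_apply, map_mul,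
      Module.End.mul_apply, hR1 x, hR2]

end Derivation

/-! ### The bimodule `℧` of a tensor algebra -/

section MhoTensorAlg

variable {k A M : Type*} [Field k] [Ring A] [Algebra k A] [FiniteDimensional k A]
  {σ : SymmetrisingElement k A} [AddCommGroup M] [Module k M] [Module A M] [Module Aᵐᵒᵖ M]
  [SMulCommClass A Aᵐᵒᵖ M] [IsScalarTower k A M] [IsScalarTower k Aᵐᵒᵖ M]

namespace Mho

open TensorAlg

/-- As a bimodule `Ω` is generated by the `dm` with `m ∈ M`. -/
lemma ext_ι {f g : Mho k A (TensorAlg k A M)} (h : ∀ θ m φ, form f θ (Omega.d k A (ι k A M m)) φ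
    = form g θ (Omega.d k A (ι k A M m)) φ) : f = g := by
  refine ext_d fun θ l φ => ?_
  induction l using TensorAlg.induction generalizing θ φ with
  | base a => rw [← base_smul_one, Omega.d_smul_one]; simp
  | ι m => exact h θ m φ
  | add x y hx hy =>
    rw [← Omega.dₗ_apply, map_add, map_add, map_add, LinearMap.add_apply, LinearMap.add_apply]
    exact congrArg₂ (· + ·) (hx θ φ) (hy θ φ)
  | mul x y hx hy =>
    rw [Omega.d_mul, map_add, map_add, LinearMap.add_apply, LinearMap.add_apply,
      ← form_op_smul_left, ← form_op_smul_left, form_op_smul_mid, form_op_smul_mid, hx, hy]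

variable (σ) in
/-- The `A`-bimodule homomorphism `M → Hom_k(DΛ, Λ)`, `m ↦ (φ ↦ μ^l(m φ^r(1)))`. -/
def coeffHom (μ : BDual k M) : M →+ (BDual k (TensorAlg k A M) →ₗ[k] (TensorAlg k A M)) :=
  AddMonoidHom.mk'
    (fun m =>
      { toFun := fun φ => base k A M (σ.lmod μ (op (σ.rmod φ 1) • m))
        map_add' := fun φ φ' => by
          rw [map_add, LinearMap.add_apply, MulOpposite.op_add, add_smul, map_add, map_add]
        map_smul' := fun r φ => by
          rw [(σ.rmod (X := TensorAlg k A M)).map_smul r φ, LinearMap.smul_apply,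
            MulOpposite.op_smul, smul_assoc, (σ.lmod μ).map_smul r, map_smul, RingHom.id_apply] })
    (fun m m' => LinearMap.ext fun φ => by
      change base k A M (σ.lmod μ (op (σ.rmod φ 1) • (m + m'))) = base k A M (σ.lmod μ _)
        + base k A M (σ.lmod μ _)
      rw [smul_add, map_add, map_add])

lemma coeffHom_apply (μ : BDual k M) (m : M) (φ : BDual k (TensorAlg k A M)) :
    coeffHom σ μ m φ = base k A M (σ.lmod μ (op (σ.rmod φ 1) • m)) := rfl

variable (σ) in
/-- The functional `θ ⊗ dm ⊗ φ ↦ μ(θ^l(1) m φ^r(1))` on `DΛ ⊗_Λ Ω ⊗_Λ DΛ` exists: it is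
`θ ⊗ dλ ⊗ φ ↦ θ(D(λ)(φ))` for the derivation `D` extending `coeffHom σ μ`. -/
lemma exists_ofDualM (μ : BDual k M) : ∃ f : Mho k A (TensorAlg k A M), ∀ θ m φ,
    form f θ (Omega.d k A (ι k A M m)) φ = μ (σ.lmod θ 1 • op (σ.rmod φ 1) • m) := by
  obtain ⟨D, hb, hι, hmul⟩ := TensorAlg.exists_derivation (A := A)
    (U := BDual k (TensorAlg k A M)) (V := TensorAlg k A M) (coeffHom σ μ)
    (fun a m φ => by
      rw [coeffHom_apply, coeffHom_apply, ← smul_comm a, σ.lmod_smul, map_mul]; rfl)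
    (fun a m φ => by
      rw [coeffHom_apply, coeffHom_apply, ← base_smul_one a, smul_one_smul_dual, σ.rmod_smul,
        MulOpposite.op_mul, mul_smul])
  have hDa : ∀ (a : A) (x : TensorAlg k A M) φ, D (a • x) φ = a • D x φ := fun a x φ => by
    rw [smul_eq_base_mul, hmul, hb, add_zero]; rfl
  -- `Ψ(α ⊗ β)(φ) = α D(β)(φ)`. It is balanced over `Λ` on `Ω`, the kernel of multiplication.
  let Ψ : BTensor k A (TensorAlg k A M) (TensorAlg k A M) →ₗ[k]
      BDual k (TensorAlg k A M) →ₗ[k] TensorAlg k A M :=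
    BTensor.lift
      (LinearMap.mk₂ k (fun α β : (TensorAlg k A M) => LinearMap.mulLeft k α ∘ₗ D β)
        (fun α α' β => LinearMap.ext fun φ => add_mul α α' (D β φ))
        (fun r α β => LinearMap.ext fun φ => smul_mul_assoc r α (D β φ))
        (fun α β β' => by rw [map_add, LinearMap.comp_add])
        (fun r α β => by rw [map_smul, LinearMap.comp_smul]))
      (fun α a β => LinearMap.ext fun φ => by
        change (op a • α) * D β φ = α * D (a • β) φ
        rw [hDa, op_smul_eq_mul_base, smul_eq_base_mul, mul_assoc])
  have hΨ : ∀ α β φ, Ψ (BTensor.tmul k A α β) φ = α * D β φ := fun α β φ =>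
    DFunLike.congr_fun (BTensor.lift_tmul _ _ α β) φ
  have hΨl : ∀ (l : TensorAlg k A M) t φ, Ψ (l • t) φ = l * Ψ t φ := fun l t φ => by
    induction t using BTensor.induction_on with
    | zero => simp only [smul_zero, map_zero, LinearMap.zero_apply, mul_zero]
    | tmul x y => rw [BTensor.smul_tmul_left, hΨ, hΨ, smul_eq_mul, mul_assoc]
    | add s t hs ht => rw [smul_add, map_add, map_add, LinearMap.add_apply, LinearMap.add_apply,
        hs, ht, mul_add]
  have hΨr : ∀ (l : TensorAlg k A M) t φ,
      Ψ (op l • t) φ = mulMap k A (TensorAlg k A M) t * D l φ + Ψ t (l • φ) :=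
    fun l t φ => by
    induction t using BTensor.induction_on with
    | zero => simp only [smul_zero, map_zero, LinearMap.zero_apply, zero_mul, add_zero]
    | tmul x y =>
      rw [BTensor.op_smul_tmul_right, hΨ, hΨ, op_smul_eq_mul, hmul, mul_add, smul_eq_mul,
        ← mul_assoc]
      simp [mulMap]
    | add s t hs ht =>
      rw [smul_add, map_add, map_add, map_add, LinearMap.add_apply, LinearMap.add_apply, hs, ht,
        add_mul]
      abel
  have hl : ∀ (l : TensorAlg k A M) ω φ, (Ψ ∘ₗ Omega.incl k A (TensorAlg k A M)) (l • ω) φ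
      = l * (Ψ ∘ₗ Omega.incl k A (TensorAlg k A M)) ω φ := fun l ω φ => hΨl l _ φ
  have hm : ∀ (l : TensorAlg k A M) ω φ, (Ψ ∘ₗ Omega.incl k A (TensorAlg k A M)) (op l • ω) φ
      = (Ψ ∘ₗ Omega.incl k A (TensorAlg k A M)) ω (l • φ) := fun l ω φ => by
    change Ψ (op l • Omega.incl k A (TensorAlg k A M) ω) φ = _
    rw [hΨr, Omega.mulMap_incl, zero_mul, zero_add]; rfl
  refine ⟨ofHom (Ψ ∘ₗ Omega.incl k A (TensorAlg k A M)) hl hm, fun θ m φ => ?_⟩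
  have h1 : D 1 φ = 0 := by rw [← map_one (base k A M), hb]
  rw [form_ofHom, LinearMap.comp_apply, Omega.incl_d, map_sub, LinearMap.sub_apply, hΨ, hΨ, h1,
    hι, one_mul, mul_zero, sub_zero, coeffHom_apply, ← base_smul_one, apply_smul_one σ,
    σ.symm', σ.apply_lmod_mul]

variable (σ) in
/-- The element `θ ⊗ dm ⊗ φ ↦ μ(θ^l(1) m φ^r(1))` of `℧` given by `μ ∈ DM`. These elements identify
`℧` with `Λ ⊗_A DM ⊗_A Λ`. -/
def ofDualM (μ : BDual k M) : Mho k A (TensorAlg k A M) := (exists_ofDualM σ μ).choose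

lemma form_ofDualM (μ : BDual k M) (θ φ : BDual k (TensorAlg k A M)) (m : M) :
    form (ofDualM σ μ) θ (Omega.d k A (ι k A M m)) φ
      = μ (σ.lmod θ 1 • op (σ.rmod φ 1) • m) :=
  (exists_ofDualM σ μ).choose_spec θ m φ

lemma form_smul_ofDualM (μ : BDual k M) (x y : TensorAlg k A M)
    (θ φ : BDual k (TensorAlg k A M)) (m : M) :
    form (x • op y • ofDualM σ μ) θ (Omega.d k A (ι k A M m)) φ
      = μ (σ.lmod θ y • op (σ.rmod φ x) • m) := by
  rw [form_smul, form_op_smul, form_ofDualM, lmod_smul_one, rmod_op_smul_one]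

lemma ofDualM_add (μ ν : BDual k M) : ofDualM σ (μ + ν) = ofDualM σ μ + ofDualM σ ν :=
  ext_ι fun θ m φ => by
    rw [form_add, form_ofDualM, form_ofDualM, form_ofDualM]; rfl

lemma ofDualM_smul (a : A) (μ : BDual k M) :
    ofDualM σ (a • μ) = base k A M a • ofDualM σ μ :=
  ext_ι fun θ m φ => by
    rw [form_smul, form_ofDualM, form_ofDualM, rmod_op_smul_one, BDual.smul_apply,
      ← base_smul_one, IsAlgebraOver.smul_one', σ.rmod_op_smul, MulOpposite.op_mul, mul_smul,
      smul_comm _ (op a)]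

lemma ofDualM_op_smul (a : A) (μ : BDual k M) :
    ofDualM σ (op a • μ) = op (base k A M a) • ofDualM σ μ :=
  ext_ι fun θ m φ => by
    rw [form_op_smul, form_ofDualM, form_ofDualM, lmod_smul_one, BDual.op_smul_apply,
      ← base_smul_one, σ.lmod_smul, mul_smul]

/-- The functional `m ↦ f(θ ⊗ dm ⊗ φ)` on `M`, for `f ∈ ℧`. -/
def coeff (θ φ : BDual k (TensorAlg k A M)) : Mho k A (TensorAlg k A M) →ₗ[k] BDual k M where
  toFun f := BDual.ofDual ((form f θ).flip φ ∘ₗ Omega.dₗ k A (TensorAlg k A M) ∘ₗ ιₗ k A M)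
  map_add' _ _ := rfl
  map_smul' _ _ := rfl

lemma coeff_apply (f : Mho k A (TensorAlg k A M)) (θ φ : BDual k (TensorAlg k A M)) (m : M) :
    coeff θ φ f m = form f θ (Omega.d k A (ι k A M m)) φ := rfl

/-- Moving elements of `A` from the functionals to the form `dm`. -/
lemma form_op_smul_smul (f : Mho k A (TensorAlg k A M)) (a b : A)
    (θ φ : BDual k (TensorAlg k A M)) (m : M) :
    form f (op a • θ) (Omega.d k A (ι k A M m)) (b • φ)
      = form f θ (Omega.d k A (ι k A M (a • op b • m))) φ := by
  rw [← smul_one_smul_dual b, ← op_smul_one_smul_dual a, form_op_smul_left, ← form_op_smul_mid,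
    ι_smul, ι_op_smul, ← smul_eq_base_mul, ← op_smul_eq_mul_base, Omega.d_smul, Omega.d_op_smul,
    smul_comm (a • (1 : TensorAlg k A M))]

/-- The elements `x μ y` span `℧`, by means of dual bases of `Λ` as a right and left `A`-module. -/
lemma eq_sum_smul_ofDualM {p n : ℕ} {x : Fin p → TensorAlg k A M}
    {ξ : Fin p → BDual k (TensorAlg k A M)} {y : Fin n → TensorAlg k A M}
    {η : Fin n → BDual k (TensorAlg k A M)} (hx : SymmetrisingElement.IsRightDualBasis σ x ξ)
    (hy : SymmetrisingElement.IsLeftDualBasis σ y η) (f : Mho k A (TensorAlg k A M)) :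
    f = ∑ i, ∑ j, x i • op (y j) • ofDualM σ (coeff (η j) (ξ i) f) := by
  refine ext_ι fun θ m φ => ?_
  simp_rw [form_sum, form_smul_ofDualM, coeff_apply, ← form_op_smul_smul]
  conv_lhs => rw [← hx.sum_rmod_smul φ, ← hy.sum_lmod_smul θ]
  rw [map_sum]
  refine Finset.sum_congr rfl fun i _ => ?_
  rw [map_sum, LinearMap.sum_apply, LinearMap.sum_apply]

end Mho

namespace DoubleAlg

variable (k A M) in
/-- The canonical map `T_A(M) → T_A(M ⊕ DM)`. -/
def inΛ : (TensorAlg k A M) →ₐ[k] DoubleAlg k A M :=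
  TensorAlg.lift (TensorAlg.base k A _) (inM k A (M := M)).toAddMonoidHom
    (fun a m => by
      change TensorAlg.ι k A _ ((a • m, 0) : M × BDual k M) = _ * TensorAlg.ι k A _ (m, 0)
      rw [← TensorAlg.ι_smul, Prod.smul_mk, smul_zero])
    (fun a m => by
      change TensorAlg.ι k A _ ((op a • m, 0) : M × BDual k M) = TensorAlg.ι k A _ (m, 0) * _
      rw [← TensorAlg.ι_op_smul, Prod.smul_mk, smul_zero])

@[simp] lemma inΛ_base (a : A) :
    inΛ k A M (TensorAlg.base k A M a) = TensorAlg.base k A _ a := by rw [inΛ, TensorAlg.lift_base]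

@[simp] lemma inΛ_ι (m : M) : inΛ k A M (TensorAlg.ι k A M m) = inM k A m := by
  rw [inΛ, TensorAlg.lift_ι]; rfl

lemma inD_smul (a : A) (μ : BDual k M) :
    inD k A (a • μ) = TensorAlg.base k A (M × BDual k M) a * inD k A μ := by
  change TensorAlg.ι k A _ ((0, a • μ) : M × BDual k M) = _ * TensorAlg.ι k A _ (0, μ)
  rw [← TensorAlg.ι_smul, Prod.smul_mk, smul_zero]

lemma inD_op_smul (a : A) (μ : BDual k M) :
    inD k A (op a • μ) = inD k A μ * TensorAlg.base k A (M × BDual k M) a := by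
  change TensorAlg.ι k A _ ((0, op a • μ) : M × BDual k M) = TensorAlg.ι k A _ (0, μ) * _
  rw [← TensorAlg.ι_op_smul, Prod.smul_mk, smul_zero]

section TensorAlgOver

open TensorAlg

variable {X : Type*} [AddCommGroup X] [Module (TensorAlg k A M) X] [Module (TensorAlg k A M)ᵐᵒᵖ X]
  (j : BDual k M →+ X) (hl : ∀ (a : A) μ, j (a • μ) = base k A M a • j μ)
  (hr : ∀ (a : A) μ, j (op a • μ) = op (base k A M a) • j μ)

/-- The homomorphism `T_A(M ⊕ DM) → T_Λ(X)`, where `Λ = T_A(M)`, given by a homomorphism of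
`A`-bimodules from `DM` to the `Λ`-bimodule `X`. -/
def toTensorAlg : DoubleAlg k A M →ₐ[k] TensorAlg k (TensorAlg k A M) X :=
  TensorAlg.lift ((base k _ X).comp (base k A M))
    (((base k (TensorAlg k A M) X : _ →+ TensorAlg k (TensorAlg k A M) X).comp (ι k A M)).coprod
      ((ι k (TensorAlg k A M) X).comp j))
    (fun a z => by
      change base k _ X (ι k A M (a • z.1)) + ι k _ X (j (a • z.2)) = base k _ X (base k A M a)
        * (base k _ X (ι k A M z.1) + ι k _ X (j z.2))
      rw [hl, ι_smul, ι_smul, map_mul, mul_add])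
    (fun a z => by
      change base k _ X (ι k A M (op a • z.1)) + ι k _ X (j (op a • z.2))
        = (base k _ X (ι k A M z.1) + ι k _ X (j z.2)) * base k _ X (base k A M a)
      rw [hr, ι_op_smul, ι_op_smul, map_mul, add_mul])

lemma toTensorAlg_base (a : A) :
    toTensorAlg j hl hr (base k A _ a) = base k _ X (base k A M a) := by
  rw [toTensorAlg, lift_base]; rfl

lemma toTensorAlg_inM (m : M) : toTensorAlg j hl hr (inM k A m) = base k _ X (ι k A M m) := by
  refine (lift_ι _ _ _ _ _).trans ?_
  simp

lemma toTensorAlg_inD (μ : BDual k M) : toTensorAlg j hl hr (inD k A μ) = ι k _ X (j μ) := by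
  refine (lift_ι _ _ _ _ _).trans ?_
  simp

lemma toTensorAlg_inΛ (l : TensorAlg k A M) :
    toTensorAlg j hl hr (inΛ k A M l) = base k _ X l := by
  induction l using TensorAlg.induction with
  | base a => rw [inΛ_base, toTensorAlg_base]
  | ι m => rw [inΛ_ι, toTensorAlg_inM]
  | add x y hx hy => rw [map_add, map_add, map_add, hx, hy]
  | mul x y hx hy => rw [map_mul, map_mul, map_mul, hx, hy]

/-- The isomorphism `T_Λ(X) ≅ T_A(M ⊕ DM)` for `Λ = T_A(M)` and a `Λ`-bimodule `X` induced from the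
`A`-bimodule `DM`. That `X` is induced enters through the bimodule homomorphism `g` from `X` to
`T_A(M ⊕ DM)` compatible with the maps from `DM`. -/
def tensorAlgEquivDouble (g : X →+ DoubleAlg k A M)
    (gl : ∀ l x, g (l • x) = inΛ k A M l * g x) (gr : ∀ l x, g (op l • x) = g x * inΛ k A M l)
    (hgj : ∀ μ, g (j μ) = inD k A μ) (hjg : ∀ x, toTensorAlg j hl hr (g x) = ι k _ X x) :
    TensorAlg k (TensorAlg k A M) X ≃ₐ[k] DoubleAlg k A M :=
  AlgEquiv.ofAlgHom (TensorAlg.lift (inΛ k A M) g gl gr) (toTensorAlg j hl hr)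
    (TensorAlg.hom_ext
      (fun a => by
        rw [AlgHom.comp_apply, toTensorAlg_base, lift_base, inΛ_base, AlgHom.id_apply])
      (fun z => by
        have hz : ι k A _ z = inM k A z.1 + inD k A z.2 := by
          change ι k A _ z = ι k A _ (z.1, 0) + ι k A _ (0, z.2)
          rw [← map_add, Prod.mk_add_mk, add_zero, zero_add]
        rw [AlgHom.comp_apply, hz, map_add, map_add, toTensorAlg_inM, toTensorAlg_inD, lift_base,
          lift_ι, inΛ_ι, hgj, AlgHom.id_apply]))
    (TensorAlg.hom_ext
      (fun l => by rw [AlgHom.comp_apply, lift_base, toTensorAlg_inΛ, AlgHom.id_apply])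
      (fun u => by rw [AlgHom.comp_apply, lift_ι, hjg, AlgHom.id_apply]))

variable {g : X →+ DoubleAlg k A M}
    {gl : ∀ l x, g (l • x) = inΛ k A M l * g x} {gr : ∀ l x, g (op l • x) = g x * inΛ k A M l}
    {hgj : ∀ μ, g (j μ) = inD k A μ} {hjg : ∀ x, toTensorAlg j hl hr (g x) = ι k _ X x}

lemma tensorAlgEquivDouble_base (l : TensorAlg k A M) :
    tensorAlgEquivDouble j hl hr g gl gr hgj hjg (base k _ X l) = inΛ k A M l := lift_base _ _ _ _ l

lemma tensorAlgEquivDouble_ι (x : X) :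
    tensorAlgEquivDouble j hl hr g gl gr hgj hjg (ι k _ X x) = g x := lift_ι _ _ _ _ x

end TensorAlgOver

end DoubleAlg

namespace Mho

open TensorAlg DoubleAlg

section ToDouble

variable (σ) [IsSemisimpleRing A] [FiniteDimensional k (TensorAlg k A M)]

/-- There is a linear map `℧ → T_A(M ⊕ DM)` sending `x μ y` to the product `x μ y`. It is written
down with the coefficients of `eq_sum_smul_ofDualM`, which are defined for all elements of `℧`, so
that no well-definedness is at issue. -/
lemma exists_toDouble : ∃ g : Mho k A (TensorAlg k A M) →ₗ[k] DoubleAlg k A M,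
    ∀ (x y : TensorAlg k A M) (μ : BDual k M),
      g (x • op y • ofDualM σ μ) = inΛ k A M x * inD k A μ * inΛ k A M y := by
  obtain ⟨p, x, ξ, hx⟩ := σ.exists_isRightDualBasis (TensorAlg k A M)
  obtain ⟨n, y, η, hy⟩ := σ.exists_isLeftDualBasis (TensorAlg k A M)
  refine ⟨∑ i, ∑ j, LinearMap.mulLeftRight k (inΛ k A M (x i), inΛ k A M (y j)) ∘ₗ inD k A ∘ₗ
    coeff (η j) (ξ i), fun u v μ => ?_⟩
  have hc : ∀ i j, coeff (η j) (ξ i) (u • op v • ofDualM σ μ)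
      = σ.rmod (ξ i) u • op (σ.lmod (η j) v) • μ := fun i j => BDual.ext fun m => by
    rw [coeff_apply, form_smul_ofDualM, BDual.smul_apply, BDual.op_smul_apply]
  conv_rhs => rw [← hx u, ← hy v, map_sum, map_sum, Finset.sum_mul, Finset.sum_mul]
  rw [LinearMap.sum_apply]
  refine Finset.sum_congr rfl fun i _ => ?_
  rw [LinearMap.sum_apply, Finset.mul_sum]
  refine Finset.sum_congr rfl fun j _ => ?_
  rw [LinearMap.comp_apply, LinearMap.comp_apply, hc, LinearMap.mulLeftRight_apply, inD_smul,
    inD_op_smul, op_smul_eq_mul_base, smul_eq_base_mul, map_mul, map_mul, inΛ_base, inΛ_base]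
  simp only [mul_assoc]

/-- The homomorphism of `Λ`-bimodules `℧ → T_A(M ⊕ DM)` sending `x μ y` to the product `x μ y`. -/
def toDouble : Mho k A (TensorAlg k A M) →ₗ[k] DoubleAlg k A M := (exists_toDouble σ).choose

lemma toDouble_smul_ofDualM (x y : TensorAlg k A M) (μ : BDual k M) :
    toDouble σ (x • op y • ofDualM σ μ) = inΛ k A M x * inD k A μ * inΛ k A M y :=
  (exists_toDouble σ).choose_spec x y μ

lemma toDouble_ofDualM (μ : BDual k M) : toDouble σ (ofDualM σ μ) = inD k A μ := by
  simpa using toDouble_smul_ofDualM σ 1 1 μ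

/-- Induction on elements of `℧`, which is spanned by the `x μ y`. -/
lemma span_induction {P : Mho k A (TensorAlg k A M) → Prop} (add : ∀ f g, P f → P g → P (f + g))
    (smul : ∀ (x y : TensorAlg k A M) (μ : BDual k M), P (x • op y • ofDualM σ μ))
    (f : Mho k A (TensorAlg k A M)) : P f := by
  obtain ⟨p, x, ξ, hx⟩ := σ.exists_isRightDualBasis (TensorAlg k A M)
  obtain ⟨n, y, η, hy⟩ := σ.exists_isLeftDualBasis (TensorAlg k A M)
  have h0 : P 0 := by
    have := smul 0 0 0
    rwa [zero_smul] at this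
  rw [eq_sum_smul_ofDualM hx hy f]
  exact Finset.sum_induction _ P add h0 fun i _ =>
    Finset.sum_induction _ P add h0 fun j _ => smul _ _ _

lemma toDouble_smul (l : TensorAlg k A M) (f : Mho k A (TensorAlg k A M)) :
    toDouble σ (l • f) = inΛ k A M l * toDouble σ f := by
  refine span_induction σ (P := fun f => toDouble σ (l • f) = inΛ k A M l * toDouble σ f)
    (fun f g hf hg => ?_) (fun x y μ => ?_) f
  · rw [smul_add, map_add, map_add, hf, hg, mul_add]
  · rw [← mul_smul, toDouble_smul_ofDualM, toDouble_smul_ofDualM, map_mul, mul_assoc, mul_assoc,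
      mul_assoc]

lemma toDouble_op_smul (l : TensorAlg k A M) (f : Mho k A (TensorAlg k A M)) :
    toDouble σ (op l • f) = toDouble σ f * inΛ k A M l := by
  refine span_induction σ (P := fun f => toDouble σ (op l • f) = toDouble σ f * inΛ k A M l)
    (fun f g hf hg => ?_) (fun x y μ => ?_) f
  · rw [smul_add, map_add, map_add, hf, hg, add_mul]
  · rw [← smul_comm x (op l), ← mul_smul (op l), ← MulOpposite.op_mul, toDouble_smul_ofDualM,
      toDouble_smul_ofDualM, map_mul, mul_assoc, mul_assoc, mul_assoc]

/-- The element `Σ m_i μ_i` of `℧` given by `t = Σ m_i ⊗ μ_i`, evaluated through `evRight`. -/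
lemma exists_toDouble_eq_inMD (t : BTensor k A M (BDual k M)) : ∃ u : Mho k A (TensorAlg k A M),
    toDouble σ u = inMD k A t ∧ ∀ θ m φ, form u θ (Omega.d k A (ι k A M m)) φ
      = φ (ι k A M (evRight σ M t (σ.lmod θ 1 • m))) := by
  induction t using BTensor.induction_on with
  | zero => exact ⟨0, by simp, fun θ m φ => by
      rw [map_zero, LinearMap.zero_apply, map_zero]; exact (map_zero φ.toDual).symm⟩
  | tmul n μ =>
    refine ⟨ι k A M n • ofDualM σ μ, ?_, fun θ m φ => ?_⟩
    · rw [toDouble_smul, toDouble_ofDualM, inΛ_ι, inMD, BTensor.lift_tmul]; rfl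
    · rw [form_smul, form_ofDualM, rmod_op_smul_one, smul_comm, ← σ.apply_rmod, σ.rmod_op_smul,
        σ.symm', ← σ.rmod_op_smul, σ.apply_rmod, evRight_tmul, ι_op_smul, op_smul_eq_mul_base]
  | add s t hs ht =>
    obtain ⟨u, hu, hu'⟩ := hs
    obtain ⟨v, hv, hv'⟩ := ht
    refine ⟨u + v, by rw [map_add, map_add, hu, hv], fun θ m φ => ?_⟩
    rw [form_add, hu', hv', map_add, LinearMap.add_apply, map_add]
    exact (map_add φ.toDual _ _).symm

/-- The element `Σ ν_j n_j` of `℧` given by `t = Σ ν_j ⊗ n_j`, evaluated through `evLeft`. -/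
lemma exists_toDouble_eq_inDM (t : BTensor k A (BDual k M) M) : ∃ u : Mho k A (TensorAlg k A M),
    toDouble σ u = inDM k A t ∧ ∀ θ m φ, form u θ (Omega.d k A (ι k A M m)) φ
      = θ (ι k A M (evLeft σ M t (op (σ.rmod φ 1) • m))) := by
  induction t using BTensor.induction_on with
  | zero => exact ⟨0, by simp, fun θ m φ => by
      rw [map_zero, LinearMap.zero_apply, map_zero]; exact (map_zero θ.toDual).symm⟩
  | tmul ν n =>
    refine ⟨op (ι k A M n) • ofDualM σ ν, ?_, fun θ m φ => ?_⟩
    · rw [toDouble_op_smul, toDouble_ofDualM, inΛ_ι, inDM, BTensor.lift_tmul]; rfl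
    · rw [form_op_smul, form_ofDualM, lmod_smul_one, ← σ.apply_lmod, σ.lmod_smul,
        σ.symm', ← σ.lmod_smul, σ.apply_lmod, evLeft_tmul, ι_smul, smul_eq_base_mul]
  | add s t hs ht =>
    obtain ⟨u, hu, hu'⟩ := hs
    obtain ⟨v, hv, hv'⟩ := ht
    refine ⟨u + v, by rw [map_add, map_add, hu, hv], fun θ m φ => ?_⟩
    rw [form_add, hu', hv', map_add, LinearMap.add_apply, map_add]
    exact (map_add θ.toDual _ _).symm

variable {σ} in
/-- Both `c̄` and the element of `℧` given by `ρ - ℓ` take the value `θ(φ^l(m)) - φ(θ^r(m))` at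
`θ ⊗ dm ⊗ φ`. -/
lemma toDouble_cBar {ρ : BTensor k A M (BDual k M)} {ℓ : BTensor k A (BDual k M) M}
    (hρ : IsRho σ M ρ) (hℓ : IsEll σ M ℓ) :
    toDouble σ (cBar (TensorAlg k A M) σ) = cElement k A ρ ℓ := by
  obtain ⟨u, hu, hu'⟩ := exists_toDouble_eq_inMD σ ρ
  obtain ⟨v, hv, hv'⟩ := exists_toDouble_eq_inDM σ ℓ
  rw [cElement, ← hu, ← hv, ← map_sub]
  refine congrArg (toDouble σ) (ext_ι fun θ m φ => ?_)
  rw [form_cBar_d, form_sub, hu', hv', show evRight σ M ρ = _ from hρ,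
    show evLeft σ M ℓ = _ from hℓ, LinearMap.id_apply, LinearMap.id_apply]
  congr 1
  · rw [apply_smul_one σ, ← σ.lmod_smul, σ.apply_lmod, ι_smul, smul_eq_base_mul]
  · rw [apply_smul_one σ, lmod_one_eq_rmod_one, σ.symm', ← σ.rmod_op_smul, σ.apply_rmod, ι_op_smul,
      op_smul_eq_mul_base]

/-- As `℧` is generated by `DM`, a homomorphism on `T_A(M ⊕ DM)` which agrees on `Λ` and `DM` with
that given by a bimodule homomorphism `i` on `℧` agrees with `i` on all of `℧`. -/
lemma algHom_toDouble {B : Type*} [Ring B] [Algebra k B] (G : DoubleAlg k A M →ₐ[k] B)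
    (b : TensorAlg k A M →ₐ[k] B) (i : Mho k A (TensorAlg k A M) →+ B)
    (hl : ∀ l u, i (l • u) = b l * i u) (hr : ∀ l u, i (op l • u) = i u * b l)
    (hb : ∀ l, G (inΛ k A M l) = b l) (hi : ∀ μ, G (inD k A μ) = i (ofDualM σ μ))
    (u : Mho k A (TensorAlg k A M)) : G (toDouble σ u) = i u := by
  refine span_induction σ (P := fun u => G (toDouble σ u) = i u)
    (fun f g hf hg => ?_) (fun x y μ => ?_) u
  · rw [map_add, map_add, map_add, hf, hg]
  · rw [toDouble_smul_ofDualM, map_mul, map_mul, hb, hb, hi, hl, hr, mul_assoc]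

/-- The isomorphism `T_Λ(℧) ≅ T_A(M ⊕ DM)`. -/
def tensorAlgEquiv :
    TensorAlg k (TensorAlg k A M) (Mho k A (TensorAlg k A M)) ≃ₐ[k] DoubleAlg k A M :=
  tensorAlgEquivDouble (AddMonoidHom.mk' (ofDualM σ) ofDualM_add) ofDualM_smul ofDualM_op_smul
    (toDouble σ).toAddMonoidHom (toDouble_smul σ) (toDouble_op_smul σ) (toDouble_ofDualM σ)
    (algHom_toDouble σ _ (base k (TensorAlg k A M) (Mho k A (TensorAlg k A M)))
      (ι k (TensorAlg k A M) (Mho k A (TensorAlg k A M))) (ι_smul k) (ι_op_smul k)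
      (toTensorAlg_inΛ _ _ _) (toTensorAlg_inD _ _ _))

lemma tensorAlgEquiv_base (l : TensorAlg k A M) :
    tensorAlgEquiv σ (base k _ _ l) = inΛ k A M l := tensorAlgEquivDouble_base _ _ _ l

lemma tensorAlgEquiv_ι (u : Mho k A (TensorAlg k A M)) :
    tensorAlgEquiv σ (ι k _ _ u) = toDouble σ u := tensorAlgEquivDouble_ι _ _ _ u

end ToDouble

end Mho

end MhoTensorAlg

/-! ### Computing `Ext¹` from a projective presentation -/

section Connecting

variable {Λ : Type u} [Ring Λ] {X Y P : Type u} [AddCommGroup X] [AddCommGroup Y] [AddCommGroup P]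
  [Module Λ X] [Module Λᵐᵒᵖ X] [SMulCommClass Λ Λᵐᵒᵖ X] [Module Λ Y] [Module Λᵐᵒᵖ Y]
  [SMulCommClass Λ Λᵐᵒᵖ Y] [Module Λ P] {π : P →ₗ[Λ] X} (hπ : Function.Surjective π)

/-- The connecting homomorphism `Hom_Λ(ker π, Y) → Ext¹_Λ(X, Y)` of a surjection `π : P → X`. -/
def connecting : (LinearMap.ker π →ₗ[Λ] Y) →+ ExtOne Λ X Y :=
  AddMonoidHom.mk'
    (fun h => (π.shortExact_shortComplexKer hπ).extClass.comp
      (Abelian.Ext.mk₀ (ModuleCat.ofHom h)) (add_zero 1))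
    (fun h h' => by
      rw [ModuleCat.ofHom_add, Abelian.Ext.mk₀_add, Abelian.Ext.comp_add]; rfl)

lemma connecting_apply (h : LinearMap.ker π →ₗ[Λ] Y) : connecting hπ h =
    (π.shortExact_shortComplexKer hπ).extClass.comp
      (Abelian.Ext.mk₀ (ModuleCat.ofHom h)) (add_zero 1) := rfl

lemma connecting_surjective [Module.Projective Λ P] :
    Function.Surjective (connecting (Y := Y) hπ) := fun e => by
  have : Projective π.shortComplexKer.X₂ :=
    inferInstanceAs (Projective (ModuleCat.of Λ P))
  obtain ⟨x, hx⟩ := Abelian.Ext.contravariant_sequence_exact₃ (π.shortExact_shortComplexKer hπ)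
    (ModuleCat.of Λ Y) e (Abelian.Ext.eq_zero_of_projective _) (add_zero 1)
  obtain ⟨h, rfl⟩ := (Abelian.Ext.mk₀_bijective _ _).2 x
  exact ⟨h.hom, hx⟩

lemma connecting_eq_zero_iff (h : LinearMap.ker π →ₗ[Λ] Y) :
    connecting hπ h = 0 ↔ ∃ H : P →ₗ[Λ] Y, ∀ t : LinearMap.ker π, H t = h t := by
  constructor
  · intro h0
    obtain ⟨x, hx⟩ := Abelian.Ext.contravariant_sequence_exact₁ (π.shortExact_shortComplexKer hπ)
      (ModuleCat.of Λ Y) _ (add_zero 1) h0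
    obtain ⟨H, rfl⟩ := (Abelian.Ext.mk₀_bijective _ _).2 x
    rw [Abelian.Ext.mk₀_comp_mk₀] at hx
    have := (Abelian.Ext.mk₀_bijective _ _).1 hx
    exact ⟨H.hom, fun t => congrArg (fun f => f.hom t) this⟩
  · rintro ⟨H, hH⟩
    have : ModuleCat.ofHom h = π.shortComplexKer.f ≫ ModuleCat.ofHom H :=
      ModuleCat.hom_ext (LinearMap.ext fun t => (hH t).symm)
    rw [connecting_apply, this, ← Abelian.Ext.mk₀_comp_mk₀]
    exact (π.shortExact_shortComplexKer hπ).extClass_comp_assoc _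

lemma op_smul_connecting (l : Λ) {h h' : LinearMap.ker π →ₗ[Λ] Y} (hh : ∀ t, h' t = op l • h t) :
    connecting hπ h' = op l • connecting hπ h := by
  have : ModuleCat.ofHom h' = ModuleCat.ofHom h ≫ rightMulHom Λ Y l :=
    ModuleCat.hom_ext (LinearMap.ext hh)
  rw [connecting_apply, this, ← Abelian.Ext.mk₀_comp_mk₀]
  exact (Abelian.Ext.comp_assoc_of_third_deg_zero _ _ _ _).symm

/-- The left action on `Ext¹(X, Y)` is computed by lifting right multiplication on `X` to `P`. -/
lemma smul_connecting (l : Λ) (r : P →ₗ[Λ] P) (hr : ∀ t, π (r t) = op l • π t)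
    {h h' : LinearMap.ker π →ₗ[Λ] Y}
    (hh : ∀ (t : LinearMap.ker π) (ht : r t ∈ LinearMap.ker π), h' t = h ⟨r t, ht⟩) :
    connecting hπ h' = l • connecting hπ h := by
  have hk : ∀ t ∈ LinearMap.ker π, r t ∈ LinearMap.ker π := fun t ht => by
    rw [LinearMap.mem_ker, hr, LinearMap.mem_ker.1 ht, smul_zero]
  let φ : π.shortComplexKer ⟶ π.shortComplexKer :=
    { τ₁ := ModuleCat.ofHom (r.restrict hk)
      τ₂ := ModuleCat.ofHom r
      τ₃ := rightMulHom Λ X l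
      comm₁₂ := rfl
      comm₂₃ := ModuleCat.hom_ext (LinearMap.ext hr) }
  have : ModuleCat.ofHom h' = ModuleCat.ofHom (r.restrict hk) ≫ ModuleCat.ofHom h :=
    ModuleCat.hom_ext (LinearMap.ext fun t => hh t (hk t t.2))
  rw [connecting_apply, this, ← Abelian.Ext.mk₀_comp_mk₀]
  have h1 := ShortComplex.ShortExact.extClass_naturality (π.shortExact_shortComplexKer hπ)
    (π.shortExact_shortComplexKer hπ) φ
  refine (Abelian.Ext.comp_assoc_of_third_deg_zero _ _ _ _).symm.trans ?_
  refine (congrArg (fun e => e.comp (Abelian.Ext.mk₀ (ModuleCat.ofHom h)) (add_zero 1)) h1).trans ?_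
  exact Abelian.Ext.comp_assoc_of_third_deg_zero _ _ _ _

end Connecting

namespace BDual

variable {k X : Type*} [Field k] [AddCommGroup X] [Module k X] (θ : BDual k X)

lemma apply_zero : θ (0 : X) = 0 := map_zero θ.toDual

lemma apply_add (x y : X) : θ (x + y) = θ x + θ y := map_add θ.toDual x y

lemma apply_neg (x : X) : θ (-x) = -θ x := map_neg θ.toDual x

lemma apply_smul (r : k) (x : X) : θ (r • x) = r • θ x := map_smul θ.toDual r x

end BDual

/-! ### The presentation `Λ ⊗_A DΛ → DΛ` -/

section Presentation

variable {k A Λ : Type*} [Field k] [Ring A] [Algebra k A] [Ring Λ] [Algebra k Λ]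
  [Module A Λ] [Module Aᵐᵒᵖ Λ] [IsAlgebraOver A Λ] [FiniteDimensional k A] [IsScalarTower k A Λ]
  [IsScalarTower k Aᵐᵒᵖ Λ]

variable (k A Λ) in
/-- The left `Λ`-module `Λ ⊗_A DΛ`. -/
abbrev DualCover : Type _ := BTensor k A Λ (BDual k Λ)

namespace DualCover

lemma op_smul_smul_dual (a : A) (l : Λ) (φ : BDual k Λ) : (op a • l) • φ = l • a • φ := by
  rw [op_smul_eq, mul_smul, smul_one_smul_dual]

variable (k A Λ) in
/-- The action map `Λ ⊗_A DΛ → DΛ` as a linear map over `k`. -/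
def actₗ : DualCover k A Λ →ₗ[k] BDual k Λ :=
  BTensor.lift (LinearMap.mk₂ k (fun (l : Λ) (φ : BDual k Λ) => l • φ)
    (fun l l' φ => add_smul l l' φ) (fun r l φ => smul_assoc r l φ)
    (fun l φ φ' => smul_add l φ φ') (fun r l φ => smul_comm l r φ))
    (fun l a φ => op_smul_smul_dual a l φ)

lemma actₗ_tmul (l : Λ) (φ : BDual k Λ) : actₗ k A Λ (BTensor.tmul k A l φ) = l • φ :=
  BTensor.lift_tmul _ _ l φ

lemma actₗ_smul (l : Λ) (t : DualCover k A Λ) : actₗ k A Λ (l • t) = l • actₗ k A Λ t := by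
  induction t using BTensor.induction_on with
  | zero => rw [smul_zero, map_zero, smul_zero]
  | tmul x φ => rw [BTensor.smul_tmul_left, actₗ_tmul, actₗ_tmul, smul_eq_mul, mul_smul]
  | add s t hs ht => rw [smul_add, map_add, map_add, hs, ht, smul_add]

lemma actₗ_op_smul (l : Λ) (t : DualCover k A Λ) :
    actₗ k A Λ (op l • t) = op l • actₗ k A Λ t := by
  induction t using BTensor.induction_on with
  | zero => rw [smul_zero, map_zero, smul_zero]
  | tmul x φ => rw [BTensor.op_smul_tmul_right, actₗ_tmul, actₗ_tmul, smul_comm]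
  | add s t hs ht => rw [smul_add, map_add, map_add, hs, ht, smul_add]

variable (k A Λ) in
/-- The action map `Λ ⊗_A DΛ → DΛ`. -/
def act : DualCover k A Λ →ₗ[Λ] BDual k Λ :=
  { actₗ k A Λ with map_smul' := actₗ_smul }

lemma act_apply (t : DualCover k A Λ) : act k A Λ t = actₗ k A Λ t := rfl

lemma act_surjective : Function.Surjective (act k A Λ) := fun φ =>
  ⟨BTensor.tmul k A 1 φ, (actₗ_tmul 1 φ).trans (one_smul _ φ)⟩

variable (k A Λ) in
/-- The map `(Λ ⊗_A Λ) ⊗_Λ DΛ → Λ ⊗_A DΛ`, `α ⊗ β ⊗ φ ↦ α ⊗ βφ`. -/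
def mulDual : BTensor k A Λ Λ →ₗ[k] BDual k Λ →ₗ[k] DualCover k A Λ :=
  BTensor.lift
    (LinearMap.mk₂ k
      (fun α β => BTensor.tmulₗ (k := k) (A := A) α ∘ₗ Algebra.lsmul k k (BDual k Λ) β)
      (fun α α' β => by rw [map_add, LinearMap.add_comp])
      (fun r α β => by rw [map_smul, LinearMap.smul_comp])
      (fun α β β' => by rw [map_add, LinearMap.comp_add])
      (fun r α β => by rw [map_smul, LinearMap.comp_smul]))
    (fun α a β => LinearMap.ext fun φ => by
      change BTensor.tmul k A (op a • α) (β • φ) = BTensor.tmul k A α ((a • β) • φ)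
      rw [BTensor.op_smul_tmul, ← smul_one_smul_dual, ← mul_smul, ← smul_eq])

lemma mulDual_tmul (α β : Λ) (φ : BDual k Λ) :
    mulDual k A Λ (BTensor.tmul k A α β) φ = BTensor.tmul k A α (β • φ) :=
  DFunLike.congr_fun (BTensor.lift_tmul _ _ α β) φ

lemma mulDual_smul (l : Λ) (t : BTensor k A Λ Λ) (φ : BDual k Λ) :
    mulDual k A Λ (l • t) φ = l • mulDual k A Λ t φ := by
  induction t using BTensor.induction_on with
  | zero => rw [smul_zero, map_zero, LinearMap.zero_apply, smul_zero]
  | tmul x y => rw [BTensor.smul_tmul_left, mulDual_tmul, mulDual_tmul, BTensor.smul_tmul_left]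
  | add s t hs ht => rw [smul_add, map_add, map_add, LinearMap.add_apply, LinearMap.add_apply, hs,
      ht, smul_add]

lemma mulDual_op_smul (l : Λ) (t : BTensor k A Λ Λ) (φ : BDual k Λ) :
    mulDual k A Λ (op l • t) φ = mulDual k A Λ t (l • φ) := by
  induction t using BTensor.induction_on with
  | zero => rw [smul_zero, map_zero, LinearMap.zero_apply, LinearMap.zero_apply]
  | tmul x y =>
    rw [BTensor.op_smul_tmul_right, mulDual_tmul, mulDual_tmul, op_smul_eq_mul, mul_smul]
  | add s t hs ht => rw [smul_add, map_add, map_add, LinearMap.add_apply, LinearMap.add_apply, hs,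
      ht]

lemma actₗ_mulDual (t : BTensor k A Λ Λ) (φ : BDual k Λ) :
    actₗ k A Λ (mulDual k A Λ t φ) = mulMap k A Λ t • φ := by
  induction t using BTensor.induction_on with
  | zero => rw [map_zero, map_zero, LinearMap.zero_apply, map_zero, zero_smul]
  | tmul x y => rw [mulDual_tmul, actₗ_tmul, ← mul_smul]; simp [mulMap]
  | add s t hs ht => rw [map_add, map_add, LinearMap.add_apply, map_add, hs, ht, add_smul]

lemma mulDual_incl_mem (ω : Omega k A Λ) (φ : BDual k Λ) :
    mulDual k A Λ (Omega.incl k A Λ ω) φ ∈ LinearMap.ker (act k A Λ) := by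
  rw [LinearMap.mem_ker, act_apply, actₗ_mulDual, Omega.mulMap_incl, zero_smul]

end DualCover

/-! ### Elements of `℧` as homomorphisms on the kernel of the action map -/

section Hat

variable [FiniteDimensional k Λ]

lemma ext_dual {k Λ : Type*} [Field k] [Ring Λ] [Algebra k Λ] [FiniteDimensional k Λ]
    {x y : Λ} (h : ∀ θ : BDual k Λ, θ x = θ y) : x = y :=
  (Module.evalEquiv k Λ).injective (LinearMap.ext fun θ => h θ)

variable (k Λ) in
/-- The identification of `D(DΛ)` with `Λ`. -/
def bidual : (BDual k Λ →ₗ[k] k) →ₗ[k] Λ := (Module.evalEquiv k Λ).symm.toLinearMap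

lemma apply_bidual (g : BDual k Λ →ₗ[k] k) (θ : BDual k Λ) : θ (bidual k Λ g) = g θ :=
  DFunLike.congr_fun ((Module.evalEquiv k Λ).apply_symm_apply g) θ

namespace Mho

open DualCover

/-- For `f ∈ ℧`, the element `x` of `Λ` with `θ(x) = -f(θ ⊗ dα ⊗ φ)`. -/
def hatAux (f : Mho k A Λ) (α : Λ) (φ : BDual k Λ) : Λ :=
  -bidual k Λ (LinearMap.flip (LinearMap.flip (form f) (Omega.d k A α)
    : BDual k Λ →ₗ[k] BDual k Λ →ₗ[k] k) φ)

lemma apply_hatAux (f : Mho k A Λ) (α : Λ) (φ θ : BDual k Λ) :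
    θ (hatAux f α φ) = -form f θ (Omega.d k A α) φ :=
  (BDual.apply_neg θ _).trans (congrArg Neg.neg (apply_bidual _ θ))

/-- The map `f̂ : Λ ⊗_A DΛ → Λ` with `θ(f̂(α ⊗ φ)) = -f(θ ⊗ dα ⊗ φ)`. On the kernel of the action
map it is `Λ`-linear, and corresponds to `f` under
`℧ = D(DΛ ⊗_Λ Ω ⊗_Λ DΛ) ≅ Hom_Λ(Ω ⊗_Λ DΛ, Λ)`. -/
def hat (f : Mho k A Λ) : DualCover k A Λ →ₗ[k] Λ :=
  BTensor.lift
    (LinearMap.mk₂ k (hatAux f)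
      (fun α α' φ => ext_dual fun (θ : BDual k Λ) => by
        rw [BDual.apply_add, apply_hatAux, apply_hatAux, apply_hatAux, ← Omega.dₗ_apply, map_add,
          map_add, LinearMap.add_apply, neg_add]
        rfl)
      (fun r α φ => ext_dual fun (θ : BDual k Λ) => by
        rw [BDual.apply_smul, apply_hatAux, apply_hatAux, ← Omega.dₗ_apply, map_smul, map_smul,
          LinearMap.smul_apply, smul_neg]
        rfl)
      (fun α φ φ' => ext_dual fun (θ : BDual k Λ) => by
        rw [BDual.apply_add, apply_hatAux, apply_hatAux, apply_hatAux, map_add, neg_add])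
      (fun r α φ => ext_dual fun (θ : BDual k Λ) => by
        rw [BDual.apply_smul, apply_hatAux, apply_hatAux, map_smul, smul_neg]))
    (fun α a φ => ext_dual fun (θ : BDual k Λ) => by
      change θ (hatAux f (op a • α) φ) = θ (hatAux f α (a • φ))
      rw [apply_hatAux, apply_hatAux, Omega.d_op_smul, form_op_smul_mid, smul_one_smul_dual])

lemma apply_hat_tmul (f : Mho k A Λ) (θ φ : BDual k Λ) (α : Λ) :
    θ (hat f (BTensor.tmul k A α φ)) = -form f θ (Omega.d k A α) φ :=
  (congrArg θ (BTensor.lift_tmul _ _ α φ)).trans (apply_hatAux f α φ θ)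

lemma hat_add (f g : Mho k A Λ) : hat (f + g) = hat f + hat g :=
  BTensor.hom_ext fun α φ => ext_dual fun (θ : BDual k Λ) => by
    rw [apply_hat_tmul, form_add, neg_add, ← apply_hat_tmul, ← apply_hat_tmul, LinearMap.add_apply,
      BDual.apply_add]

lemma hat_smul_apply (f : Mho k A Λ) (l : Λ) (t : DualCover k A Λ) :
    hat (l • f) t = hat f (op l • t) := by
  induction t using BTensor.induction_on with
  | zero => rw [smul_zero, map_zero, map_zero]
  | tmul α φ =>
    exact ext_dual fun (θ : BDual k Λ) => by
      rw [apply_hat_tmul, form_smul, BTensor.op_smul_tmul_right, apply_hat_tmul]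
  | add s t hs ht => rw [smul_add, map_add, map_add, hs, ht]

lemma hat_op_smul_apply (f : Mho k A Λ) (l : Λ) (t : DualCover k A Λ) :
    hat (op l • f) t = op l • hat f t := by
  induction t using BTensor.induction_on with
  | zero => rw [map_zero, map_zero, smul_zero]
  | tmul α φ =>
    exact ext_dual fun (θ : BDual k Λ) => by
      rw [apply_hat_tmul, form_op_smul, ← BDual.smul_apply, apply_hat_tmul]
  | add s t hs ht => rw [map_add, map_add, smul_add, hs, ht]

/-- The failure of `f̂` to be `Λ`-linear at `t` only depends on the image of `t` under the action
map. -/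
lemma apply_hat_smul (f : Mho k A Λ) (l : Λ) (t : DualCover k A Λ) (θ : BDual k Λ) :
    θ (hat f (l • t)) = θ (l * hat f t) - form f θ (Omega.d k A l) (actₗ k A Λ t) := by
  induction t using BTensor.induction_on with
  | zero => rw [smul_zero, map_zero, mul_zero, BDual.apply_zero, map_zero, map_zero, sub_zero]
  | tmul α φ =>
    rw [BTensor.smul_tmul_left, apply_hat_tmul, smul_eq_mul, Omega.d_mul, map_add,
      LinearMap.add_apply, form_op_smul_mid, ← form_op_smul_left, actₗ_tmul, neg_add,
      ← apply_hat_tmul, sub_eq_add_neg]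
    rfl
  | add s t hs ht =>
    rw [smul_add, map_add, BDual.apply_add, hs, ht, map_add, map_add, mul_add, BDual.apply_add,
      map_add]
    abel

/-- The restriction of `f̂` to the kernel of the action map. -/
def hatKer (f : Mho k A Λ) : LinearMap.ker (act k A Λ) →ₗ[Λ] Λ where
  toFun t := hat f t.1
  map_add' s t := map_add (hat f) s.1 t.1
  map_smul' l t := ext_dual fun (θ : BDual k Λ) => by
    have ht : actₗ k A Λ (t : DualCover k A Λ) = 0 := t.2
    exact (apply_hat_smul f l (t : DualCover k A Λ) θ).trans (by rw [ht, map_zero, sub_zero]; rfl)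

lemma hatKer_apply (f : Mho k A Λ) (t : LinearMap.ker (act k A Λ)) :
    hatKer f t = hat f (t : DualCover k A Λ) := rfl

lemma hatKer_add (f g : Mho k A Λ) : hatKer (f + g) = hatKer f + hatKer g :=
  LinearMap.ext fun t => by
    rw [LinearMap.add_apply, hatKer_apply, hat_add]; rfl

lemma apply_hat_mulDual (f : Mho k A Λ) (t : BTensor k A Λ Λ) (θ φ : BDual k Λ) :
    θ (hat f (mulDual k A Λ t φ)) = -form f θ (Omega.dMul k A Λ t) φ := by
  induction t using BTensor.induction_on with
  | zero =>
    rw [map_zero, LinearMap.zero_apply, map_zero, BDual.apply_zero, map_zero, map_zero,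
      LinearMap.zero_apply, neg_zero]
  | tmul α β => rw [mulDual_tmul, apply_hat_tmul, Omega.dMul_tmul, form_op_smul_mid]
  | add s t hs ht =>
    rw [map_add, LinearMap.add_apply, map_add, BDual.apply_add, hs, ht, map_add, map_add,
      LinearMap.add_apply, neg_add]

/-- The element `f` of `℧` is recovered from `f̂`. -/
lemma form_eq_apply_hat (f : Mho k A Λ) (ω : Omega k A Λ) (θ φ : BDual k Λ) :
    form f θ ω φ = θ (hat f (mulDual k A Λ (Omega.incl k A Λ ω) φ)) := by
  rw [apply_hat_mulDual, Omega.dMul_incl, map_neg, LinearMap.neg_apply, neg_neg]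

/-- A homomorphism `h` on the kernel of the action map is `f̂` for the element `f` of `℧` given by
`(ω, φ) ↦ h(ω φ)`, because `f̂(t) = h(t - 1 ⊗ s)` where `s` is the image of `t` in `DΛ`. -/
lemma hatKer_surjective :
    Function.Surjective (hatKer : Mho k A Λ → LinearMap.ker (act k A Λ) →ₗ[Λ] Λ) := fun h => by
  have hsm : ∀ (r : k) t (ht : t ∈ LinearMap.ker (act k A Λ))
      (hr : r • t ∈ LinearMap.ker (act k A Λ)), h ⟨r • t, hr⟩ = r • h ⟨t, ht⟩ :=
    fun r t ht hr => by
      rw [← one_smul Λ (h ⟨t, ht⟩), ← smul_assoc, ← map_smul]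
      refine congrArg h (Subtype.ext ?_)
      exact (smul_one_smul Λ r t).symm
  let H : Omega k A Λ →ₗ[k] BDual k Λ →ₗ[k] Λ :=
    LinearMap.mk₂ k
      (fun ω φ => h ⟨mulDual k A Λ (Omega.incl k A Λ ω) φ, mulDual_incl_mem ω φ⟩)
      (fun ω ω' φ => by
        rw [← map_add]
        exact congrArg h (Subtype.ext (DFunLike.congr_fun
          (map_add (mulDual k A Λ ∘ₗ (Omega.incl k A Λ : Omega k A Λ →ₗ[k] _)) ω ω') φ)))
      (fun r ω φ => by
        rw [← hsm r _ _ (by rw [← LinearMap.smul_apply, ← map_smul, ← map_smul]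
                            exact mulDual_incl_mem _ _)]
        exact congrArg h (Subtype.ext (DFunLike.congr_fun
          (map_smul (mulDual k A Λ ∘ₗ (Omega.incl k A Λ : Omega k A Λ →ₗ[k] _)) r ω) φ)))
      (fun ω φ φ' => by
        rw [← map_add]
        exact congrArg h (Subtype.ext (map_add _ _ _)))
      (fun r ω φ => by
        rw [← hsm r _ _ (by rw [← map_smul]; exact mulDual_incl_mem _ _)]
        exact congrArg h (Subtype.ext (map_smul _ _ _)))
  have hH : ∀ ω φ, H ω φ = h ⟨mulDual k A Λ (Omega.incl k A Λ ω) φ, mulDual_incl_mem ω φ⟩ :=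
    fun _ _ => rfl
  have hl : ∀ (l : Λ) ω φ, H (l • ω) φ = l * H ω φ := fun l ω φ => by
    rw [hH, hH, ← smul_eq_mul, ← map_smul]
    exact congrArg h (Subtype.ext (mulDual_smul l _ φ))
  have hm : ∀ (l : Λ) ω φ, H (op l • ω) φ = H ω (l • φ) := fun l ω φ => by
    rw [hH, hH]
    exact congrArg h (Subtype.ext (mulDual_op_smul l _ φ))
  have hmem : ∀ t : DualCover k A Λ,
      t - BTensor.tmul k A 1 (actₗ k A Λ t) ∈ LinearMap.ker (act k A Λ) := fun t => by
    rw [LinearMap.mem_ker, act_apply, map_sub, actₗ_tmul, one_smul, sub_self]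
  have key : ∀ t, hat (ofHom H hl hm) t = h ⟨_, hmem t⟩ := fun t => by
    induction t using BTensor.induction_on with
    | zero =>
      rw [map_zero]
      refine (map_zero h).symm.trans (congrArg h (Subtype.ext (Eq.symm ?_)))
      change (0 : DualCover k A Λ) - BTensor.tmul k A (1 : Λ) (actₗ k A Λ 0) = 0
      rw [map_zero, zero_sub]
      exact neg_eq_zero.2 (BTensor.tmul_zero (1 : Λ))
    | tmul α φ =>
      refine ext_dual (k := k) fun θ => ?_
      rw [apply_hat_tmul, form_ofHom, hH]
      refine (map_neg θ.toDual _).symm.trans (congrArg θ ?_)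
      rw [← map_neg]
      refine congrArg h (Subtype.ext ?_)
      change -mulDual k A Λ (BTensor.tmul k A 1 α - BTensor.tmul k A α 1) φ
        = BTensor.tmul k A α φ - BTensor.tmul k A 1 (actₗ k A Λ (BTensor.tmul k A α φ))
      rw [map_sub, LinearMap.sub_apply, mulDual_tmul, mulDual_tmul, neg_sub, one_smul, actₗ_tmul]
    | add s t hs ht =>
      rw [map_add, hs, ht, ← map_add]
      refine congrArg h (Subtype.ext ?_)
      change _ = s + t - BTensor.tmul k A 1 (actₗ k A Λ (s + t))
      rw [map_add, BTensor.tmul_add]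
      change s - _ + (t - _) = _
      abel
  refine ⟨ofHom H hl hm, LinearMap.ext fun t => ?_⟩
  rw [hatKer_apply, key]
  refine congrArg h (Subtype.ext ?_)
  change (t : DualCover k A Λ) - BTensor.tmul k A (1 : Λ) (actₗ k A Λ (t : DualCover k A Λ))
    = (t : DualCover k A Λ)
  rw [show actₗ k A Λ (t : DualCover k A Λ) = 0 from t.2]
  exact (congrArg (fun z => (t : DualCover k A Λ) - z)
    (BTensor.tmul_zero (1 : Λ))).trans (sub_zero _)

end Mho

end Hat

end Presentation

/-! ### The computation of `τ⁻Λ` -/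

section Coordinates

variable {k A Λ : Type*} [Field k] [Ring A] [Algebra k A] [Ring Λ] [Algebra k Λ]
  [Module A Λ] [Module Aᵐᵒᵖ Λ] [IsAlgebraOver A Λ] [FiniteDimensional k A] [IsScalarTower k A Λ]
  [IsScalarTower k Aᵐᵒᵖ Λ] (σ : SymmetrisingElement k A)

namespace DualCover

/-- The map `Λ ⊗_A DΛ → Λ`, `α ⊗ φ ↦ α φ^r(x)`, as a linear map over `k`. -/
def coordₗ (x : Λ) : DualCover k A Λ →ₗ[k] Λ :=
  BTensor.lift
    (LinearMap.mk₂ k (fun (α : Λ) (φ : BDual k Λ) => op (σ.rmod φ x) • α)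
      (fun α α' φ => smul_add _ α α')
      (fun r α φ => smul_comm (op (σ.rmod φ x)) r α)
      (fun α φ φ' => by rw [map_add, LinearMap.add_apply, MulOpposite.op_add, add_smul])
      (fun r α φ => by rw [map_smul, LinearMap.smul_apply, MulOpposite.op_smul, smul_assoc]))
    (fun α a φ => by
      change op (σ.rmod φ x) • op a • α = op (σ.rmod (a • φ) x) • α
      rw [σ.rmod_smul, MulOpposite.op_mul, mul_smul])

lemma coordₗ_tmul (x α : Λ) (φ : BDual k Λ) :
    coordₗ σ x (BTensor.tmul k A α φ) = op (σ.rmod φ x) • α :=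
  BTensor.lift_tmul _ _ α φ

lemma coordₗ_smul (x l : Λ) (t : DualCover k A Λ) :
    coordₗ σ x (l • t) = l • coordₗ σ x t := by
  induction t using BTensor.induction_on with
  | zero => rw [smul_zero, map_zero, smul_zero]
  | tmul α φ =>
    rw [BTensor.smul_tmul_left, coordₗ_tmul, coordₗ_tmul]
    exact (smul_comm l _ α).symm
  | add s t hs ht => rw [smul_add, map_add, map_add, hs, ht, smul_add]

/-- The homomorphism of left `Λ`-modules `Λ ⊗_A DΛ → Λ`, `α ⊗ φ ↦ α φ^r(x)`. -/
def coord (x : Λ) : DualCover k A Λ →ₗ[Λ] Λ :=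
  { coordₗ σ x with map_smul' := coordₗ_smul σ x }

lemma coord_tmul (x α : Λ) (φ : BDual k Λ) :
    coord σ x (BTensor.tmul k A α φ) = op (σ.rmod φ x) • α := coordₗ_tmul σ x α φ

lemma coord_mulDual (x : Λ) (t : BTensor k A Λ Λ) (φ : BDual k Λ) :
    coord σ x (mulDual k A Λ t φ) = psi σ (op x • φ) t := by
  induction t using BTensor.induction_on with
  | zero => rw [map_zero, LinearMap.zero_apply, map_zero, map_zero]
  | tmul α β => rw [mulDual_tmul, coord_tmul, psi_tmul, rmod_smul_eq_lmod_op_smul]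
  | add s t hs ht => rw [map_add, LinearMap.add_apply, map_add, map_add, hs, ht]

variable {σ} {n : ℕ} {x : Fin n → Λ} {ξ : Fin n → BDual k Λ}

/-- A dual basis of the right `A`-module `Λ` gives a dual basis of `Λ ⊗_A DΛ`. -/
lemma sum_coord_smul (h : σ.IsRightDualBasis x ξ) (t : DualCover k A Λ) :
    ∑ i, coord σ (x i) t • BTensor.tmul k A (1 : Λ) (ξ i) = t := by
  induction t using BTensor.induction_on with
  | zero => exact Finset.sum_eq_zero fun i _ => by rw [map_zero, zero_smul]
  | tmul α φ =>
    conv_rhs => rw [← h.sum_rmod_smul φ]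
    rw [BTensor.tmul_sum]
    refine Finset.sum_congr rfl fun i _ => ?_
    rw [coord_tmul, BTensor.smul_tmul_left, smul_eq_mul, mul_one, BTensor.op_smul_tmul]
  | add s t hs ht =>
    conv_rhs => rw [← hs, ← ht]
    rw [← Finset.sum_add_distrib]
    exact Finset.sum_congr rfl fun i _ => by rw [map_add, add_smul]

variable (k A Λ) in
lemma projective (σ : SymmetrisingElement k A) [IsSemisimpleRing A] [FiniteDimensional k Λ] :
    Module.Projective Λ (DualCover k A Λ) := by
  obtain ⟨n, x, ξ, h⟩ := σ.exists_isRightDualBasis Λ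
  refine Module.Projective.of_split (M := Fin n → Λ) (LinearMap.pi fun i => coord σ (x i))
    (∑ i, (LinearMap.toSpanSingleton Λ _ (BTensor.tmul k A (1 : Λ) (ξ i))) ∘ₗ LinearMap.proj i)
    (LinearMap.ext fun t => ?_)
  refine Eq.trans ?_ (sum_coord_smul h t)
  simp

end DualCover

namespace Mho

open DualCover

variable [FiniteDimensional k Λ]

/-- For `f = x c̄ y` the restriction of `f̂` extends to the homomorphism `α ⊗ φ ↦ α φ^r(x) y`. -/
lemma hat_smul_cBar (x y : Λ) (t : LinearMap.ker (act k A Λ)) :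
    hat (x • op y • cBar Λ σ) (t : DualCover k A Λ) = coord σ x (t : DualCover k A Λ) * y := by
  have h0 : BTensor.tmul k A (1 : Λ) (0 : BDual k Λ) = 0 :=
    BTensor.tmul_zero (1 : Λ)
  -- Off the kernel the two maps differ by the value at `1 ⊗ s`, for `s` the image of `t` in `DΛ`.
  have key : ∀ t : DualCover k A Λ, hat (x • op y • cBar Λ σ) t
      = (coord σ x t - coord σ x (BTensor.tmul k A 1 (actₗ k A Λ t))) * y := fun t => by
    induction t using BTensor.induction_on with
    | zero =>
      rw [map_zero, map_zero, map_zero, h0, map_zero, sub_zero, zero_mul]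
    | tmul α φ =>
      refine ext_dual (k := k) fun θ => ?_
      rw [apply_hat_tmul, form_smul_cBar, ← BDual.apply_neg, Omega.incl_d, map_sub, psi_tmul,
        psi_tmul, ← neg_mul, neg_sub, actₗ_tmul, coord_tmul, coord_tmul,
        rmod_smul_eq_lmod_op_smul, lmod_one_eq_rmod_one, rmod_op_smul_one]
    | add s t hs ht =>
      rw [map_add, hs, ht, ← add_mul, map_add, map_add, BTensor.tmul_add, map_add]
      congr 1
      abel
  rw [key, show actₗ k A Λ (t : DualCover k A Λ) = 0 from t.2, h0, map_zero, sub_zero]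

/-- The elements of the sub-bimodule of `℧` generated by `c̄` are those `f` for which `f̂` extends
from the kernel of the action map to a homomorphism `Λ ⊗_A DΛ → Λ`. -/
lemma exists_extension_iff [IsSemisimpleRing A] (f : Mho k A Λ) :
    (∃ H : DualCover k A Λ →ₗ[Λ] Λ, ∀ t : LinearMap.ker (act k A Λ),
      H (t : DualCover k A Λ) = hatKer f t) ↔ f ∈ LinearMap.range (cBarMap Λ σ) := by
  constructor
  · rintro ⟨H, hH⟩
    obtain ⟨n, x, ξ, h⟩ := σ.exists_isRightDualBasis Λ
    -- `H` is determined by its values at the elements `1 ⊗ ξ_i`, which generate `Λ ⊗_A DΛ`.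
    refine ⟨∑ i, BTensor.tmul k A (x i) (H (BTensor.tmul k A 1 (ξ i))),
      ext_form fun θ ω φ => Eq.symm ?_⟩
    have h1 : H (mulDual k A Λ (Omega.incl k A Λ ω) φ)
        = hat f (mulDual k A Λ (Omega.incl k A Λ ω) φ) := hH ⟨_, mulDual_incl_mem ω φ⟩
    rw [form_eq_apply_hat, ← h1, ← sum_coord_smul h (mulDual k A Λ (Omega.incl k A Λ ω) φ),
      map_sum H, map_sum (cBarMap Λ σ), form_sum]
    refine (map_sum θ.toDual _ _).trans (Finset.sum_congr rfl fun i _ => ?_)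
    rw [cBarMap_tmul, form_smul_cBar, ← coord_mulDual, map_smul]
    rfl
  · rintro ⟨s, rfl⟩
    induction s using BTensor.induction_on with
    | zero =>
      refine ⟨0, fun t => ?_⟩
      rw [map_zero, hatKer_apply, LinearMap.zero_apply]
      exact (DFunLike.congr_fun (add_eq_left.1 ((hat_add (0 : Mho k A Λ) 0).symm.trans
        (congrArg hat (add_zero _)))) (t : DualCover k A Λ)).symm
    | tmul x y =>
      refine ⟨LinearMap.toSpanSingleton Λ Λ y ∘ₗ coord σ x, fun t => ?_⟩
      rw [cBarMap_tmul, hatKer_apply, hat_smul_cBar]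
      rfl
    | add s t hs ht =>
      obtain ⟨H, hH⟩ := hs
      obtain ⟨H', hH'⟩ := ht
      refine ⟨H + H', fun t => ?_⟩
      rw [LinearMap.add_apply, hH, hH', map_add, hatKer_add]
      rfl

end Mho

end Coordinates

section TauMinus

variable {k A Λ : Type u} [Field k] [Ring A] [Algebra k A] [Ring Λ] [Algebra k Λ]
  [Module A Λ] [Module Aᵐᵒᵖ Λ] [IsAlgebraOver A Λ] [FiniteDimensional k A] [IsScalarTower k A Λ]
  [IsScalarTower k Aᵐᵒᵖ Λ] (σ : SymmetrisingElement k A) [FiniteDimensional k Λ]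

open DualCover

namespace Mho

variable (k A Λ) in
/-- The map `℧ → τ⁻Λ`, sending `f` to the image of `f̂` under the connecting homomorphism of
`Λ ⊗_A DΛ → DΛ`. -/
def toTauMinus : Mho k A Λ →+ TauMinus k Λ :=
  (connecting (X := BDual k Λ) (Y := Λ) (P := DualCover k A Λ) (π := act k A Λ)
    act_surjective).comp (AddMonoidHom.mk' hatKer hatKer_add)

lemma toTauMinus_apply (f : Mho k A Λ) : toTauMinus k A Λ f =
    connecting (X := BDual k Λ) (Y := Λ) (P := DualCover k A Λ) (π := act k A Λ)
      act_surjective (hatKer f) := rfl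

lemma toTauMinus_smul (l : Λ) (f : Mho k A Λ) :
    toTauMinus k A Λ (l • f) = l • toTauMinus k A Λ f := by
  let r : DualCover k A Λ →ₗ[Λ] DualCover k A Λ :=
    { toFun := fun t => op l • t
      map_add' := smul_add _
      map_smul' := fun a t => (smul_comm a (op l) t).symm }
  have hr : ∀ t, act k A Λ (r t) = op l • act k A Λ t := fun t => actₗ_op_smul l t
  have hh : ∀ (t : LinearMap.ker (act k A Λ)) (ht : r t ∈ LinearMap.ker (act k A Λ)),
      hatKer (l • f) t = hatKer f ⟨r t, ht⟩ := fun t _ => hat_smul_apply f l t.1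
  rw [toTauMinus_apply, toTauMinus_apply]
  exact smul_connecting (X := BDual k Λ) (Y := Λ) act_surjective l r hr hh

lemma toTauMinus_op_smul (l : Λ) (f : Mho k A Λ) :
    toTauMinus k A Λ (op l • f) = op l • toTauMinus k A Λ f := by
  have hh : ∀ t : LinearMap.ker (act k A Λ), hatKer (op l • f) t = op l • hatKer f t :=
    fun t => hat_op_smul_apply f l t.1
  rw [toTauMinus_apply, toTauMinus_apply]
  exact op_smul_connecting (X := BDual k Λ) (Y := Λ) act_surjective l hh

lemma toTauMinus_surjective (σ : SymmetrisingElement k A) [IsSemisimpleRing A] :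
    Function.Surjective (toTauMinus k A Λ) := fun e => by
  have := projective k A Λ σ
  obtain ⟨h, rfl⟩ := connecting_surjective (X := BDual k Λ) (Y := Λ) (P := DualCover k A Λ)
    (π := act k A Λ) act_surjective e
  obtain ⟨f, rfl⟩ := hatKer_surjective h
  exact ⟨f, toTauMinus_apply f⟩

lemma toTauMinus_eq_zero_iff (σ : SymmetrisingElement k A) [IsSemisimpleRing A] (f : Mho k A Λ) :
    toTauMinus k A Λ f = 0 ↔ f ∈ LinearMap.range (cBarMap Λ σ) := by
  rw [toTauMinus_apply, connecting_eq_zero_iff, exists_extension_iff]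

end Mho

variable [IsSemisimpleRing A]

variable (Λ) in
/-- The isomorphism `T_Λ(τ⁻Λ) ≅ T_Λ(℧) / ⟨c̄⟩`. -/
def tensorAlgTauMinusEquiv : TensorAlg k Λ (TauMinus k Λ) ≃ₐ[k]
    QuotBy (TensorAlg.ι k Λ (Mho k A Λ) (cBar Λ σ)) :=
  tensorAlgEquivQuotCBar Λ σ (Mho.toTauMinus k A Λ)
    (Mho.toTauMinus_surjective σ) Mho.toTauMinus_smul Mho.toTauMinus_op_smul
    (Mho.toTauMinus_eq_zero_iff σ)

end TauMinus

/-! ### The universal property of path algebras -/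

namespace PathAlgebra

section Basic

variable {k V : Type*} [Field k] [Quiver V] [Fintype V]

lemma ofPath_cons {i j l : V} (p : Quiver.Path i j) (a : j ⟶ l) :
    ofPath k (p.cons a) = ofPath k p * ofArrow k a := (ofPath_mul k p a.toPath).symm

variable (k V) in
/-- The algebra homomorphism `k^V → kQ` sending `e_i` to the trivial path at `i`. -/
def vertexHom : (V → k) →ₐ[k] PathAlgebra k V :=
  AlgHom.ofLinearMap
    (∑ i : V, (LinearMap.proj i : (V → k) →ₗ[k] k).smulRight
      (ofPath k (Quiver.Path.nil : Quiver.Path i i)))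
    (by simp [one_def])
    (fun f g => by
      simp only [LinearMap.sum_apply, LinearMap.smulRight_apply, LinearMap.proj_apply,
        Pi.mul_apply, Finset.sum_mul, Finset.mul_sum, smul_mul_assoc, mul_smul_comm]
      refine Finset.sum_congr rfl fun i _ => ?_
      rw [Finset.sum_eq_single i]
      · rw [ofPath_mul, smul_smul, mul_comm, Quiver.Path.comp_nil]
      · intro j _ hj
        rw [ofPath_mul_of_ne k _ _ hj, smul_zero]
      · simp)

lemma vertexHom_apply (f : V → k) :
    vertexHom k V f = ∑ i : V, f i • ofPath k (Quiver.Path.nil : Quiver.Path i i) := by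
  simp [vertexHom]

lemma vertexHom_mul_ofPath (f : V → k) {i j : V} (p : Quiver.Path i j) :
    vertexHom k V f * ofPath k p = f i • ofPath k p := by
  rw [vertexHom_apply, Finset.sum_mul, Finset.sum_eq_single i]
  · rw [smul_mul_assoc, ofPath_mul, Quiver.Path.nil_comp]
  · intro l _ hl
    rw [smul_mul_assoc, ofPath_mul_of_ne k _ _ hl, smul_zero]
  · simp

lemma ofPath_mul_vertexHom (f : V → k) {i j : V} (p : Quiver.Path i j) :
    ofPath k p * vertexHom k V f = f j • ofPath k p := by
  rw [vertexHom_apply, Finset.mul_sum, Finset.sum_eq_single j]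
  · rw [mul_smul_comm, ofPath_mul, Quiver.Path.comp_nil]
  · intro l _ hl
    rw [mul_smul_comm, ofPath_mul_of_ne k _ _ hl.symm, smul_zero]
  · simp

end Basic

section Lift

variable {k V : Type*} [Field k] [Quiver V] [Fintype V] [DecidableEq V] {B : Type*} [Ring B]
  [Algebra k B]

/-- The image of a path under the homomorphism given on vertices by `β` and on arrows by `γ`. -/
def evalPath (β : (V → k) →ₐ[k] B) (γ : Arrows V → B) {i : V} : ∀ {j : V}, Quiver.Path i j → B
  | _, .nil => β (Pi.single i 1)
  | _, .cons p a => evalPath β γ p * γ ⟨_, _, a⟩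

variable (β : (V → k) →ₐ[k] B) (γ : Arrows V → B)
  (hl : ∀ a : Arrows V, β (Pi.single a.1 1) * γ a = γ a)
  (hr : ∀ a : Arrows V, γ a * β (Pi.single a.2.1 1) = γ a)

lemma map_single_mul_map_single (i j : V) : β (Pi.single i 1) * β (Pi.single j 1)
    = if i = j then β (Pi.single i 1) else 0 := by
  rw [← map_mul]
  split_ifs with h
  · subst h
    rw [← Pi.single_mul, one_mul]
  · refine (congrArg β (funext fun l => ?_)).trans (map_zero β)
    by_cases hl : l = i
    · have hj : l ≠ j := fun hj => h (hl.symm.trans hj)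
      rw [Pi.mul_apply, Pi.single_eq_of_ne hj, mul_zero, Pi.zero_apply]
    · rw [Pi.mul_apply, Pi.single_eq_of_ne hl, zero_mul, Pi.zero_apply]

lemma map_single_mul_evalPath {i j : V} (p : Quiver.Path i j) :
    β (Pi.single i 1) * evalPath β γ p = evalPath β γ p := by
  induction p with
  | nil => rw [evalPath, map_single_mul_map_single, if_pos rfl]
  | cons p a ih => rw [evalPath, ← mul_assoc, ih]

include hr in
lemma evalPath_mul_map_single {i j : V} (p : Quiver.Path i j) :
    evalPath β γ p * β (Pi.single j 1) = evalPath β γ p := by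
  cases p with
  | nil => rw [evalPath, map_single_mul_map_single, if_pos rfl]
  | cons p a => rw [evalPath, mul_assoc, hr ⟨_, _, a⟩]

include hr in
lemma evalPath_comp {i j l : V} (p : Quiver.Path i j) (q : Quiver.Path j l) :
    evalPath β γ (p.comp q) = evalPath β γ p * evalPath β γ q := by
  induction q with
  | nil => rw [Quiver.Path.comp_nil, evalPath, evalPath_mul_map_single β γ hr]
  | cons q a ih => rw [Quiver.Path.comp_cons, evalPath, evalPath, ih, mul_assoc]

/-- The linear map underlying `PathAlgebra.lift`. -/
def liftₗ : PathAlgebra k V →ₗ[k] B :=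
  Finsupp.lift B k (Σ i j : V, Quiver.Path i j) fun p => evalPath β γ p.2.2

lemma liftₗ_ofPath {i j : V} (p : Quiver.Path i j) :
    liftₗ β γ (ofPath k p) = evalPath β γ p :=
  (Finsupp.lift_apply _ _ _ _ _).trans
    ((Finsupp.sum_single_index (by exact zero_smul _ _)).trans (one_smul _ _))

include hr in
lemma liftₗ_mul (x y : PathAlgebra k V) : liftₗ β γ (x * y) = liftₗ β γ x * liftₗ β γ y := by
  induction x using induction_on with
  | zero => rw [zero_mul, map_zero, zero_mul]
  | add x x' hx hx' => rw [add_mul, map_add, map_add, hx, hx', add_mul]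
  | smul r x hx => rw [smul_mul_assoc, map_smul, map_smul, hx, smul_mul_assoc]
  | path p =>
    induction y using induction_on with
    | zero => rw [mul_zero, map_zero, mul_zero]
    | add x x' hx hx' => rw [mul_add, map_add, map_add, hx, hx', mul_add]
    | smul r x hx => rw [mul_smul_comm, map_smul, map_smul, hx, mul_smul_comm]
    | path q =>
      rename_i i j i' j'
      rw [liftₗ_ofPath, liftₗ_ofPath]
      by_cases h : j = i'
      · subst h
        rw [ofPath_mul, liftₗ_ofPath, evalPath_comp β γ hr]
      · rw [ofPath_mul_of_ne k _ _ h, map_zero, ← evalPath_mul_map_single β γ hr p,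
          ← map_single_mul_evalPath β γ q, mul_assoc, ← mul_assoc (β _), map_single_mul_map_single,
          if_neg h, zero_mul, mul_zero]

lemma liftₗ_vertexHom (f : V → k) : liftₗ β γ (vertexHom k V f) = β f := by
  rw [vertexHom_apply, map_sum]
  conv_rhs => rw [← Finset.univ_sum_single f, map_sum]
  refine Finset.sum_congr rfl fun i _ => ?_
  rw [map_smul, liftₗ_ofPath, evalPath, ← map_smul, ← Pi.single_smul, smul_eq_mul, mul_one]

/-- The universal property of the path algebra. -/
def lift : PathAlgebra k V →ₐ[k] B :=
  AlgHom.ofLinearMap (liftₗ β γ)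
    (by rw [← map_one (vertexHom k V), liftₗ_vertexHom, map_one]) (liftₗ_mul β γ hr)

lemma lift_vertexHom (f : V → k) : lift β γ hr (vertexHom k V f) = β f := liftₗ_vertexHom β γ f

include hl in
lemma lift_ofArrow {i j : V} (a : i ⟶ j) : lift β γ hr (ofArrow k a) = γ ⟨i, j, a⟩ :=
  (liftₗ_ofPath β γ a.toPath).trans (hl ⟨i, j, a⟩)

lemma vertexHom_single (i : V) :
    vertexHom k V (Pi.single i 1) = ofPath k (Quiver.Path.nil : Quiver.Path i i) := by
  rw [vertexHom_apply, Finset.sum_eq_single i]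
  · rw [Pi.single_eq_same, one_smul]
  · intro j _ hj
    rw [Pi.single_eq_of_ne hj, zero_smul]
  · simp

lemma hom_ext {f g : PathAlgebra k V →ₐ[k] B}
    (hv : ∀ c, f (vertexHom k V c) = g (vertexHom k V c))
    (ha : ∀ a : Arrows V, f (ofArrow k a.2.2) = g (ofArrow k a.2.2)) : f = g := by
  refine AlgHom.ext fun x => ?_
  induction x using induction_on with
  | zero => rw [map_zero, map_zero]
  | add x x' hx hx' => rw [map_add, map_add, hx, hx']
  | smul r x hx => rw [map_smul, map_smul, hx]
  | path p =>
    induction p with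
    | nil => rw [← vertexHom_single, hv]
    | cons p a ih => rw [ofPath_cons, map_mul, map_mul, ih, ha ⟨_, _, a⟩]

end Lift

end PathAlgebra

/-! ### Tensor algebras of bimodules with a basis of arrows -/

section ArrowBasis

variable {k V : Type*} [Field k] [q : Quiver V] [Fintype V]
  {M : Type*} [AddCommGroup M] [Module k M] [Module (V → k) M] [Module (V → k)ᵐᵒᵖ M]
  [SMulCommClass (V → k) (V → k)ᵐᵒᵖ M] [IsScalarTower k (V → k) M] [IsScalarTower k (V → k)ᵐᵒᵖ M]
  (b : Module.Basis (Arrows V) k M)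

/-- If the basis elements `b_a` lie in `e_i M e_j` for `a : i ⟶ j`, then `T_A(M) → kQ`, sending
`b_a` to `a`, is an isomorphism of algebras. -/
lemma exists_equiv_pathAlgebra (hl : ∀ (f : V → k) a, f • b a = f a.1 • b a)
    (hr : ∀ (f : V → k) a, op f • b a = f a.2.1 • b a) :
    ∃ e : TensorAlg k (V → k) M ≃ₐ[k] PathAlgebra k V,
      (∀ f, e (TensorAlg.base k _ _ f) = PathAlgebra.vertexHom k V f) ∧
      ∀ a, e (TensorAlg.ι k _ _ (b a)) = PathAlgebra.ofArrow k a.2.2 := by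
  classical
  let g : M →ₗ[k] PathAlgebra k V := b.constr k fun a => PathAlgebra.ofArrow k a.2.2
  have hg : ∀ a, g (b a) = PathAlgebra.ofArrow k a.2.2 := fun a => b.constr_basis k _ a
  have hgl : ∀ (f : V → k) (m : M), g (f • m) = PathAlgebra.vertexHom k V f * g m := fun f =>
    LinearMap.congr_fun (b.ext (f₁ := g ∘ₗ Algebra.lsmul k k M f)
      (f₂ := LinearMap.mulLeft k (PathAlgebra.vertexHom k V f) ∘ₗ g) fun a => by
        change g (f • b a) = PathAlgebra.vertexHom k V f * g (b a)
        rw [hl, map_smul, hg]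
        exact (PathAlgebra.vertexHom_mul_ofPath f _).symm)
  have hgr : ∀ (f : V → k) (m : M), g (op f • m) = g m * PathAlgebra.vertexHom k V f := fun f =>
    LinearMap.congr_fun (b.ext (f₁ := g ∘ₗ Algebra.lsmul k k M (op f))
      (f₂ := LinearMap.mulRight k (PathAlgebra.vertexHom k V f) ∘ₗ g) fun a => by
        change g (op f • b a) = g (b a) * PathAlgebra.vertexHom k V f
        rw [hr, map_smul, hg]
        exact (PathAlgebra.ofPath_mul_vertexHom f _).symm)
  let F : TensorAlg k (V → k) M →ₐ[k] PathAlgebra k V :=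
    TensorAlg.lift (PathAlgebra.vertexHom k V) g.toAddMonoidHom hgl hgr
  have hFb : ∀ f, F (TensorAlg.base k _ _ f) = PathAlgebra.vertexHom k V f := fun f =>
    TensorAlg.lift_base _ _ _ _ f
  have hFι : ∀ m, F (TensorAlg.ι k _ _ m) = g m := fun m => TensorAlg.lift_ι _ _ _ _ m
  have hγl : ∀ a : Arrows V, TensorAlg.base k (V → k) M (Pi.single a.1 1) * TensorAlg.ι k _ _ (b a)
      = TensorAlg.ι k _ _ (b a) := fun a => by
    rw [← TensorAlg.ι_smul, hl, Pi.single_eq_same, one_smul]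
  have hγr : ∀ a : Arrows V,
      TensorAlg.ι k _ _ (b a) * TensorAlg.base k (V → k) M (Pi.single a.2.1 1)
        = TensorAlg.ι k _ _ (b a) := fun a => by
    rw [← TensorAlg.ι_op_smul, hr, Pi.single_eq_same, one_smul]
  let G : PathAlgebra k V →ₐ[k] TensorAlg k (V → k) M :=
    PathAlgebra.lift (TensorAlg.base k _ _) (fun a => TensorAlg.ι k _ _ (b a)) hγr
  have hGb : ∀ f, G (PathAlgebra.vertexHom k V f) = TensorAlg.base k _ _ f := fun f =>
    PathAlgebra.lift_vertexHom _ _ hγr f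
  have hGa : ∀ a : Arrows V, G (PathAlgebra.ofArrow k a.2.2) = TensorAlg.ι k _ _ (b a) := fun a =>
    PathAlgebra.lift_ofArrow _ _ hγl hγr a.2.2
  refine ⟨AlgEquiv.ofAlgHom F G ?_ ?_, hFb, fun a => (hFι _).trans (hg a)⟩
  · refine PathAlgebra.hom_ext (fun c => ?_) (fun a => ?_)
    · rw [AlgHom.comp_apply, hGb, hFb]; rfl
    · rw [AlgHom.comp_apply, hGa, hFι, hg]; rfl
  · refine TensorAlg.hom_ext (fun c => ?_) (fun m => ?_)
    · rw [AlgHom.comp_apply, hFb, hGb]; rfl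
    · rw [AlgHom.comp_apply, hFι]
      exact LinearMap.congr_fun (b.ext (f₁ := G.toLinearMap ∘ₗ g) (f₂ := TensorAlg.ιₗ k (V → k) M)
        fun a => (congrArg G (hg a)).trans (hGa a)) m

end ArrowBasis

/-! ### Arrow bimodules and double quivers -/

section ArrowBimodule

namespace ArrowBimodule

variable {k V : Type*} [Field k] [Quiver V] [Fintype (Arrows V)]

lemma smul_ofArrow (f : V → k) (a : Arrows V) : f • ofArrow k a = f a.1 • ofArrow k a :=
  funext fun b => by
    change f b.1 * ofArrow k a b = f a.1 * ofArrow k a b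
    by_cases h : b = a
    · rw [h]
    · rw [ofArrow, if_neg h, mul_zero, mul_zero]

lemma op_smul_ofArrow (f : V → k) (a : Arrows V) :
    op f • ofArrow k a = f a.2.1 • ofArrow k a :=
  funext fun b => by
    change f b.2.1 * ofArrow k a b = f a.2.1 * ofArrow k a b
    by_cases h : b = a
    · rw [h]
    · rw [ofArrow, if_neg h, mul_zero, mul_zero]

lemma smul_dualArrow (f : V → k) (a : Arrows V) :
    f • dualArrow k a = f a.2.1 • dualArrow k a := rfl

lemma op_smul_dualArrow (f : V → k) (a : Arrows V) :
    op f • dualArrow k a = f a.1 • dualArrow k a := rfl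

lemma sum_smul_ofArrow (x : ArrowBimodule k V) : ∑ a, x a • ofArrow k a = x := by
  classical
  refine funext fun b => (Fintype.sum_apply b _).trans ?_
  change ∑ a, x a * ofArrow k a b = x b
  rw [Finset.sum_eq_single b]
  · rw [ofArrow, if_pos rfl, mul_one]
  · intro a _ h
    rw [ofArrow, if_neg (Ne.symm h), mul_zero]
  · simp

variable (k V) in
/-- The basis of the arrow bimodule. -/
def basis : Module.Basis (Arrows V) k (ArrowBimodule k V) := Pi.basisFun k (Arrows V)

lemma basis_apply (a : Arrows V) : basis k V a = ofArrow k a := by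
  classical
  refine (Pi.basisFun_apply k (Arrows V) a).trans (funext fun b => ?_)
  rw [Pi.single_apply, ofArrow]

variable (k V) in
open Classical in
/-- The dual basis of the arrow bimodule. -/
def dualBasis : Module.Basis (Arrows V) k (BDual k (ArrowBimodule k V)) := (basis k V).dualBasis

lemma dualBasis_apply (a : Arrows V) : dualBasis k V a = dualArrow k a := by
  classical
  refine BDual.ext fun x => ?_
  refine ((basis k V).dualBasis_apply a x).trans ?_
  exact Pi.basisFun_repr k (Arrows V) x a

end ArrowBimodule

variable {k V : Type*} [Field k] [Quiver V] [Fintype V] [Fintype (Arrows V)]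

lemma exists_tensorAlg_equiv_pathAlgebra :
    ∃ e : TensorAlg k (V → k) (ArrowBimodule k V) ≃ₐ[k] PathAlgebra k V,
      (∀ f : V → k, e (TensorAlg.base k _ _ f)
        = ∑ i : V, f i • PathAlgebra.ofPath k (Quiver.Path.nil : Quiver.Path i i)) ∧
      (∀ a : Arrows V, e (TensorAlg.ι k _ _ (ArrowBimodule.ofArrow k a))
        = PathAlgebra.ofArrow k a.2.2) := by
  obtain ⟨e, he, he'⟩ := exists_equiv_pathAlgebra (ArrowBimodule.basis k V)
    (fun f a => by rw [ArrowBimodule.basis_apply, ArrowBimodule.smul_ofArrow])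
    (fun f a => by rw [ArrowBimodule.basis_apply, ArrowBimodule.op_smul_ofArrow])
  refine ⟨e, fun f => (he f).trans (PathAlgebra.vertexHom_apply f), fun a => ?_⟩
  rw [← ArrowBimodule.basis_apply, he']

variable (k V) in
lemma isRho_sum : IsRho (stdSymmetrising k V) (ArrowBimodule k V)
    (∑ a : Arrows V, BTensor.tmul k (V → k)
      (ArrowBimodule.ofArrow k a) (ArrowBimodule.dualArrow k a)) := by
  classical
  refine LinearMap.ext fun x => ?_
  rw [map_sum, LinearMap.sum_apply, LinearMap.id_apply]
  refine Eq.trans (Finset.sum_congr rfl fun a _ => ?_) (ArrowBimodule.sum_smul_ofArrow x)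
  rw [evRight_tmul, ArrowBimodule.op_smul_ofArrow]
  congr 1
  have h := (stdSymmetrising k V).apply_rmod_mul (ArrowBimodule.dualArrow k a) x
    (Pi.single a.2.1 1)
  -- Only the coordinate of `a*^r(x)` at the target of `a` matters, and `σ(- e_i)` reads it off.
  have h2 : ∀ g : V → k, (stdSymmetrising k V).toFun (g * Pi.single a.2.1 1) = g a.2.1 :=
    fun g => by simp [stdSymmetrising, Pi.single_apply]
  rw [h2] at h
  refine h.trans ?_
  change (Pi.single a.2.1 1 : V → k) a.2.1 * x a = x a
  rw [Pi.single_eq_same, one_mul]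

variable (k V) in
lemma isEll_sum : IsEll (stdSymmetrising k V) (ArrowBimodule k V)
    (∑ a : Arrows V, BTensor.tmul k (V → k)
      (ArrowBimodule.dualArrow k a) (ArrowBimodule.ofArrow k a)) := by
  classical
  refine LinearMap.ext fun x => ?_
  rw [map_sum, LinearMap.sum_apply, LinearMap.id_apply]
  refine Eq.trans (Finset.sum_congr rfl fun a _ => ?_) (ArrowBimodule.sum_smul_ofArrow x)
  rw [evLeft_tmul, ArrowBimodule.smul_ofArrow]
  congr 1
  have h := (stdSymmetrising k V).apply_lmod_mul (ArrowBimodule.dualArrow k a) x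
    (Pi.single a.1 1)
  -- Only the coordinate of `a*^l(x)` at the source of `a` matters, and `σ(- e_i)` reads it off.
  have h2 : ∀ g : V → k, (stdSymmetrising k V).toFun (g * Pi.single a.1 1) = g a.1 :=
    fun g => by simp [stdSymmetrising, Pi.single_apply]
  rw [h2] at h
  refine h.trans ?_
  change (Pi.single a.1 1 : V → k) a.1 * x a = x a
  rw [Pi.single_eq_same, one_mul]

/-- The arrows of the double quiver are the arrows of the quiver and their reverses. -/
def arrowsSymmetrifyEquiv (V : Type*) [Quiver V] :
    Arrows V ⊕ Arrows V ≃ Arrows (Quiver.Symmetrify V) where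
  toFun := Sum.elim (fun a => ⟨a.1, a.2.1, Quiver.Hom.toPos a.2.2⟩)
    (fun a => ⟨a.2.1, a.1, Quiver.Hom.toNeg a.2.2⟩)
  invFun
    | ⟨i, j, Sum.inl a⟩ => Sum.inl ⟨i, j, a⟩
    | ⟨i, j, Sum.inr a⟩ => Sum.inr ⟨j, i, a⟩
  left_inv := by rintro (a | a) <;> rfl
  right_inv := by rintro ⟨i, j, a | a⟩ <;> rfl

lemma exists_doubleAlg_equiv_pathAlgebra :
    ∃ e : DoubleAlg k (V → k) (ArrowBimodule k V) ≃ₐ[k] PathAlgebra k (Quiver.Symmetrify V),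
      (∀ f : V → k, e (TensorAlg.base k _ _ f)
        = ∑ i : Quiver.Symmetrify V,
          f i • PathAlgebra.ofPath k (Quiver.Path.nil : Quiver.Path i i)) ∧
      (∀ a : Arrows V, e (DoubleAlg.inM k _ (ArrowBimodule.ofArrow k a))
        = PathAlgebra.ofArrow k (Quiver.Hom.toPos a.2.2)) ∧
      (∀ a : Arrows V, e (DoubleAlg.inD k _ (ArrowBimodule.dualArrow k a))
        = PathAlgebra.ofArrow k (Quiver.Hom.toNeg a.2.2)) := by
  let b : Module.Basis (Arrows V ⊕ Arrows V) k
      (ArrowBimodule k V × BDual k (ArrowBimodule k V)) :=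
    (ArrowBimodule.basis k V).prod (ArrowBimodule.dualBasis k V)
  have hb1 : ∀ a, b (Sum.inl a) = (ArrowBimodule.ofArrow k a, 0) := fun a => by
    rw [Module.Basis.prod_apply, ← ArrowBimodule.basis_apply]; rfl
  have hb2 : ∀ a, b (Sum.inr a) = (0, ArrowBimodule.dualArrow k a) := fun a => by
    rw [Module.Basis.prod_apply, ← ArrowBimodule.dualBasis_apply]; rfl
  have hl : ∀ (f : V → k) a, f • b a = f (arrowsSymmetrifyEquiv V a).1 • b a := by
    rintro f (a | a)
    · rw [hb1, Prod.smul_mk, Prod.smul_mk, smul_zero, smul_zero, ArrowBimodule.smul_ofArrow]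
      rfl
    · rw [hb2, Prod.smul_mk, Prod.smul_mk, smul_zero, smul_zero, ArrowBimodule.smul_dualArrow]
      rfl
  have hr : ∀ (f : V → k) a, op f • b a = f (arrowsSymmetrifyEquiv V a).2.1 • b a := by
    rintro f (a | a)
    · rw [hb1, Prod.smul_mk, Prod.smul_mk, smul_zero, smul_zero, ArrowBimodule.op_smul_ofArrow]
      rfl
    · rw [hb2, Prod.smul_mk, Prod.smul_mk, smul_zero, smul_zero, ArrowBimodule.op_smul_dualArrow]
      rfl
  have hbr : ∀ a, b.reindex (arrowsSymmetrifyEquiv V) (arrowsSymmetrifyEquiv V a) = b a :=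
    fun a => by rw [Module.Basis.reindex_apply, Equiv.symm_apply_apply]
  -- The vertices are taken in `V` rather than in its synonym `Quiver.Symmetrify V`, as it is over
  -- `k^V` that the bimodule structure is found.
  obtain ⟨e, he, he'⟩ := exists_equiv_pathAlgebra (V := V) (q := Quiver.symmetrifyQuiver V)
    (b.reindex (arrowsSymmetrifyEquiv V))
    (fun f a => by
      obtain ⟨a, rfl⟩ := (arrowsSymmetrifyEquiv V).surjective a
      exact (congrArg (f • ·) (hbr a)).trans
        ((hl f a).trans (congrArg (f (arrowsSymmetrifyEquiv V a).1 • ·) (hbr a).symm)))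
    (fun f a => by
      obtain ⟨a, rfl⟩ := (arrowsSymmetrifyEquiv V).surjective a
      exact (congrArg (op f • ·) (hbr a)).trans
        ((hr f a).trans (congrArg (f (arrowsSymmetrifyEquiv V a).2.1 • ·) (hbr a).symm)))
  have hι : ∀ a, e (TensorAlg.ι k _ _ (b a))
      = PathAlgebra.ofArrow k (arrowsSymmetrifyEquiv V a).2.2 := fun a =>
    (congrArg (fun z => e (TensorAlg.ι k _ _ z)) (hbr a).symm).trans
      (he' (arrowsSymmetrifyEquiv V a))
  refine ⟨e, fun f => (he f).trans (PathAlgebra.vertexHom_apply (V := Quiver.Symmetrify V) f),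
    fun a => ?_, fun a => ?_⟩
  · have := hι (Sum.inl a)
    rw [hb1] at this
    exact this
  · have := hι (Sum.inr a)
    rw [hb2] at this
    exact this

lemma map_cElement_eq_commutatorSum
    (e : DoubleAlg k (V → k) (ArrowBimodule k V) ≃ₐ[k] PathAlgebra k (Quiver.Symmetrify V))
    (hM : ∀ a : Arrows V, e (DoubleAlg.inM k _ (ArrowBimodule.ofArrow k a))
      = PathAlgebra.ofArrow k (Quiver.Hom.toPos a.2.2))
    (hD : ∀ a : Arrows V, e (DoubleAlg.inD k _ (ArrowBimodule.dualArrow k a))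
      = PathAlgebra.ofArrow k (Quiver.Hom.toNeg a.2.2))
    {ρ : BTensor k (V → k) (ArrowBimodule k V) (BDual k (ArrowBimodule k V))}
    {ℓ : BTensor k (V → k) (BDual k (ArrowBimodule k V)) (ArrowBimodule k V)}
    (hρ : IsRho (stdSymmetrising k V) (ArrowBimodule k V) ρ)
    (hℓ : IsEll (stdSymmetrising k V) (ArrowBimodule k V) ℓ) :
    e (cElement k _ ρ ℓ) = commutatorSum k V := by
  rw [(existsUnique_isRho (stdSymmetrising k V) (ArrowBimodule k V)).unique hρ (isRho_sum k V),
    (existsUnique_isEll (stdSymmetrising k V) (ArrowBimodule k V)).unique hℓ (isEll_sum k V),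
    cElement, map_sum, map_sum, ← Finset.sum_sub_distrib, map_sum, commutatorSum]
  refine Finset.sum_congr rfl fun a _ => ?_
  rw [map_sub, DoubleAlg.inMD, DoubleAlg.inDM, BTensor.lift_tmul, BTensor.lift_tmul, ← hM, ← hD,
    ← map_mul, ← map_mul]
  rfl

end ArrowBimodule

/-! ### Preprojective algebras -/

section Preprojective

variable {k : Type u} [Field k] {A : Type u} [Ring A] [Algebra k A] [FiniteDimensional k A]
  [IsSemisimpleRing A] (σ : SymmetrisingElement k A) {M : Type u} [AddCommGroup M] [Module k M]
  [Module A M] [Module Aᵐᵒᵖ M] [SMulCommClass A Aᵐᵒᵖ M] [IsScalarTower k A M]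
  [IsScalarTower k Aᵐᵒᵖ M] [FiniteDimensional k M] [FiniteDimensional k (TensorAlg k A M)]
  {ρ : BTensor k A M (BDual k M)} {ℓ : BTensor k A (BDual k M) M}

lemma Mho.tensorAlgEquiv_cBar (hρ : IsRho σ M ρ) (hℓ : IsEll σ M ℓ) :
    Mho.tensorAlgEquiv σ (TensorAlg.ι k _ _ (cBar (TensorAlg k A M) σ)) = cElement k A ρ ℓ :=
  (Mho.tensorAlgEquiv_ι σ _).trans (Mho.toDouble_cBar hρ hℓ)

/-- The quotient of `T_Λ(℧)` by `c̄` is the quotient of `T_A(M ⊕ DM)` by `c`. -/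
def quotByCBarEquiv (hρ : IsRho σ M ρ) (hℓ : IsEll σ M ℓ) :
    QuotBy (TensorAlg.ι k (TensorAlg k A M) (Mho k A (TensorAlg k A M))
      (cBar (TensorAlg k A M) σ)) ≃ₐ[k] QuotBy (cElement k A ρ ℓ) :=
  QuotBy.congr (Mho.tensorAlgEquiv σ) _ _ (Mho.tensorAlgEquiv_cBar σ hρ hℓ)

end Preprojective

end

end Preproj

theorem mainTheorem10 (k : Type u) [Field k] :
    -- finite dimensional hereditary tensor algebras `Λ = T_A(M)`
    (∀ (A : Type u) [Ring A] [Algebra k A] [FiniteDimensional k A] [IsSemisimpleRing A]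
      (σ : SymmetrisingElement k A)
      (M : Type u) [AddCommGroup M] [Module k M] [Module A M] [Module Aᵐᵒᵖ M]
      [SMulCommClass A Aᵐᵒᵖ M] [IsScalarTower k A M] [IsScalarTower k Aᵐᵒᵖ M]
      [FiniteDimensional k M] [FiniteDimensional k (TensorAlg k A M)],
      (∃! ρ : BTensor k A M (BDual k M), IsRho σ M ρ) ∧
      (∃! ℓ : BTensor k A (BDual k M) M, IsEll σ M ℓ) ∧
      ∀ (ρ : BTensor k A M (BDual k M)) (ℓ : BTensor k A (BDual k M) M),
        IsRho σ M ρ → IsEll σ M ℓ →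
        (∃ e : TensorAlg k (TensorAlg k A M) (Mho k A (TensorAlg k A M)) ≃ₐ[k] DoubleAlg k A M,
          (∀ a : A, e (TensorAlg.base k _ _ (TensorAlg.base k A M a)) = TensorAlg.base k A _ a) ∧
          (∀ m : M, e (TensorAlg.base k _ _ (TensorAlg.ι k A M m)) = DoubleAlg.inM k A m) ∧
          e (TensorAlg.ι k _ _ (cBar (TensorAlg k A M) σ)) = cElement k A ρ ℓ) ∧
        Nonempty (TensorAlg k (TensorAlg k A M) (PiOne (TensorAlg k A M) σ) ≃ₐ[k]
          QuotBy (cElement k A ρ ℓ)) ∧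
        Nonempty (TensorAlg k (TensorAlg k A M) (TauMinus k (TensorAlg k A M)) ≃ₐ[k]
          QuotBy (cElement k A ρ ℓ))) ∧
    -- quivers
    (∀ (V : Type u) [Quiver.{u} V] [Fintype V] [Fintype (Arrows V)],
      (∃ e : TensorAlg k (V → k) (ArrowBimodule k V) ≃ₐ[k] PathAlgebra k V,
        (∀ f : V → k, e (TensorAlg.base k _ _ f)
          = ∑ i : V, f i • PathAlgebra.ofPath k (Quiver.Path.nil : Quiver.Path i i)) ∧
        (∀ a : Arrows V, e (TensorAlg.ι k _ _ (ArrowBimodule.ofArrow k a))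
          = PathAlgebra.ofArrow k a.2.2)) ∧
      IsRho (stdSymmetrising k V) (ArrowBimodule k V)
        (∑ a : Arrows V, BTensor.tmul k (V → k)
          (ArrowBimodule.ofArrow k a) (ArrowBimodule.dualArrow k a)) ∧
      IsEll (stdSymmetrising k V) (ArrowBimodule k V)
        (∑ a : Arrows V, BTensor.tmul k (V → k)
          (ArrowBimodule.dualArrow k a) (ArrowBimodule.ofArrow k a)) ∧
      ∀ (ρ : BTensor k (V → k) (ArrowBimodule k V) (BDual k (ArrowBimodule k V)))
        (ℓ : BTensor k (V → k) (BDual k (ArrowBimodule k V)) (ArrowBimodule k V)),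
        IsRho (stdSymmetrising k V) (ArrowBimodule k V) ρ →
        IsEll (stdSymmetrising k V) (ArrowBimodule k V) ℓ →
        (∃ e : DoubleAlg k (V → k) (ArrowBimodule k V) ≃ₐ[k]
            PathAlgebra k (Quiver.Symmetrify V),
          (∀ f : V → k, e (TensorAlg.base k _ _ f)
            = ∑ i : Quiver.Symmetrify V,
              f i • PathAlgebra.ofPath k (Quiver.Path.nil : Quiver.Path i i)) ∧
          (∀ a : Arrows V, e (DoubleAlg.inM k _ (ArrowBimodule.ofArrow k a))
            = PathAlgebra.ofArrow k (Quiver.Hom.toPos a.2.2)) ∧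
          (∀ a : Arrows V, e (DoubleAlg.inD k _ (ArrowBimodule.dualArrow k a))
            = PathAlgebra.ofArrow k (Quiver.Hom.toNeg a.2.2)) ∧
          e (cElement k _ ρ ℓ) = commutatorSum k V) ∧
        Nonempty (QuotBy (cElement k (V → k) ρ ℓ) ≃ₐ[k] QuotBy (commutatorSum k V)) ∧
        (FiniteDimensional k (PathAlgebra k V) →
          Nonempty (TensorAlg k (TensorAlg k (V → k) (ArrowBimodule k V))
              (TauMinus k (TensorAlg k (V → k) (ArrowBimodule k V))) ≃ₐ[k]
            QuotBy (commutatorSum k V)))) := by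
  refine ⟨?_, ?_⟩
  · intro A _ _ _ _ σ M _ _ _ _ _ _ _ _ _
    refine ⟨existsUnique_isRho σ M, existsUnique_isEll σ M, fun ρ ℓ hρ hℓ => ⟨?_, ?_, ?_⟩⟩
    · refine ⟨Mho.tensorAlgEquiv σ, fun a => ?_, fun m => ?_, Mho.tensorAlgEquiv_cBar σ hρ hℓ⟩
      · rw [Mho.tensorAlgEquiv_base, DoubleAlg.inΛ_base]
      · rw [Mho.tensorAlgEquiv_base, DoubleAlg.inΛ_ι]
    · exact ⟨(tensorAlgPiOneEquiv (TensorAlg k A M) σ).trans (quotByCBarEquiv σ hρ hℓ)⟩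
    · exact ⟨(tensorAlgTauMinusEquiv (TensorAlg k A M) σ).trans (quotByCBarEquiv σ hρ hℓ)⟩
  · intro V _ _ _
    refine ⟨exists_tensorAlg_equiv_pathAlgebra, isRho_sum k V, isEll_sum k V,
      fun ρ ℓ hρ hℓ => ?_⟩
    obtain ⟨e, he, hM, hD⟩ := exists_doubleAlg_equiv_pathAlgebra (k := k) (V := V)
    have hc := map_cElement_eq_commutatorSum e hM hD hρ hℓ
    have eQ := QuotBy.congr e _ _ hc
    refine ⟨⟨e, he, hM, hD, hc⟩, ⟨eQ⟩, fun _ => ?_⟩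
    -- `kQ` and `Λ` are isomorphic, so that the first part applies to `Λ`.
    obtain ⟨e', -⟩ := exists_tensorAlg_equiv_pathAlgebra (k := k) (V := V)
    have : FiniteDimensional k (TensorAlg k (V → k) (ArrowBimodule k V)) :=
      e'.symm.toLinearEquiv.finiteDimensional
    exact ⟨((tensorAlgTauMinusEquiv _ (stdSymmetrising k V)).trans
      (quotByCBarEquiv (stdSymmetrising k V) hρ hℓ)).trans eQ⟩
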